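/- Let $(M,g)$ be a smooth spacetime, i.e. a smooth Hausdorff second countable $d$-manifold with a smooth Lorentzian metric of signature $(-,+,\dots,+)$, time-oriented by a continuous timelike vector field. Causal curves are future-directed, piecewise $C^1$, with nonzero timelike or null velocity, and defined on an interval; such a curve is inextendible if it has neither a past nor a future end point in $M$. For $S\subseteq M$, the sets $J^{\pm}(S)\supseteq S$ are the causal future and past of $S$, and $D(S)$ is the set of points $p$ such that every inextendible causal curve through $p$ meets $S$. A time function is a $C^1$ function $T:M\to\mathbb{R}$ that strictly increases along every future-directed causal curve; a timeslice is a level set of a time function. A set $\Sigma'$ is a Cauchy evolution of $\Sigma$ forward in time within $U$ if $$D(\Sigma')=D(\Sigma),\qquad \Sigma'\subseteq J^+(\Sigma),\qquad \Sigma\subseteq J^-(\Sigma'),\qquad \Sigma\,\Delta\,\Sigma'\subseteq U,\qquad \bigl(J^+(\Sigma)\cap J^-(\Sigma')\bigr)\setminus\Sigma\subseteq U .$$ **Proposition (Timeslices can be deformed).** Let $k\in\{1,2,\dots,\infty\}$, let $\Sigma\subseteq M$ be a timeslice that is a level set of a time function of class $C^k$, let $X\subseteq\Sigma$ be compact and let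 $U\supseteq X$ be open in $M$. Then there exists a timeslice $\Sigma'$, again a level set of a time function of class $C^k$, such that $\Sigma'$ is a Cauchy evolution of $\Sigma$ forward in time within $U$ and $$\Sigma'\cap\Sigma\cap X=\varnothing .$$ -/

import Mathlib

open Set Topology
open scoped Manifold ContDiff

namespace Spacetime

section

variable {d : ℕ} {M : Type*} [TopologicalSpace M] [ChartedSpace (EuclideanSpace ℝ (Fin d)) M]

/-- A smooth Lorentzian metric of signature `(-, +, …, +)` on a smooth `d`-manifold: a smooth
field of symmetric bilinear forms on the tangent spaces such that at each point some vector `v`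
satisfies `g(v, v) < 0` and `g` is positive definite on the orthogonal complement of `v`. -/
structure LorentzianMetric (d : ℕ) (M : Type*) [TopologicalSpace M]
    [ChartedSpace (EuclideanSpace ℝ (Fin d)) M] [IsManifold (𝓡 d) ∞ M] where
  /-- the bilinear form on the tangent space at `x` -/
  form (x : M) : TangentSpace (𝓡 d) x →L[ℝ] TangentSpace (𝓡 d) x →L[ℝ] ℝ
  symm (x : M) (v w : TangentSpace (𝓡 d) x) : form x v w = form x w v
  signature (x : M) : ∃ v : TangentSpace (𝓡 d) x, form x v v < 0 ∧
    ∀ w : TangentSpace (𝓡 d) x, form x v w = 0 → w ≠ 0 → 0 < form x w w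
  contMDiff : ContMDiff (𝓡 d)
    ((𝓡 d).prod 𝓘(ℝ, EuclideanSpace ℝ (Fin d) →L[ℝ] EuclideanSpace ℝ (Fin d) →L[ℝ] ℝ)) ∞
    (fun x : M ↦ Bundle.TotalSpace.mk'
      (EuclideanSpace ℝ (Fin d) →L[ℝ] EuclideanSpace ℝ (Fin d) →L[ℝ] ℝ)
      (E := fun x : M ↦ TangentSpace (𝓡 d) x →L[ℝ] TangentSpace (𝓡 d) x →L[ℝ] ℝ) x (form x))

variable [IsManifold (𝓡 d) ∞ M]

/-- A time orientation: a continuous timelike vector field, which points to the future. -/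
structure TimeOrientation (g : LorentzianMetric d M) where
  /-- the value at `x` of the vector field -/
  field (x : M) : TangentSpace (𝓡 d) x
  timelike (x : M) : g.form x (field x) (field x) < 0
  continuous : Continuous (fun x : M ↦ (⟨x, field x⟩ : TangentBundle (𝓡 d) M))

variable {g : LorentzianMetric d M} (τ : TimeOrientation g)

/-- `v` is a future-directed causal (timelike or null, nonzero) tangent vector. -/
def IsFutureCausal {x : M} (v : TangentSpace (𝓡 d) x) : Prop :=
  v ≠ 0 ∧ g.form x v v ≤ 0 ∧ g.form x v (τ.field x) < 0

/-- `γ` is `C¹` on `[a, b]` with future-directed causal velocity (one-sided at the end points). -/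
def IsC1CausalOn (γ : ℝ → M) (a b : ℝ) : Prop :=
  ContMDiffOn 𝓘(ℝ, ℝ) (𝓡 d) 1 γ (Icc a b) ∧
    ∀ s ∈ Icc a b,
      IsFutureCausal τ (mfderivWithin 𝓘(ℝ, ℝ) (𝓡 d) γ (Icc a b) s (1 : ℝ) :
        TangentSpace (𝓡 d) (γ s))

/-- `γ`, restricted to the interval `I`, is a future-directed, piecewise `C¹` causal curve:
every parameter `t ∈ I` which is not the maximum of `I` is the left end of a subinterval of `I` on
which `γ` is a `C¹` future-directed causal curve, and symmetrically on the left. (Hence the break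
points form a locally finite subset of `I`.) -/
structure IsCausalCurveOn (γ : ℝ → M) (I : Set ℝ) : Prop where
  ordConnected : I.OrdConnected
  right : ∀ t ∈ I, ∀ u ∈ I, t < u → ∃ b ∈ Ioc t u, IsC1CausalOn τ γ t b
  left : ∀ t ∈ I, ∀ u ∈ I, u < t → ∃ a ∈ Ico u t, IsC1CausalOn τ γ a t

/-- `p` is a future end point of the curve `γ` on `I`. -/
def IsFutureEndpoint (γ : ℝ → M) (I : Set ℝ) (p : M) : Prop :=
  ∀ V ∈ 𝓝 p, ∃ t₀ ∈ I, ∀ t ∈ I, t₀ ≤ t → γ t ∈ V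

/-- `p` is a past end point of the curve `γ` on `I`. -/
def IsPastEndpoint (γ : ℝ → M) (I : Set ℝ) (p : M) : Prop :=
  ∀ V ∈ 𝓝 p, ∃ t₀ ∈ I, ∀ t ∈ I, t ≤ t₀ → γ t ∈ V

/-- An inextendible causal curve: it has neither a future nor a past end point. -/
def IsInextendibleCausalCurve (γ : ℝ → M) (I : Set ℝ) : Prop :=
  IsCausalCurveOn τ γ I ∧ ∀ p : M, ¬ IsFutureEndpoint γ I p ∧ ¬ IsPastEndpoint γ I p

/-- The causal future `J⁺(S)`, which contains `S`. -/
def causalFuture (S : Set M) : Set M :=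
  {q | ∃ p ∈ S, p = q ∨ ∃ (γ : ℝ → M) (a b : ℝ), a < b ∧ IsCausalCurveOn τ γ (Icc a b) ∧
    γ a = p ∧ γ b = q}

/-- The causal past `J⁻(S)`, which contains `S`. -/
def causalPast (S : Set M) : Set M :=
  {q | ∃ p ∈ S, q = p ∨ ∃ (γ : ℝ → M) (a b : ℝ), a < b ∧ IsCausalCurveOn τ γ (Icc a b) ∧
    γ a = q ∧ γ b = p}

/-- The domain of dependence `D(S)`: the points `p` such that every inextendible causal curve
through `p` meets `S`. -/
def domainOfDependence (S : Set M) : Set M :=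
  {p | ∀ (γ : ℝ → M) (I : Set ℝ), IsInextendibleCausalCurve τ γ I → p ∈ γ '' I →
    (γ '' I ∩ S).Nonempty}

/-- A time function: a `C¹` function which strictly increases along every future-directed causal
curve. -/
structure IsTimeFunction (T : M → ℝ) : Prop where
  contMDiff : ContMDiff (𝓡 d) 𝓘(ℝ, ℝ) 1 T
  strictMonoOn : ∀ (γ : ℝ → M) (I : Set ℝ), IsCausalCurveOn τ γ I → StrictMonoOn (T ∘ γ) I

/-- `S` is a level set of a time function of class `C^k`. For `k = 1` this says that `S` is a
timeslice; larger `k` records the smoothness of a corresponding time function. -/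
def IsTimeslice (k : ℕ∞) (S : Set M) : Prop :=
  ∃ (T : M → ℝ) (c : ℝ), IsTimeFunction τ T ∧ ContMDiff (𝓡 d) 𝓘(ℝ, ℝ) k T ∧ S = T ⁻¹' {c}

/-- `S'` is a Cauchy evolution of `S` forward in time within `U`: the two sets have the same domain
of dependence, `S'` lies in the future of `S`, and both the places where they differ and
the region between them lie in `U`. -/
structure IsForwardCauchyEvolution (U S S' : Set M) : Prop where
  domain : domainOfDependence τ S' = domainOfDependence τ S
  future : S' ⊆ causalFuture τ S
  past : S ⊆ causalPast τ S'
  differ : symmDiff S S' ⊆ U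
  between : (causalFuture τ S ∩ causalPast τ S') \ S ⊆ U

end

end Spacetime

/-! ### Cone fields and almost causal chains -/

namespace Spacetime

open Filter Metric

/-! Write the timeslice as the zero set of a time function `T₀`. Subtracting a small bump from `T₀`
does not work: the differential of a `C¹` time function may vanish on causal vectors, so strict
increase along curves leaves no margin for a perturbation. Instead, each point `p` of `X` gets a
smooth function `h` on a coordinate ball whose differential is positive on all causal vectors, with
`h p < 0` and `h ≥ T₀ + δ` on a spherical layer around `p` (`exists_local_time`). Let `θ` vanish up
to `-δ`, be positive beyond, and have slope between 0 and 1. Then `T - θ (T - h)` increases with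
both `T` and `h`, so it is again a time function; it equals `T` outside a compact core, and it is
negative where `T ≤ 0` and `h < 0`. Finitely many such deformations cover `X`. They compose because
only `T ≤ T₀` is needed, and this inequality is preserved.

The function `h` smooths the indicator of the complement of the almost causal past of `p`: the
points from which a chain of short steps, causal up to an error `ε`, leads close to `p`. The allowed
error absorbs the variation of the cones under smoothing. What must be shown is that, away from `p`,
this set stays below the level `T₀ = 0` for small `ε` (`exists_almostPast_bound`). Otherwise chains
with `ε → 0` converge to a Lipschitz curve ending at `p` on which `T₀` is nondecreasing, starts at a
value at least 0 and ends at 0; so `T₀` vanishes along it. Time functions are only known to increase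
along piecewise `C¹` curves, so regularity is needed: since `T₀` is constant, no chord lies well
inside the cones, and strict convexity of the cones bounds the second differences by `D ^ (5 / 4)`.
The curve is therefore `C¹` with causal velocity, contradicting strict increase.

The domain of dependence does not change because an inextendible causal curve cannot stay in the
compact core (`meets_iff`), and causal curves crossing the core in a fixed coordinate direction
connect the old and new slices. -/

/-- A field of convex cones `{v | 0 ≤ f y v}` on a ball of a normed space, given by superadditive,
positively homogeneous functions `f y` which are Hölder continuous in `y`, together with a linear
form `l` which controls the norm on slightly wider cones, a vector `e` in the interior of all cones,
and a quantitative form of the strict convexity of the cones. -/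
structure ConeField (E : Type*) [NormedAddCommGroup E] [NormedSpace ℝ E] (p : E) (R : ℝ) where
  /-- the function that is nonnegative on the cone -/
  f : E → E → ℝ
  /-- the linear form -/
  l : E →L[ℝ] ℝ
  /-- the interior vector -/
  e : E
  /-- a large constant -/
  C : ℝ
  /-- a small constant -/
  κ : ℝ
  one_le_C : 1 ≤ C
  κ_pos : 0 < κ
  add_le : ∀ y ∈ ball p R, ∀ v w, f y v + f y w ≤ f y (v + w)
  smul : ∀ y ∈ ball p R, ∀ (c : ℝ) v, 0 ≤ c → f y (c • v) = c * f y v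
  holder : ∀ y ∈ ball p R, ∀ y' ∈ ball p R, ∀ v, |f y v - f y' v| ≤ C * √‖y - y'‖ * ‖v‖
  bound : ∀ y ∈ ball p R, ∀ v, |f y v| ≤ C * ‖v‖
  narrow : ∀ y ∈ ball p R, ∀ v, -(κ * ‖v‖) ≤ f y v → ‖v‖ ≤ C * l v
  interior : ∀ y ∈ ball p R, κ ≤ f y e
  strict : ∀ y ∈ ball p R, ∀ v w η, 0 ≤ η → l v = l w → -η ≤ f y v → -η ≤ f y w →
    f y (v + w) ≤ η → ‖v - w‖ ^ 2 ≤ C * η * (‖v‖ + ‖w‖ + η)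

namespace ConeField

variable {E : Type*} [NormedAddCommGroup E] [NormedSpace ℝ E] {p : E} {R : ℝ}
  (F : ConeField E p R)

lemma C_pos : 0 < F.C := zero_lt_one.trans_le F.one_le_C

lemma zero {y : E} (hy : y ∈ ball p R) : F.f y 0 = 0 := by
  simpa using F.smul y hy 0 0 le_rfl

/-- Superadditivity for `v = w + (v - w)` and for `w = v + (w - v)` turns the linear bound into a
Lipschitz bound. -/
lemma sub_le {y : E} (hy : y ∈ ball p R) (v w : E) : |F.f y v - F.f y w| ≤ F.C * ‖v - w‖ := by
  have h1 := F.add_le y hy w (v - w)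
  have h2 := F.add_le y hy v (w - v)
  have h3 := abs_le.1 (F.bound y hy (v - w))
  have h4 := abs_le.1 (F.bound y hy (w - v))
  rw [add_sub_cancel] at h1 h2
  rw [norm_sub_rev w v] at h4
  rw [abs_le]; constructor <;> linarith [h3.1, h4.1]

lemma tendsto {α : Type*} {u : Filter α} {a b : α → E} {y v : E} (ha : Tendsto a u (𝓝 y))
    (hb : Tendsto b u (𝓝 v)) (hy : y ∈ ball p R) :
    Tendsto (fun i ↦ F.f (a i) (b i)) u (𝓝 (F.f y v)) := by
  have ev : ∀ᶠ i in u, a i ∈ ball p R := ha.eventually (isOpen_ball.mem_nhds hy)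
  rw [tendsto_iff_norm_sub_tendsto_zero]
  have lim : Tendsto (fun i ↦ F.C * √‖a i - y‖ * ‖b i‖ + F.C * ‖b i - v‖) u (𝓝 0) := by
    have h1 : Tendsto (fun i ↦ √‖a i - y‖) u (𝓝 0) := by
      have := (tendsto_iff_norm_sub_tendsto_zero.1 ha).sqrt
      simpa using this
    have h2 := tendsto_iff_norm_sub_tendsto_zero.1 hb
    have := ((h1.const_mul F.C).mul hb.norm).add (h2.const_mul F.C)
    simpa using this
  refine squeeze_zero' (Eventually.of_forall fun _ ↦ norm_nonneg _) ?_ lim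
  filter_upwards [ev] with i hi
  have h1 := F.holder _ hi y hy (b i)
  have h2 := F.sub_le hy (b i) v
  rw [Real.norm_eq_abs]
  calc |F.f (a i) (b i) - F.f y v| ≤ _ := abs_sub_le _ (F.f y (b i)) _
    _ ≤ _ := add_le_add h1 h2

lemma norm_le {y v : E} (hy : y ∈ ball p R) (hv : 0 ≤ F.f y v) : ‖v‖ ≤ F.C * F.l v :=
  F.narrow y hy v ((neg_nonpos.2 (mul_nonneg F.κ_pos.le (norm_nonneg _))).trans hv)

/-- The step relation of chains in the ball of radius `r` with mesh `ε`, whose steps are causal up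
to an error `ε`. -/
def Step (r ε : ℝ) (a b : E) : Prop :=
  a ∈ ball p r ∧ ‖b - a‖ < ε ∧ -(ε * ‖b - a‖) < F.f a (b - a)

/-- The points from which an almost causal chain leads to the ball of radius `ε`. -/
def almostPast (r ε : ℝ) : Set E :=
  {q | ∃ (N : ℕ) (c : ℕ → E), c 0 = q ∧ c N ∈ ball p ε ∧ ∀ i < N, F.Step r ε (c i) (c (i + 1))}

lemma ball_subset_almostPast (r ε : ℝ) : ball p ε ⊆ F.almostPast r ε :=
  fun q hq ↦ ⟨0, fun _ ↦ q, rfl, hq, by simp⟩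

lemma almostPast_of_step {r ε : ℝ} {a b : E} (h : F.Step r ε a b) (hb : b ∈ F.almostPast r ε) :
    a ∈ F.almostPast r ε := by
  obtain ⟨N, c, rfl, hN, hc⟩ := hb
  refine ⟨N + 1, fun i ↦ Nat.casesOn i a c, rfl, hN, ?_⟩
  rintro (_ | i) hi
  · exact h
  · exact hc i (by omega)

lemma almostPast_cases {r ε : ℝ} {a : E} (h : a ∈ F.almostPast r ε) :
    a ∈ ball p ε ∨ ∃ b ∈ F.almostPast r ε, F.Step r ε a b := by
  obtain ⟨N, c, rfl, hN, hc⟩ := h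
  rcases N with _ | N
  · exact Or.inl hN
  · exact Or.inr ⟨c 1, ⟨N, fun i ↦ c (i + 1), rfl, hN, fun i hi ↦ hc (i + 1) (by omega)⟩,
      hc 0 (by omega)⟩

/-- The inequalities defining a step are strict, so the first point of a chain can be moved.
Openness serves to make the indicator function measurable. -/
lemma isOpen_almostPast {r ε : ℝ} (hr : r ≤ R) : IsOpen (F.almostPast r ε) := by
  rw [isOpen_iff_mem_nhds]
  intro a ha
  rcases F.almostPast_cases ha with h | ⟨b, hb, h1, h2, h3⟩
  · exact mem_of_superset (isOpen_ball.mem_nhds h) (F.ball_subset_almostPast r ε)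
  · have hb' : Tendsto (fun x ↦ b - x) (𝓝 a) (𝓝 (b - a)) := tendsto_const_nhds.sub tendsto_id
    have e1 : ∀ᶠ x in 𝓝 a, x ∈ ball p r := isOpen_ball.mem_nhds h1
    have e2 : ∀ᶠ x in 𝓝 a, ‖b - x‖ < ε := hb'.norm.eventually (gt_mem_nhds h2)
    have e3 : ∀ᶠ x in 𝓝 a, -(ε * ‖b - x‖) < F.f x (b - x) :=
      ((hb'.norm.const_mul ε).neg).eventually_lt
        (F.tendsto tendsto_id hb' (ball_subset_ball hr h1)) h3
    filter_upwards [e1, e2, e3] with x h1 h2 h3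
    exact F.almostPast_of_step ⟨h1, h2, h3⟩ hb

section chain

variable {r ε : ℝ} {N : ℕ} {c : ℕ → E}

lemma Step.norm_le (hr : r ≤ R) (hε : ε ≤ F.κ) {a b : E} (h : F.Step r ε a b) :
    ‖b - a‖ ≤ F.C * F.l (b - a) := by
  refine F.narrow a (ball_subset_ball hr h.1) _ (le_trans ?_ h.2.2.le)
  exact neg_le_neg (mul_le_mul_of_nonneg_right hε (norm_nonneg _))

/-- The form `l` acts as a clock: each step is no longer than `C` times its increment of `l`, and
these increments telescope. -/
lemma chain_norm_le (hr : r ≤ R) (hε : ε ≤ F.κ)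
    (hc : ∀ i < N, F.Step r ε (c i) (c (i + 1))) {i j : ℕ} (hij : i ≤ j) (hj : j ≤ N) :
    ‖c j - c i‖ ≤ F.C * F.l (c j - c i) := by
  induction j, hij using Nat.le_induction with
  | base => simp
  | succ j hij ih =>
    have h1 := ih (by omega)
    have h2 := (hc j (by omega)).norm_le F hr hε
    have : c (j + 1) - c i = (c (j + 1) - c j) + (c j - c i) := by abel
    rw [this, map_add, mul_add]
    exact (norm_add_le _ _).trans (add_le_add h2 h1)

lemma chain_l_nonneg (hr : r ≤ R) (hε : ε ≤ F.κ)
    (hc : ∀ i < N, F.Step r ε (c i) (c (i + 1))) {i j : ℕ} (hij : i ≤ j) (hj : j ≤ N) :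
    0 ≤ F.l (c j - c i) :=
  nonneg_of_mul_nonneg_right ((norm_nonneg _).trans (F.chain_norm_le hr hε hc hij hj)) F.C_pos

lemma chain_mem (hεr : ε ≤ r) (hN : c N ∈ ball p ε)
    (hc : ∀ i < N, F.Step r ε (c i) (c (i + 1))) {i : ℕ} (hi : i ≤ N) : c i ∈ ball p r := by
  rcases hi.eq_or_lt with rfl | h
  · exact ball_subset_ball hεr hN
  · exact (hc i h).1

/-- Freeze the cone at `c i` and add the steps by superadditivity. A step loses its own error `ε`
and the Hölder change of the cone between `c i` and its base point; both the distance to that point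
and the total length are controlled by `l`. -/
lemma chain_le_f (hr : r ≤ R) (hε : ε ≤ F.κ) (hε0 : 0 ≤ ε) (hεr : ε ≤ r) (hN : c N ∈ ball p ε)
    (hc : ∀ i < N, F.Step r ε (c i) (c (i + 1))) {i j : ℕ} (hij : i ≤ j) (hj : j ≤ N) :
    -((ε + F.C * √(F.C * F.l (c j - c i))) * (F.C * F.l (c j - c i))) ≤
      F.f (c i) (c j - c i) := by
  have hm : ∀ k ≤ N, c k ∈ ball p R := fun k hk ↦
    ball_subset_ball hr (F.chain_mem hεr hN hc hk)
  suffices H : ∀ m, i ≤ m → m ≤ j →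
      -((ε + F.C * √(F.C * F.l (c j - c i))) * (F.C * F.l (c m - c i))) ≤
        F.f (c i) (c m - c i) from H j hij le_rfl
  intro m him
  induction m, him using Nat.le_induction with
  | base => intro _; simp [F.zero (hm i (by omega))]
  | succ m him ih =>
    intro hmj
    have h1 := ih (by omega)
    have hs := hc m (by omega)
    have h2 := hs.norm_le F hr hε
    have e : c (m + 1) - c i = (c m - c i) + (c (m + 1) - c m) := by abel
    have h3 := F.add_le _ (hm i (by omega)) (c m - c i) (c (m + 1) - c m)
    have h4 := (abs_le.1 (F.holder _ (hm i (by omega)) _ (hm m (by omega)) (c (m + 1) - c m))).1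
    have h5 : ‖c i - c m‖ ≤ F.C * F.l (c j - c i) := by
      rw [norm_sub_rev]
      refine (F.chain_norm_le hr hε hc him (by omega)).trans
        (mul_le_mul_of_nonneg_left ?_ F.C_pos.le)
      have := F.chain_l_nonneg hr hε hc (i := m) (j := j) (by omega) hj
      rw [map_sub] at this ⊢
      rw [map_sub]; linarith
    have h6 := Real.sqrt_le_sqrt h5
    have h7 := hs.2.2
    have hC := F.C_pos
    have h8 : (ε + F.C * √‖c i - c m‖) * ‖c (m + 1) - c m‖ ≤
        (ε + F.C * √(F.C * F.l (c j - c i))) * (F.C * F.l (c (m + 1) - c m)) := by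
      gcongr
    rw [e, map_add, mul_add, mul_add]
    linarith

end chain

end ConeField

end Spacetime

/-! ### Limits of almost causal chains -/

namespace Spacetime

open Filter Metric

namespace ConeField

variable {E : Type*} [NormedAddCommGroup E] [NormedSpace ℝ E] {p : E} {R : ℝ}
  (F : ConeField E p R)

/-- A chain, seen as a step function of the time `l`. -/
lemma exists_curve_of_mem_almostPast {r ε : ℝ} {q : E} (hr : r ≤ R) (hε : ε ≤ F.κ) (hε0 : 0 ≤ ε)
    (hεr : ε ≤ r) (hq : q ∈ F.almostPast r ε) :
    ∃ (g : ℝ → E) (b : E), b ∈ ball p ε ∧ (∀ s, g s ∈ ball p r) ∧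
      (∀ s s', s ≤ s' → 0 ≤ F.l (g s' - g s) ∧ ‖g s' - g s‖ ≤ F.C * F.l (g s' - g s) ∧
        -((ε + F.C * √(F.C * F.l (g s' - g s))) * (F.C * F.l (g s' - g s))) ≤
          F.f (g s) (g s' - g s)) ∧
      ∀ s, 0 ≤ s → F.l (g s - q) ≤ s ∧ min s (F.l (b - q)) - ‖F.l‖ * ε ≤ F.l (g s - q) ∧
        ‖g s - q‖ ≤ F.C * F.l (g s - q) ∧ ‖b - g s‖ ≤ F.C * F.l (b - g s) := by
  classical
  obtain ⟨N, c, rfl, hN, hc⟩ := hq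
  set i : ℝ → ℕ := fun s ↦ Nat.findGreatest (fun i ↦ F.l (c i - c 0) ≤ s) N with hi
  have hiN : ∀ s, i s ≤ N := fun s ↦ Nat.findGreatest_le N
  have imono : ∀ s s', s ≤ s' → i s ≤ i s' := fun s s' h ↦
    Nat.findGreatest_mono (fun _ h' ↦ le_trans h' h) le_rfl
  refine ⟨fun s ↦ c (i s), c N, hN, fun s ↦ F.chain_mem hεr hN hc (hiN s), fun s s' h ↦ ?_,
    fun s hs ↦ ⟨?_, ?_, ?_, ?_⟩⟩
  · exact ⟨F.chain_l_nonneg hr hε hc (imono s s' h) (hiN s'),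
      F.chain_norm_le hr hε hc (imono s s' h) (hiN s'),
      F.chain_le_f hr hε hε0 hεr hN hc (imono s s' h) (hiN s')⟩
  · exact Nat.findGreatest_spec (P := fun i ↦ F.l (c i - c 0) ≤ s) (m := 0) (Nat.zero_le N)
      (by simpa using hs)
  · rcases (hiN s).eq_or_lt with h | h
    · have : 0 ≤ ‖F.l‖ * ε := by positivity
      simp only [h]
      linarith [min_le_right s (F.l (c N - c 0))]
    · have h1 : ¬ F.l (c (i s + 1) - c 0) ≤ s :=
        Nat.findGreatest_is_greatest (P := fun i ↦ F.l (c i - c 0) ≤ s) (Nat.lt_succ_self _) h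
      have h2 : F.l (c (i s + 1) - c (i s)) ≤ ‖F.l‖ * ε :=
        (le_abs_self _).trans ((F.l.le_opNorm _).trans
          (mul_le_mul_of_nonneg_left (hc _ h).2.1.le (norm_nonneg _)))
      have h3 := min_le_left s (F.l (c N - c 0))
      simp only [map_sub] at *
      linarith
  · exact F.chain_norm_le hr hε hc (Nat.zero_le _) (hiN s)
  · exact F.chain_norm_le hr hε hc (hiN s) le_rfl

/-- Limits of almost causal chains are Lipschitz curves, causal in an integrated sense. -/
lemma exists_limit_curve [ProperSpace E] {r : ℝ} (hr0 : 0 < r) (hr : r < R) {T : E → ℝ}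
    (hT : ContinuousOn T (ball p R))
    (H : ∀ ε > 0, ∃ q ∈ F.almostPast r ε, r / 2 ≤ ‖q - p‖ ∧ -ε ≤ T q) :
    ∃ (γ : ℝ → E) (τ : ℝ), 0 < τ ∧ (∀ s, γ s ∈ closedBall p r) ∧
      (∀ s s', 0 ≤ s → s ≤ s' → s' ≤ τ → F.l (γ s' - γ s) = s' - s ∧
        ‖γ s' - γ s‖ ≤ F.C * (s' - s) ∧
        -(F.C * √(F.C * (s' - s)) * (F.C * (s' - s))) ≤ F.f (γ s) (γ s' - γ s)) ∧
      γ τ = p ∧ 0 ≤ T (γ 0) := by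
  have hsub : closedBall p r ⊆ ball p R := closedBall_subset_ball hr
  set ε : ℕ → ℝ := fun n ↦ min F.κ r / (n + 1) with hε
  have hm : 0 < min F.κ r := lt_min F.κ_pos hr0
  have ε0 : ∀ n, 0 < ε n := fun n ↦ by positivity
  have εm : ∀ n, ε n ≤ min F.κ r := fun n ↦
    div_le_self hm.le (by linarith [(Nat.cast_nonneg n : (0 : ℝ) ≤ n)])
  -- Along one fixed ultrafilter the curves `g n` converge at all times `s` simultaneously, so no
  -- diagonal subsequence is needed.
  set u : Filter ℕ := (hyperfilter ℕ : Filter ℕ) with hu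
  have εlim : Tendsto ε u (𝓝 0) :=
    (tendsto_const_div_atTop_nhds_zero_nat (min F.κ r)).comp (tendsto_add_atTop_nat 1) |>.congr
      (fun n ↦ by simp [hε]) |>.mono_left Nat.hyperfilter_le_atTop
  choose q hq hqp hqT using fun n ↦ H (ε n) (ε0 n)
  choose g b hb hg hgg hgq using fun n ↦ F.exists_curve_of_mem_almostPast hr.le
    ((εm n).trans (min_le_left _ _)) (ε0 n).le ((εm n).trans (min_le_right _ _)) (hq n)
  have compact : ∀ x : ℕ → E, (∀ n, x n ∈ closedBall p r) →
      ∃ y ∈ closedBall p r, Tendsto x u (𝓝 y) := by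
    intro x hx
    obtain ⟨y, hy, h⟩ := (isCompact_closedBall p r).ultrafilter_le_nhds
      ((hyperfilter ℕ).map x) (tendsto_principal.2 (Eventually.of_forall hx))
    exact ⟨y, hy, h⟩
  choose γ hγ hlim using fun s ↦ compact (fun n ↦ g n s) (fun n ↦ ball_subset_closedBall (hg n s))
  have hq0 : ∀ n, q n ∈ closedBall p r := by
    intro n
    obtain ⟨N, c, h0, hN, hc⟩ := hq n
    rw [← h0]
    exact ball_subset_closedBall
      (F.chain_mem ((εm n).trans (min_le_right _ _)) hN hc (Nat.zero_le N))
  obtain ⟨q', hq', hqlim⟩ := compact q hq0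
  have hblim : Tendsto b u (𝓝 p) := by
    rw [tendsto_iff_norm_sub_tendsto_zero]
    exact squeeze_zero (fun _ ↦ norm_nonneg _) (fun n ↦ (mem_ball_iff_norm.1 (hb n)).le) εlim
  have hl := F.l.continuous
  have ll : ∀ s, Tendsto (fun n ↦ F.l (g n s - q n)) u (𝓝 (F.l (γ s - q'))) := fun s ↦
    (hl.tendsto _).comp ((hlim s).sub hqlim)
  have lb : Tendsto (fun n ↦ F.l (b n - q n)) u (𝓝 (F.l (p - q'))) :=
    (hl.tendsto _).comp (hblim.sub hqlim)
  set τ := F.l (p - q') with hτ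
  -- The limit curve is parametrised by elapsed `l`-time: the lag `‖l‖ * ε n` tends to 0.
  have time1 : ∀ s, 0 ≤ s → s ≤ τ → F.l (γ s - q') = s := by
    intro s hs hsτ
    apply le_antisymm
    · exact le_of_tendsto (ll s) (Eventually.of_forall fun n ↦ (hgq n s hs).1)
    · have h1 : Tendsto (fun n ↦ min s (F.l (b n - q n)) - ‖F.l‖ * ε n) u
          (𝓝 (min s τ - ‖F.l‖ * 0)) := (tendsto_const_nhds.min lb).sub (εlim.const_mul _)
      have := le_of_tendsto_of_tendsto h1 (ll s) (Eventually.of_forall fun n ↦ (hgq n s hs).2.1)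
      simpa [min_eq_left hsτ] using this
  have hp0 : ‖p - q'‖ ≤ F.C * τ := by
    have h1 := ((hblim.sub (hlim 0)).norm)
    have h3 : ∀ n, ‖b n - q n‖ ≤ F.C * F.l (b n - q n) := by
      intro n
      have h1 := (hgq n 0 le_rfl).2.2.1
      have h2 := (hgq n 0 le_rfl).2.2.2
      have e : b n - q n = (b n - g n 0) + (g n 0 - q n) := by abel
      rw [e, map_add, mul_add]
      exact (norm_add_le _ _).trans (add_le_add h2 h1)
    exact le_of_tendsto_of_tendsto (hblim.sub hqlim).norm (lb.const_mul _)
      (Eventually.of_forall h3)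
  have hqp' : r / 2 ≤ ‖q' - p‖ :=
    ge_of_tendsto (hqlim.sub_const p).norm (Eventually.of_forall hqp)
  have τ0 : 0 < τ := by
    rw [norm_sub_rev] at hqp'
    exact pos_of_mul_pos_right ((half_pos hr0).trans_le (hqp'.trans hp0)) F.C_pos.le
  refine ⟨γ, τ, τ0, hγ, fun s s' hs hss hs' ↦ ?_, ?_, ?_⟩
  · have e : F.l (γ s' - γ s) = s' - s := by
      have h1 := time1 s hs (hss.trans hs')
      have h2 := time1 s' (hs.trans hss) hs'
      rw [map_sub] at h1 h2 ⊢
      linarith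
    have lim := (hlim s').sub (hlim s)
    have liml : Tendsto (fun n ↦ F.l (g n s' - g n s)) u (𝓝 (s' - s)) := by
      rw [← e]; exact (hl.tendsto _).comp lim
    refine ⟨e, ?_, ?_⟩
    · exact le_of_tendsto_of_tendsto lim.norm (liml.const_mul _)
        (Eventually.of_forall fun n ↦ (hgg n s s' hss).2.1)
    · have h1 := F.tendsto (hlim s) lim (hsub (hγ s))
      have h2 : Tendsto (fun n ↦ -((ε n + F.C * √(F.C * F.l (g n s' - g n s))) *
          (F.C * F.l (g n s' - g n s)))) u
          (𝓝 (-((0 + F.C * √(F.C * (s' - s))) * (F.C * (s' - s))))) :=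
        ((εlim.add ((liml.const_mul _).sqrt.const_mul _)).mul (liml.const_mul _)).neg
      rw [zero_add] at h2
      exact le_of_tendsto_of_tendsto h2 h1 (Eventually.of_forall fun n ↦ (hgg n s s' hss).2.2)
  · have h1 : ‖p - γ τ‖ ≤ F.C * F.l (p - γ τ) :=
      le_of_tendsto_of_tendsto (hblim.sub (hlim τ)).norm
        (((hl.tendsto _).comp (hblim.sub (hlim τ))).const_mul _)
        (Eventually.of_forall fun n ↦ (hgq n τ τ0.le).2.2.2)
    have h2 := time1 τ τ0.le le_rfl
    have h3 : F.l (p - γ τ) = 0 := by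
      rw [map_sub] at h2 ⊢
      rw [map_sub] at hτ
      linarith
    rw [h3, mul_zero] at h1
    exact (sub_eq_zero.1 (norm_le_zero_iff.1 h1)).symm
  · have h1 : ‖γ 0 - q'‖ ≤ F.C * F.l (γ 0 - q') :=
      le_of_tendsto_of_tendsto ((hlim 0).sub hqlim).norm ((ll 0).const_mul _)
        (Eventually.of_forall fun n ↦ (hgq n 0 le_rfl).2.2.1)
    rw [time1 0 le_rfl τ0.le, mul_zero] at h1
    rw [sub_eq_zero.1 (norm_le_zero_iff.1 h1)]
    have h2 : Tendsto (fun n ↦ T (q n)) u (𝓝 (T q')) :=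
      ((hT.continuousAt (isOpen_ball.mem_nhds (hsub hq'))).tendsto).comp hqlim
    have h3 := le_of_tendsto_of_tendsto εlim.neg h2 (Eventually.of_forall fun n ↦ hqT n)
    simpa using h3

end ConeField

end Spacetime

/-! ### Regularity and monotonicity from difference estimates -/

namespace Spacetime

open Filter Metric

/-- A continuous curve whose second differences are `O(D ^ (5 / 4))` is `C¹`. -/
lemma exists_continuousOn_hasDerivAt {E : Type*} [NormedAddCommGroup E] [NormedSpace ℝ E]
    [CompleteSpace E] {γ : ℝ → E} {τ K : ℝ} (hτ : 0 < τ) (hγ : ContinuousOn γ (Icc 0 τ))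
    (hK : ∀ s D, 0 ≤ s → 0 ≤ D → s + D ≤ τ →
      ‖(γ (s + D / 2) - γ s) - (γ (s + D) - γ (s + D / 2))‖ ≤ K * (D * √√D)) :
    ∃ G : ℝ → E, ContinuousOn G (Ioo 0 (τ / 2)) ∧
      ∀ s ∈ Ioo 0 (τ / 2), HasDerivAt γ (G s) s := by
  set c : ℝ → E := fun s ↦ γ (projIcc 0 τ hτ.le s) with hc
  have hcc : Continuous c := hγ.domRestrict.comp continuous_projIcc
  have hcγ : ∀ s ∈ Icc 0 τ, c s = γ s := fun s hs ↦ by simp [hc, projIcc_of_mem hτ.le hs]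
  set d : ℕ → ℝ := fun n ↦ τ / 2 * (1 / 2) ^ n with hd
  have d0 : ∀ n, 0 < d n := fun n ↦ by positivity
  have dle : ∀ n, d n ≤ τ / 2 := fun n ↦
    mul_le_of_le_one_right (by positivity) (pow_le_one₀ (by norm_num) (by norm_num))
  have dsucc : ∀ n, d (n + 1) = d n / 2 := fun n ↦ by simp only [hd, pow_succ]; ring
  have dlim : Tendsto d atTop (𝓝 0) := by
    have := (tendsto_pow_atTop_nhds_zero_of_lt_one (r := (1 / 2 : ℝ)) (by norm_num)
      (by norm_num)).const_mul (τ / 2)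
    rwa [mul_zero] at this
  -- The difference quotients at the dyadic scales `d n`. Passing from one scale to the next costs a
  -- second difference divided by `d n`, hence a term of a geometric series with ratio `2 ^ (-1 /
  -- 4)`.
  set D : ℕ → ℝ → E := fun n s ↦ (d n)⁻¹ • (c (s + d n) - c s) with hD
  set u : ℕ → ℝ := fun n ↦ K * √√(τ / 2) * (√√(1 / 2)) ^ n with hu
  have usum : Summable u := by
    refine (summable_geometric_of_lt_one (Real.sqrt_nonneg _) ?_).mul_left _
    rw [Real.sqrt_lt' one_pos, Real.sqrt_lt' (by norm_num)]; norm_num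
  have hDu : ∀ n, ∀ s ∈ Ioo 0 (τ / 2), ‖D (n + 1) s - D n s‖ ≤ u n := by
    intro n s hs
    have h1 := hK s (d n) hs.1.le (d0 n).le (by linarith [hs.2, dle n])
    have e : D (n + 1) s - D n s =
        (d n)⁻¹ • ((γ (s + d n / 2) - γ s) - (γ (s + d n) - γ (s + d n / 2))) := by
      have := d0 n
      simp only [hD, dsucc]
      rw [hcγ _ ⟨by linarith [hs.1], by linarith [hs.2, dle n]⟩,
        hcγ _ ⟨by linarith [hs.1], by linarith [hs.2, dle n]⟩,
        hcγ _ ⟨by linarith [hs.1], by linarith [hs.2, dle n]⟩, inv_div, div_eq_mul_inv]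
      module
    have e2 : √√(d n) = √√(τ / 2) * (√√(1 / 2)) ^ n := by
      have : ∀ m : ℕ, √√((1 / 2 : ℝ) ^ m) = (√√(1 / 2)) ^ m := by
        intro m
        induction m with
        | zero => simp
        | succ m ih =>
          rw [pow_succ, Real.sqrt_mul (by positivity), Real.sqrt_mul (by positivity), ih, pow_succ]
      simp only [hd]
      rw [Real.sqrt_mul (by positivity), Real.sqrt_mul (by positivity), this]
    rw [e, norm_smul, norm_inv, Real.norm_of_nonneg (d0 n).le]
    calc (d n)⁻¹ * _ ≤ (d n)⁻¹ * (K * (d n * √√(d n))) :=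
          mul_le_mul_of_nonneg_left h1 (inv_nonneg.2 (d0 n).le)
      _ = u n := by
          rw [hu, e2]
          field_simp [(d0 n).ne']
  set G : ℝ → E := fun s ↦ D 0 s + ∑' n, (D (n + 1) s - D n s) with hG
  have unif : TendstoUniformlyOn D G atTop (Ioo 0 (τ / 2)) := by
    have h := tendstoUniformlyOn_tsum_nat usum hDu
    rw [Metric.tendstoUniformlyOn_iff] at h ⊢
    intro ε hε
    filter_upwards [h ε hε] with n hn s hs
    have := hn s hs
    rw [Finset.sum_range_sub (fun n ↦ D n s)] at this
    rw [hG]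
    rwa [← dist_add_left (D 0 s), add_sub_cancel] at this
  have Dcont : ∀ n, Continuous (D n) := fun n ↦ by simp only [hD]; fun_prop
  have Gcont : ContinuousOn G (Ioo 0 (τ / 2)) :=
    unif.continuousOn (Frequently.of_forall fun n ↦ (Dcont n).continuousOn)
  -- Differentiability of `c` comes from its primitive: `(P (s + d n) - P s) / d n` has derivative
  -- `D n s` and tends to `c s`, so uniform convergence of the derivatives identifies `G` as the
  -- derivative of `c`.
  set P : ℝ → E := fun s ↦ ∫ x in (0 : ℝ)..s, c x with hP
  have hPd : ∀ s, HasDerivAt P (c s) s := fun s ↦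
    intervalIntegral.integral_hasDerivAt_right (hcc.intervalIntegrable _ _)
      hcc.aestronglyMeasurable.stronglyMeasurableAtFilter hcc.continuousAt
  have key : ∀ s ∈ Ioo 0 (τ / 2), HasDerivAt c (G s) s := by
    intro s hs
    refine hasDerivAt_of_tendstoUniformlyOn (f := fun n s ↦ (d n)⁻¹ • (P (s + d n) - P s))
      isOpen_Ioo unif (Eventually.of_forall fun n s _ ↦ ?_) (fun s _ ↦ ?_) hs
    · exact (((hPd (s + d n)).comp_add_const s (d n)).sub (hPd s)).const_smul _
    · have h1 := (hasDerivAt_iff_tendsto_slope_zero.1 (hPd s))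
      exact h1.comp (tendsto_nhdsWithin_iff.2 ⟨dlim, Eventually.of_forall fun n ↦ (d0 n).ne'⟩)
  refine ⟨G, Gcont, fun s hs ↦ (key s hs).congr_of_eventuallyEq ?_⟩
  filter_upwards [isOpen_Ioo.mem_nhds hs] with x hx
  exact (hcγ x ⟨hx.1.le, by linarith [hx.2]⟩).symm

/-- A function whose decrease is locally `O(D ^ (3 / 2))` is monotone. -/
lemma le_of_decrease_le {φ : ℝ → ℝ} {τ δ K : ℝ} (hδ : 0 < δ)
    (h : ∀ s s', 0 ≤ s → s ≤ s' → s' ≤ τ → s' - s ≤ δ →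
      φ s - K * ((s' - s) * √(s' - s)) ≤ φ s') {s s' : ℝ} (hs : 0 ≤ s) (hss : s ≤ s')
    (hs' : s' ≤ τ) : φ s ≤ φ s' := by
  set D := s' - s with hD
  have D0 : 0 ≤ D := sub_nonneg.2 hss
  have lim : Tendsto (fun n : ℕ ↦ D / (n + 1 : ℕ)) atTop (𝓝 0) :=
    (tendsto_const_div_atTop_nhds_zero_nat D).comp (tendsto_add_atTop_nat 1)
  have ev : ∀ᶠ n : ℕ in atTop, φ s - K * (D * √(D / (n + 1 : ℕ))) ≤ φ s' := by
    filter_upwards [lim.eventually (gt_mem_nhds hδ)] with n hn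
    -- With `n + 1` equal pieces of length `x` the total loss is `K * D * √x`, which tends to 0.
    set x := D / (n + 1 : ℕ) with hx
    have hxn : ((n + 1 : ℕ) : ℝ) * x = D := by
      rw [hx]; field_simp
    have x0 : 0 ≤ x := by positivity
    have : ∀ k : ℕ, k ≤ n + 1 → φ s - k * (K * (x * √x)) ≤ φ (s + k * x) := by
      intro k
      induction k with
      | zero => simp
      | succ k ih =>
        intro hk
        have h1 := ih (by omega)
        have hk' : ((k + 1 : ℕ) : ℝ) * x ≤ D := by
          rw [← hxn]; gcongr
        push_cast at hk' ⊢
        have h2 := h (s + k * x) (s + (k + 1) * x) (by positivity) (by nlinarith) (by linarith)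
          (by linarith)
        have e : s + (k + 1) * x - (s + k * x) = x := by ring
        rw [e] at h2
        linarith
    have h1 := this (n + 1) le_rfl
    rw [hxn, show s + D = s' by rw [hD]; ring] at h1
    rw [← hxn]
    calc _ = φ s - ((n + 1 : ℕ) : ℝ) * (K * (x * √x)) := by
          rw [hxn]; nth_rw 1 [← hxn]; ring
      _ ≤ _ := h1
  have l1 : Tendsto (fun n : ℕ ↦ φ s - K * (D * √(D / (n + 1 : ℕ)))) atTop (𝓝 (φ s)) := by
    have := ((lim.sqrt.const_mul D).const_mul K).const_sub (φ s)
    simpa using this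
  exact le_of_tendsto l1 ev

namespace ConeField

variable {E : Type*} [NormedAddCommGroup E] [NormedSpace ℝ E] {p : E} {R : ℝ}
  (F : ConeField E p R)

/-- `T` strictly increases along the `C¹` curves with velocities in the cones. -/
def Increasing (T : E → ℝ) : Prop :=
  ∀ (γ γ' : ℝ → E) (a b : ℝ), a < b →
    (∀ s ∈ Icc a b, HasDerivWithinAt γ (γ' s) (Icc a b) s) → ContinuousOn γ' (Icc a b) →
    (∀ s ∈ Icc a b, γ s ∈ ball p R ∧ γ' s ≠ 0 ∧ 0 ≤ F.f (γ s) (γ' s)) → T (γ a) < T (γ b)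

variable {F} {T : E → ℝ}

lemma Increasing.lt_add (hT : F.Increasing T) {y w : E} (hy : y ∈ ball p R)
    (hyw : y + w ∈ ball p R) (hw : w ≠ 0) (h : ∀ z ∈ segment ℝ y (y + w), 0 ≤ F.f z w) :
    T y < T (y + w) := by
  have := hT (fun s ↦ y + s • w) (fun _ ↦ w) 0 1 one_pos
    (fun s _ ↦ by
      simpa using (((hasDerivAt_id s).smul_const w).const_add y).hasDerivWithinAt)
    continuousOn_const (fun s hs ↦ ?_)
  · simpa using this
  · have hz : y + s • w ∈ segment ℝ y (y + w) := by
      rw [segment_eq_image']; exact ⟨s, hs, by simp⟩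
    exact ⟨(convex_ball p R).segment_subset hy hyw hz, hw, h _ hz⟩

/-- The margin assumed at `y` pays for the Hölder change of the cones along the segment, so the
straight segment is causal. -/
lemma Increasing.lt_add_of_le (hT : F.Increasing T) {y w : E} (hy : y ∈ ball p R)
    (hyw : y + w ∈ ball p R) (hw : w ≠ 0) (h : F.C * √‖w‖ * ‖w‖ ≤ F.f y w) : T y < T (y + w) := by
  refine hT.lt_add hy hyw hw fun z hz ↦ ?_
  have h1 := (abs_le.1 (F.holder y hy z ((convex_ball p R).segment_subset hy hyw hz) w)).2
  have h2 : ‖y - z‖ ≤ ‖w‖ := by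
    rw [segment_eq_image'] at hz
    obtain ⟨s, hs, rfl⟩ := hz
    rw [norm_sub_rev]
    simp only [add_sub_cancel_left, norm_smul, Real.norm_of_nonneg hs.1]
    exact mul_le_of_le_one_left (norm_nonneg _) hs.2
  have h3 : F.C * √‖y - z‖ * ‖w‖ ≤ F.C * √‖w‖ * ‖w‖ := by
    have := F.C_pos
    gcongr
  linarith

end ConeField

end Spacetime

/-! ### Limit curves and the level sets of an increasing function -/

namespace Spacetime

open Filter Metric

namespace ConeField

variable {E : Type*} [NormedAddCommGroup E] [NormedSpace ℝ E] {p : E} {R : ℝ}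
  {F : ConeField E p R} {T : E → ℝ}

section limitCurve

variable {r τ : ℝ} {γ : ℝ → E}

/-- The integrated form of causality which limits of almost causal chains have. -/
def IsWeaklyCausal (F : ConeField E p R) (γ : ℝ → E) (τ : ℝ) : Prop :=
  ∀ s s', 0 ≤ s → s ≤ s' → s' ≤ τ → F.l (γ s' - γ s) = s' - s ∧
    ‖γ s' - γ s‖ ≤ F.C * (s' - s) ∧
    -(F.C * √(F.C * (s' - s)) * (F.C * (s' - s))) ≤ F.f (γ s) (γ s' - γ s)

/-- A chord over time `D` misses the cone by `O(D ^ (3 / 2))`. Adding a multiple of `e` of that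
order makes the straight segment causal, and undoing this push changes the Lipschitz function `T` by
only `O(D ^ (3 / 2))`. -/
lemma IsWeaklyCausal.decrease_le (hγ : F.IsWeaklyCausal γ τ) (hr : r < R)
    (hm : ∀ s, γ s ∈ closedBall p r) (hT : F.Increasing T) {L : ℝ}
    (hL : ∀ x ∈ ball p R, ∀ y ∈ ball p R, |T x - T y| ≤ L * ‖x - y‖) :
    ∃ δ K : ℝ, 0 < δ ∧ ∀ s s', 0 ≤ s → s ≤ s' → s' ≤ τ → s' - s ≤ δ →
      T (γ s) - K * ((s' - s) * √(s' - s)) ≤ T (γ s') := by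
  have hsub : closedBall p r ⊆ ball p R := closedBall_subset_ball hr
  have hC := F.C_pos
  have hκ := F.κ_pos
  -- The first term of `B * κ` covers the defect of the chord, the second covers the Hölder change
  -- along a vector of length at most `2 * C * D`, and the 1 forces `w ≠ 0`.
  obtain ⟨B, hB⟩ : ∃ B : ℝ, B * F.κ = F.C * √F.C * F.C + F.C * √(2 * F.C) * (2 * F.C) + 1 :=
    ⟨_, div_mul_cancel₀ _ F.κ_pos.ne'⟩
  have hB0 : 0 < B := by
    have : 0 < B * F.κ := by rw [hB]; positivity
    exact pos_of_mul_pos_left this hκ.le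
  obtain ⟨δ, hδ, h1, h2⟩ : ∃ δ : ℝ, 0 < δ ∧ B * √δ * ‖F.e‖ ≤ F.C ∧ 2 * F.C * δ < R - r := by
    have l1 : Tendsto (fun δ : ℝ ↦ B * √δ * ‖F.e‖) (𝓝[>] 0) (𝓝 (B * √0 * ‖F.e‖)) :=
      Tendsto.mono_left (Continuous.tendsto (by fun_prop) _) nhdsWithin_le_nhds
    have l2 : Tendsto (fun δ : ℝ ↦ 2 * F.C * δ) (𝓝[>] 0) (𝓝 (2 * F.C * 0)) :=
      Tendsto.mono_left (Continuous.tendsto (by fun_prop) _) nhdsWithin_le_nhds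
    rw [Real.sqrt_zero, mul_zero, zero_mul] at l1
    rw [mul_zero] at l2
    obtain ⟨δ, ⟨h1, h2⟩, h3⟩ := (((l1.eventually (ge_mem_nhds hC)).and
      (l2.eventually (gt_mem_nhds (sub_pos.2 hr)))).and self_mem_nhdsWithin).exists
    exact ⟨δ, h3, h1, h2⟩
  refine ⟨δ, L * (B * ‖F.e‖), hδ, fun s s' hs hss hs' hd ↦ ?_⟩
  obtain ⟨-, g2, g3⟩ := hγ s s' hs hss hs'
  have hD0 : 0 ≤ s' - s := sub_nonneg.2 hss
  generalize s' - s = D at *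
  rcases hD0.eq_or_lt with rfl | hD
  · rw [mul_zero] at g2
    rw [sub_eq_zero.1 (norm_le_zero_iff.1 g2)]; simp
  set t := B * (D * √D) with ht
  have ht0 : 0 ≤ t := by positivity
  set w := (γ s' - γ s) + t • F.e with hw
  have hte : ‖t • F.e‖ ≤ F.C * D := by
    rw [norm_smul, Real.norm_of_nonneg ht0]
    have : B * √D * ‖F.e‖ ≤ F.C := le_trans (by gcongr) h1
    calc t * ‖F.e‖ = D * (B * √D * ‖F.e‖) := by rw [ht]; ring
      _ ≤ D * F.C := by gcongr
      _ = _ := mul_comm _ _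
  have hwn : ‖w‖ ≤ 2 * F.C * D := (norm_add_le _ _).trans (by linarith)
  have hyR := hsub (hm s)
  have hfw : F.C * √(2 * F.C) * (2 * F.C) * (D * √D) + D * √D ≤ F.f (γ s) w := by
    have a1 := F.add_le _ hyR (γ s' - γ s) (t • F.e)
    rw [F.smul _ hyR _ _ ht0] at a1
    have a2 := mul_le_mul_of_nonneg_left (F.interior _ hyR) ht0
    have a3 : t * F.κ = (F.C * √F.C * F.C + F.C * √(2 * F.C) * (2 * F.C) + 1) * (D * √D) := by
      rw [ht, ← hB]; ring
    have a4 : F.C * √(F.C * D) * (F.C * D) = F.C * √F.C * F.C * (D * √D) := by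
      rw [Real.sqrt_mul hC.le]; ring
    linarith
  have hDD : 0 < D * √D := by positivity
  have hfw' : F.C * √‖w‖ * ‖w‖ ≤ F.f (γ s) w := by
    refine le_trans ?_ hfw
    calc F.C * √‖w‖ * ‖w‖ ≤ F.C * √(2 * F.C * D) * (2 * F.C * D) := by gcongr
      _ = F.C * √(2 * F.C) * (2 * F.C) * (D * √D) := by rw [Real.sqrt_mul (by positivity)]; ring
      _ ≤ _ := by linarith
  have hw0 : w ≠ 0 := by
    intro h
    rw [h, F.zero hyR] at hfw
    have : 0 ≤ F.C * √(2 * F.C) * (2 * F.C) * (D * √D) := by positivity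
    linarith
  have hz : γ s + w = γ s' + t • F.e := by rw [hw]; abel
  have hwR : γ s + w ∈ ball p R := by
    rw [mem_ball_iff_norm]
    have := mem_closedBall_iff_norm.1 (hm s)
    have h4 : 2 * F.C * D ≤ 2 * F.C * δ := by gcongr
    calc ‖γ s + w - p‖ = ‖(γ s - p) + w‖ := by congr 1; abel
      _ ≤ ‖γ s - p‖ + ‖w‖ := norm_add_le _ _
      _ < R := by linarith
  have h5 := hT.lt_add_of_le hyR hwR hw0 hfw'
  have h6 := (abs_le.1 (hL _ hwR _ (hsub (hm s')))).2
  have h7 : L * ‖γ s + w - γ s'‖ = L * (B * ‖F.e‖) * (D * √D) := by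
    rw [hz, add_sub_cancel_left, norm_smul, Real.norm_of_nonneg ht0, ht]; ring
  linarith

/-- A chord further inside the cone would be a causal segment joining two zeros of `T`. -/
lemma IsWeaklyCausal.f_le (hγ : F.IsWeaklyCausal γ τ) (hm : ∀ s, γ s ∈ ball p R)
    (hT : F.Increasing T) (hTγ : ∀ s ∈ Icc 0 τ, T (γ s) = 0) {s s' : ℝ} (hs : 0 ≤ s)
    (hss : s ≤ s') (hs' : s' ≤ τ) :
    F.f (γ s) (γ s' - γ s) ≤ F.C * √(F.C * (s' - s)) * (F.C * (s' - s)) := by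
  by_contra! h
  have hC := F.C_pos
  obtain ⟨-, g2, -⟩ := hγ s s' hs hss hs'
  have h1 : F.C * √‖γ s' - γ s‖ * ‖γ s' - γ s‖ ≤ F.C * √(F.C * (s' - s)) * (F.C * (s' - s)) := by
    gcongr
  have h0 : 0 ≤ F.C * √(F.C * (s' - s)) * (F.C * (s' - s)) := by
    have := sub_nonneg.2 hss
    positivity
  have := hT.lt_add_of_le (hm s) (w := γ s' - γ s) (by simpa using hm s')
    (fun h' ↦ by rw [h', F.zero (hm s)] at h; linarith) (h1.trans h.le)
  rw [add_sub_cancel, hTγ s ⟨hs, hss.trans hs'⟩, hTγ s' ⟨hs.trans hss, hs'⟩] at this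
  exact lt_irrefl _ this

/-- The two half chords have the same `l`, are causal up to `η = O(D ^ (3 / 2))`, and by `f_le`
their sum is at most `η` inside the cone. Strict convexity then gives `‖v - w‖ ^ 2 ≤ O(η * D) = O(D
^ (5 / 2))`. -/
lemma IsWeaklyCausal.second_difference_le (hγ : F.IsWeaklyCausal γ τ) (hm : ∀ s, γ s ∈ ball p R)
    (hT : F.Increasing T) (hTγ : ∀ s ∈ Icc 0 τ, T (γ s) = 0) :
    ∃ K : ℝ, ∀ s D, 0 ≤ s → 0 ≤ D → s + D ≤ τ →
      ‖(γ (s + D / 2) - γ s) - (γ (s + D) - γ (s + D / 2))‖ ≤ K * (D * √√D) := by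
  have hC := F.C_pos
  set A := F.C * √F.C * F.C with hA
  have hA0 : 0 ≤ A := by positivity
  set Q := F.C * (2 * A) * (F.C + 2 * A * √τ) with hQ
  have hQ0 : 0 ≤ Q := by positivity
  refine ⟨√Q, fun s D hs hD hsD ↦ ?_⟩
  have eA : ∀ x : ℝ, F.C * √(F.C * x) * (F.C * x) = A * (x * √x) := by
    intro x; rw [Real.sqrt_mul hC.le, hA]; ring
  have half : A * (D / 2 * √(D / 2)) ≤ A * (D * √D) := by
    have : D / 2 ≤ D := by linarith
    gcongr
  obtain ⟨a1, a2, a3⟩ := hγ s (s + D / 2) hs (by linarith) (by linarith)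
  obtain ⟨b1, b2, b3⟩ := hγ (s + D / 2) (s + D) (by linarith) (by linarith) (by linarith)
  have c3 := hγ.f_le hm hT hTγ (s := s) (s' := s + D) hs (by linarith) hsD
  rw [show s + D / 2 - s = D / 2 by ring] at a1 a2 a3
  rw [show s + D - (s + D / 2) = D / 2 by ring] at b1 b2 b3
  rw [show s + D - s = D by ring] at c3
  rw [eA] at a3 b3 c3
  set v := γ (s + D / 2) - γ s with hv
  set w := γ (s + D) - γ (s + D / 2) with hw
  have hvw : γ (s + D) - γ s = v + w := by rw [hv, hw]; abel
  rw [hvw] at c3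
  set η := A * (D * √D) with hη
  have η0 : 0 ≤ η := by positivity
  have hol := (abs_le.1 (F.holder _ (hm (s + D / 2)) _ (hm s) w)).2
  have hol2 : F.C * √‖v‖ * ‖w‖ ≤ η := by
    rw [← eA] at half
    refine le_trans ?_ half
    gcongr
  -- The error is `2 * η`: the second half chord is nearly causal at the midpoint, and moving its
  -- base point to `γ s` costs at most another `η`.
  have key := F.strict _ (hm s) v w (2 * η) (by positivity) (by rw [a1, b1]) (by linarith)
    (by linarith) (by linarith)
  have hDτ : √D ≤ √τ := Real.sqrt_le_sqrt (by linarith)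
  have : ‖v - w‖ ^ 2 ≤ (√Q * (D * √√D)) ^ 2 := by
    refine key.trans ?_
    have e : (√Q * (D * √√D)) ^ 2 = F.C * (2 * η) * (F.C * D + 2 * A * √τ * D) := by
      rw [mul_pow, mul_pow, Real.sq_sqrt hQ0, Real.sq_sqrt (Real.sqrt_nonneg _), hQ, hη]; ring
    rw [e]
    have e2 : ‖v‖ + ‖w‖ + 2 * η ≤ F.C * D + 2 * A * √τ * D := by
      have : A * (D * √D) ≤ A * (D * √τ) := by gcongr
      rw [hη]; linarith
    gcongr
  exact (pow_le_pow_iff_left₀ (norm_nonneg _) (by positivity) two_ne_zero).1 this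

/-- The second difference bound makes the curve `C¹` on an initial piece. Its velocity has `l`-value
1, so it is nonzero, and it is causal because the defect of a chord divided by its duration tends to
0. Thus `T` would have to increase strictly. -/
lemma IsWeaklyCausal.not_const [CompleteSpace E] (hγ : F.IsWeaklyCausal γ τ) (hτ : 0 < τ)
    (hm : ∀ s, γ s ∈ ball p R) (hT : F.Increasing T) (hTγ : ∀ s ∈ Icc 0 τ, T (γ s) = 0) :
    False := by
  have hC := F.C_pos
  have hcont : ContinuousOn γ (Icc 0 τ) := by
    have : LipschitzOnWith ⟨F.C, hC.le⟩ γ (Icc 0 τ) := by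
      refine LipschitzOnWith.of_dist_le_mul fun s hs s' hs' ↦ ?_
      wlog h : s ≤ s' generalizing s s'
      · rw [dist_comm, dist_comm s]; exact this s' hs' s hs (not_le.1 h).le
      · rw [dist_comm, dist_comm s, dist_eq_norm, dist_eq_norm,
          Real.norm_of_nonneg (sub_nonneg.2 h)]
        exact (hγ s s' hs.1 h hs'.2).2.1
    exact this.continuousOn
  obtain ⟨K, hK⟩ := hγ.second_difference_le hm hT hTγ
  obtain ⟨G, hG, hGd⟩ := exists_continuousOn_hasDerivAt hτ hcont hK
  have hsub : Icc (τ / 8) (τ / 4) ⊆ Ioo 0 (τ / 2) :=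
    fun s hs ↦ ⟨by linarith [hs.1], by linarith [hs.2]⟩
  have slope : ∀ s ∈ Ioo 0 (τ / 2),
      Tendsto (fun t ↦ t⁻¹ • (γ (s + t) - γ s)) (𝓝[>] 0) (𝓝 (G s)) := fun s hs ↦
    (hasDerivAt_iff_tendsto_slope_zero.1 (hGd s hs)).mono_left
      (nhdsWithin_mono _ fun x hx ↦ ne_of_gt hx)
  have small : ∀ s ∈ Ioo 0 (τ / 2), ∀ᶠ t in 𝓝[>] (0 : ℝ), 0 < t ∧ s + t ≤ τ := by
    intro s hs
    filter_upwards [Ioo_mem_nhdsGT (half_pos hτ)] with t ht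
    exact ⟨ht.1, by linarith [ht.2, hs.2]⟩
  have h := hT γ G (τ / 8) (τ / 4) (by linarith)
    (fun s hs ↦ (hGd s (hsub hs)).hasDerivWithinAt) (hG.mono hsub) fun s hs ↦ ⟨hm s, ?_, ?_⟩
  · rw [hTγ _ ⟨by linarith, by linarith⟩, hTγ _ ⟨by linarith, by linarith⟩] at h
    exact lt_irrefl _ h
  · have h1 : Tendsto (fun t ↦ F.l (t⁻¹ • (γ (s + t) - γ s))) (𝓝[>] 0) (𝓝 (F.l (G s))) :=
      (F.l.continuous.tendsto _).comp (slope s (hsub hs))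
    have h2 : Tendsto (fun t ↦ F.l (t⁻¹ • (γ (s + t) - γ s))) (𝓝[>] 0) (𝓝 1) := by
      refine tendsto_const_nhds.congr' ?_
      filter_upwards [small s (hsub hs)] with t ht
      rw [map_smul, (hγ s (s + t) (hsub hs).1.le (by linarith [ht.1]) ht.2).1]
      simp [ht.1.ne']
    have h3 := tendsto_nhds_unique h1 h2
    intro h4
    rw [h4, map_zero] at h3
    exact zero_ne_one h3
  · have h1 := F.tendsto tendsto_const_nhds (slope s (hsub hs)) (hm s)
    have h2 : Tendsto (fun t ↦ -(F.C * √(F.C * t) * F.C)) (𝓝[>] 0)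
        (𝓝 (-(F.C * √(F.C * 0) * F.C))) :=
      Tendsto.mono_left (Continuous.tendsto (by fun_prop) _) nhdsWithin_le_nhds
    have h3 := le_of_tendsto_of_tendsto h2 h1 ?_
    · simpa using h3
    · filter_upwards [small s (hsub hs)] with t ht
      have h4 := (hγ s (s + t) (hsub hs).1.le (by linarith [ht.1]) ht.2).2.2
      rw [F.smul _ (hm s) _ _ (inv_nonneg.2 ht.1.le), inv_mul_eq_div, le_div_iff₀ ht.1]
      rw [show s + t - s = t by ring] at h4
      linarith

end limitCurve

/-- The level set of a function that increases along the cones is locally not met by the almost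
causal past of its points. -/
theorem exists_almostPast_bound [ProperSpace E] {r : ℝ} (hr0 : 0 < r) (hr : r < R)
    (hT : F.Increasing T) {L : ℝ}
    (hL : ∀ x ∈ ball p R, ∀ y ∈ ball p R, |T x - T y| ≤ L * ‖x - y‖) (hTp : T p = 0) :
    ∃ ε > 0, ∀ q ∈ F.almostPast r ε, ‖q - p‖ < r / 2 ∨ T q < -ε := by
  by_contra! H
  have hTc : ContinuousOn T (ball p R) := by
    have : LipschitzOnWith L.toNNReal T (ball p R) := by
      refine LipschitzOnWith.of_dist_le_mul fun x hx y hy ↦ ?_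
      rw [dist_eq_norm, dist_eq_norm, Real.norm_eq_abs]
      exact (hL x hx y hy).trans
        (mul_le_mul_of_nonneg_right (Real.le_coe_toNNReal L) (norm_nonneg _))
    exact this.continuousOn
  obtain ⟨γ, τ, hτ, hm, hγ, hγτ, hγ0⟩ := F.exists_limit_curve hr0 hr hTc H
  have hγ : F.IsWeaklyCausal γ τ := hγ
  obtain ⟨δ, K, hδ, hdec⟩ := hγ.decrease_le hr hm hT hL
  have mono : ∀ s s', 0 ≤ s → s ≤ s' → s' ≤ τ → T (γ s) ≤ T (γ s') :=
    fun s s' hs hss hs' ↦ le_of_decrease_le (φ := T ∘ γ) hδ hdec hs hss hs'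
  -- `T` is nondecreasing along the curve, at least 0 at the start and 0 at the end, so it vanishes
  -- throughout.
  refine hγ.not_const hτ (fun s ↦ closedBall_subset_ball hr (hm s)) hT fun s hs ↦ ?_
  apply le_antisymm
  · have := mono s τ hs.1 hs.2 le_rfl
    rwa [hγτ, hTp] at this
  · exact hγ0.trans (mono 0 s le_rfl hs.1 hs.2)

end ConeField

end Spacetime

/-! ### Smooth local time functions -/

namespace Spacetime

open Filter Metric

namespace ConeField

variable {E : Type*} [NormedAddCommGroup E] [NormedSpace ℝ E] {p : E} {R : ℝ}
  {F : ConeField E p R} {T : E → ℝ}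

open MeasureTheory in
open scoped Convolution in
/-- A smoothing of the indicator function of the complement of the almost causal past. -/
lemma exists_smooth_indicator [FiniteDimensional ℝ E] {r ε σ : ℝ} (hr : r ≤ R)
    (hσ0 : 0 < σ) (hσε : F.C * √σ < ε) :
    ∃ H : E → ℝ, ContDiff ℝ ∞ H ∧ (∀ q, 0 ≤ H q) ∧
      (∀ q, ball q σ ⊆ F.almostPast r ε → H q = 0) ∧
      (∀ q, Disjoint (ball q σ) (F.almostPast r ε) → H q = 1) ∧
      ∀ q ∈ ball p (r - σ), ∀ v, v ≠ 0 → 0 ≤ F.f q v → 0 ≤ fderiv ℝ H q v := by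
  classical
  borelize E
  have hε : 0 < ε := lt_of_le_of_lt (mul_nonneg F.C_pos.le (Real.sqrt_nonneg _)) hσε
  set μ : Measure E := Measure.addHaar
  set P := F.almostPast r ε
  have hP : MeasurableSet P := (F.isOpen_almostPast hr).measurableSet
  set g : E → ℝ := Pᶜ.indicator fun _ ↦ 1 with hg
  have g1 : ∀ x, x ∉ P → g x = 1 := fun x hx ↦ indicator_of_mem (s := Pᶜ) hx _
  have g0 : ∀ x ∈ P, g x = 0 := fun x hx ↦ indicator_of_notMem (s := Pᶜ) (not_not.2 hx) _
  have gnn : ∀ x, 0 ≤ g x := fun x ↦ indicator_nonneg (fun _ _ ↦ zero_le_one) _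
  have gli : LocallyIntegrable g μ :=
    (locallyIntegrable_const (1 : ℝ)).indicator hP.compl
  let φ : ContDiffBump (0 : E) := ⟨σ / 2, σ, half_pos hσ0, half_lt_self hσ0⟩
  have φc : HasCompactSupport (φ.normed μ) := φ.hasCompactSupport_normed
  have φs : ContDiff ℝ ∞ (φ.normed μ) := φ.contDiff_normed
  have ex := φc.convolutionExists_left (ContinuousLinearMap.lsmul ℝ ℝ) φs.continuous gli
  set H : E → ℝ := φ.normed μ ⋆[ContinuousLinearMap.lsmul ℝ ℝ, μ] g with hH
  have Hs : ContDiff ℝ ∞ H := φc.contDiff_convolution_left _ φs gli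
  refine ⟨H, Hs, fun q ↦ ?_, fun q hq ↦ ?_, fun q hq ↦ ?_, fun q hq v hv0 hv ↦ ?_⟩
  · exact integral_nonneg fun z ↦ mul_nonneg (φ.nonneg_normed z) (gnn _)
  · have hq0 := g0 q (hq (mem_ball_self hσ0))
    rw [← hq0]
    exact φ.normed_convolution_eq_right fun x hx ↦ by rw [hq0, g0 x (hq hx)]
  · have h1 : ∀ x ∈ ball q σ, g x = 1 := fun x hx ↦ g1 x (disjoint_left.1 hq hx)
    rw [← h1 q (mem_ball_self hσ0)]
    exact φ.normed_convolution_eq_right fun x hx ↦ by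
      rw [h1 x hx, h1 q (mem_ball_self hσ0)]
  · have hd := ((Hs.differentiable (by simp)) q).hasFDerivAt.hasLineDerivAt v
    have hsl := (hasDerivAt_iff_tendsto_slope_zero.1 hd).mono_left
      (nhdsWithin_mono _ fun x (hx : x ∈ Ioi (0 : ℝ)) ↦ ne_of_gt hx)
    refine ge_of_tendsto hsl ?_
    filter_upwards [Ioo_mem_nhdsGT (div_pos hε (norm_pos_iff.2 hv0))] with s hs
    simp only [zero_add, zero_smul, add_zero]
    refine smul_nonneg (inv_nonneg.2 hs.1.le) (sub_nonneg.2 ?_)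
    refine integral_mono (ex q) (ex (q + s • v)) fun z ↦ ?_
    simp only [ContinuousLinearMap.lsmul_apply, smul_eq_mul]
    by_cases hz : z ∈ ball (0 : E) σ
    · refine mul_le_mul_of_nonneg_left ?_ (φ.nonneg_normed z)
      rw [mem_ball_zero_iff] at hz
      -- One further step leads from `q - z` to this point: its direction `v` is causal at `q`, and
      -- by `hσε` the change of the cone over the distance `‖z‖ < σ` is less than the tolerated
      -- error. So `q - z` lies in `P` too, and the indicator of the complement does not decrease.
      by_cases h : q + s • v - z ∈ P
      · rw [g0 (q - z)]
        · exact gnn _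
        · have hqR : q ∈ ball p R := ball_subset_ball (by linarith) hq
          have hy : q - z ∈ ball p r := by
            rw [mem_ball_iff_norm] at hq ⊢
            calc ‖q - z - p‖ = ‖(q - p) - z‖ := by congr 1; abel
              _ ≤ ‖q - p‖ + ‖z‖ := norm_sub_le _ _
              _ < r := by linarith
          have hyR := ball_subset_ball hr hy
          refine F.almostPast_of_step ⟨hy, ?_, ?_⟩ h
          · rw [show q + s • v - z - (q - z) = s • v by abel, norm_smul,
              Real.norm_of_nonneg hs.1.le]
            exact (lt_div_iff₀ (norm_pos_iff.2 hv0)).1 hs.2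
          · rw [show q + s • v - z - (q - z) = s • v by abel, norm_smul,
              Real.norm_of_nonneg hs.1.le, F.smul _ hyR _ _ hs.1.le]
            have h1 := (abs_le.1 (F.holder _ hqR _ hyR v)).2
            rw [sub_sub_cancel] at h1
            have h2 : F.C * √‖z‖ * ‖v‖ < ε * ‖v‖ := by
              have := norm_pos_iff.2 hv0
              have h3 : F.C * √‖z‖ ≤ F.C * √σ :=
                mul_le_mul_of_nonneg_left (Real.sqrt_le_sqrt hz.le) F.C_pos.le
              exact mul_lt_mul_of_pos_right (h3.trans_lt hσε) this
            nlinarith [hs.1]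
      · rw [g1 _ h]
        exact indicator_le_self' (fun _ _ ↦ zero_le_one) _
    · have : φ.normed μ z = 0 := by
        rw [← Function.notMem_support, φ.support_normed_eq]
        exact hz
      rw [this]; simp

/-- Near a point of the zero set of `T` there is a smooth function `h` that increases along the
cones, is negative at the point and greater than `T` in a spherical layer around the point. -/
theorem exists_local_time [FiniteDimensional ℝ E] {r : ℝ} (hr0 : 0 < r) (hr : r < R)
    (hT : F.Increasing T) {L : ℝ}
    (hL : ∀ x ∈ ball p R, ∀ y ∈ ball p R, |T x - T y| ≤ L * ‖x - y‖) (hTp : T p = 0) :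
    ∃ (h : E → ℝ) (δ : ℝ), 0 < δ ∧ ContDiff ℝ ∞ h ∧ h p < 0 ∧
      (∀ q ∈ ball p (7 * r / 8), ∀ v, v ≠ 0 → 0 ≤ F.f q v → 0 < fderiv ℝ h q v) ∧
      ∀ q ∈ ball p (7 * r / 8), 5 * r / 8 ≤ ‖q - p‖ → T q + δ ≤ h q := by
  have : ProperSpace E := FiniteDimensional.proper_real E
  obtain ⟨ε, hε, hP⟩ := exists_almostPast_bound hr0 hr hT hL hTp
  obtain ⟨σ, hσ0, hσ1, hσ2, hσ3, hσ4⟩ : ∃ σ : ℝ, 0 < σ ∧ F.C * √σ < ε ∧ |L| * σ < ε / 2 ∧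
      σ < ε ∧ σ < r / 8 := by
    have l1 : Tendsto (fun δ : ℝ ↦ F.C * √δ) (𝓝[>] 0) (𝓝 (F.C * √0)) :=
      Tendsto.mono_left (Continuous.tendsto (by fun_prop) _) nhdsWithin_le_nhds
    have l2 : Tendsto (fun δ : ℝ ↦ |L| * δ) (𝓝[>] 0) (𝓝 (|L| * 0)) :=
      Tendsto.mono_left (Continuous.tendsto (by fun_prop) _) nhdsWithin_le_nhds
    rw [Real.sqrt_zero, mul_zero] at l1
    rw [mul_zero] at l2
    have h3 : Ioo 0 ε ∈ 𝓝[>] (0 : ℝ) := Ioo_mem_nhdsGT hε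
    have h4 : Ioo 0 (r / 8) ∈ 𝓝[>] (0 : ℝ) := Ioo_mem_nhdsGT (by linarith)
    obtain ⟨σ, ⟨h1, h2⟩, h3, h4⟩ := (((l1.eventually (gt_mem_nhds hε)).and
      (l2.eventually (gt_mem_nhds (half_pos hε)))).and (inter_mem h3 h4)).exists
    exact ⟨σ, h3.1, h1, h2, h3.2, h4.2⟩
  obtain ⟨H, Hs, H0, Hz, Ho, Hd⟩ := F.exists_smooth_indicator hr.le hσ0 hσ1
  -- `B` bounds the affine term on the ball, and `k` scales it to size at most `ε / 4`. This term
  -- makes the increase strict, and its `-1` makes the value at `p` negative. `A` lets `A * H`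
  -- dominate `T` where `H = 1`.
  set B := ‖F.l‖ * r + 1 with hB
  have hB0 : 0 < B := by positivity
  set k := ε / 4 / B with hk
  have hk0 : 0 < k := by positivity
  have hkB : k * B = ε / 4 := div_mul_cancel₀ _ hB0.ne'
  set A := |L| * r + ε with hA
  have hA0 : 0 < A := by positivity
  refine ⟨fun q ↦ A * H q + k * (F.l (q - p) - 1), ε / 4, by positivity, by fun_prop, ?_, ?_, ?_⟩
  · beta_reduce
    rw [Hz p ((ball_subset_ball hσ3.le).trans (F.ball_subset_almostPast r ε))]
    simpa using hk0
  · intro q hq v hv0 hv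
    have h1 : HasFDerivAt H (fderiv ℝ H q) q := ((Hs.differentiable (by simp)) q).hasFDerivAt
    have h2 : HasFDerivAt (fun q ↦ F.l (q - p) - 1) F.l q :=
      (F.l.hasFDerivAt.comp q ((hasFDerivAt_id q).sub_const p)).sub_const 1
    have h3 := (h1.const_mul A).add (h2.const_mul k)
    have h4 := Hd q (ball_subset_ball (by linarith) hq) v hv0 hv
    have h5 : 0 < F.l v := by
      have := F.norm_le (ball_subset_ball (by linarith) hq) hv
      exact pos_of_mul_pos_right ((norm_pos_iff.2 hv0).trans_le this) F.C_pos.le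
    erw [h3.fderiv]
    have : 0 < A * fderiv ℝ H q v + k * F.l v := by positivity
    simpa using this
  · intro q hq hq'
    rw [mem_ball_iff_norm] at hq
    have hqR : q ∈ ball p R := by rw [mem_ball_iff_norm]; linarith
    have hl : -B ≤ F.l (q - p) - 1 := by
      have h1 := (abs_le.1 (F.l.le_opNorm (q - p))).1
      have h2 : ‖F.l‖ * ‖q - p‖ ≤ ‖F.l‖ * r := by gcongr; linarith
      linarith
    have hl' : -(ε / 4) ≤ k * (F.l (q - p) - 1) := by
      rw [← hkB]; nlinarith
    -- Either `T q` is already well below `-ε / 4`, or the `σ`-ball around `q` misses the almost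
    -- causal past, whose points far from `p` have `T < -ε`.
    rcases lt_or_ge (T q) (-(ε / 2)) with h | h
    · have := mul_nonneg hA0.le (H0 q)
      linarith
    · have : H q = 1 := by
        refine Ho q (disjoint_left.2 fun x hx hxP ↦ ?_)
        rw [mem_ball_iff_norm] at hx
        have hxp : ‖q - p‖ ≤ ‖x - q‖ + ‖x - p‖ := by
          rw [norm_sub_rev x q]
          calc ‖q - p‖ = ‖(q - x) + (x - p)‖ := by congr 1; abel
            _ ≤ _ := norm_add_le _ _
        have hxp' : ‖x - p‖ ≤ ‖x - q‖ + ‖q - p‖ := by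
          calc ‖x - p‖ = ‖(x - q) + (q - p)‖ := by congr 1; abel
            _ ≤ _ := norm_add_le _ _
        rcases hP x hxP with h1 | h1
        · linarith
        · have h2 := (abs_le.1 (hL x (by rw [mem_ball_iff_norm]; linarith) q hqR)).1
          have h3 : L * ‖x - q‖ ≤ |L| * σ :=
            mul_le_mul (le_abs_self L) hx.le (norm_nonneg _) (abs_nonneg _)
          linarith
      beta_reduce
      rw [this]
      have h2 := (abs_le.1 (hL q hqR p (mem_ball_self (by linarith)))).2
      have h3 : L * ‖q - p‖ ≤ |L| * r :=
        mul_le_mul (le_abs_self L) (by linarith) (norm_nonneg _) (abs_nonneg _)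
      rw [hTp] at h2
      linarith

end ConeField

end Spacetime

/-! ### Algebra of a Lorentzian form -/

namespace Spacetime

open Filter Metric

section LorentzForm

variable {E : Type*} [NormedAddCommGroup E] [NormedSpace ℝ E]

/-- The spatial form of the bilinear form `G` with respect to the vector `e`. -/
noncomputable def spatialForm (G : E →L[ℝ] E →L[ℝ] ℝ) (e v w : E) : ℝ := -(G e e) * G v w + G v e * G w e

/-- The function that is nonnegative on the causal cone of `G` that contains `e`. -/
noncomputable def coneFun (G : E →L[ℝ] E →L[ℝ] ℝ) (e v : E) : ℝ :=
  -(G v e) - √(spatialForm G e v v)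

variable {G G' : E →L[ℝ] E →L[ℝ] ℝ} {e : E}

/-- If `G e e ≠ 0`, the spatial form is `-(G e e)` times `G` on the `G`-orthogonal projection off
`e`; the direction `e` is in its kernel. -/
lemma spatialForm_sub_smul (hG : ∀ v w, G v w = G w v) (v : E) (t : ℝ) :
    spatialForm G e (v - t • e) (v - t • e) = spatialForm G e v v := by
  simp only [spatialForm, map_sub, map_smul, FunLike.coe_sub,
    FunLike.coe_smul, Pi.sub_apply, Pi.smul_apply, smul_eq_mul, hG e v]
  ring

/-- Minkowski's inequality, from Cauchy–Schwarz for a positive semidefinite form by the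
discriminant. It makes `coneFun` superadditive. -/
lemma sqrt_spatialForm_add_le (hG : ∀ v w, G v w = G w v) (h0 : ∀ v, 0 ≤ spatialForm G e v v)
    (v w : E) : √(spatialForm G e (v + w) (v + w)) ≤
      √(spatialForm G e v v) + √(spatialForm G e w w) := by
  have expand : ∀ t : ℝ, spatialForm G e (v + t • w) (v + t • w) =
      spatialForm G e w w * (t * t) + 2 * spatialForm G e v w * t + spatialForm G e v v := by
    intro t
    simp only [spatialForm, map_add, map_smul, FunLike.coe_add,
      FunLike.coe_smul, Pi.add_apply, Pi.smul_apply, smul_eq_mul, hG w v]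
    ring
  have hd := discrim_le_zero (a := spatialForm G e w w) (b := 2 * spatialForm G e v w)
    (c := spatialForm G e v v) fun t ↦ by rw [← expand]; exact h0 _
  rw [discrim] at hd
  have h1 := expand 1
  rw [one_smul] at h1
  rw [Real.sqrt_le_left (by positivity), h1, add_sq, Real.sq_sqrt (h0 v), Real.sq_sqrt (h0 w)]
  have h2 : spatialForm G e v w ≤ √(spatialForm G e v v) * √(spatialForm G e w w) := by
    rw [← Real.sqrt_mul (h0 v)]
    exact Real.le_sqrt_of_sq_le (by linarith)
  linarith

lemma norm_spatialForm_sub_le {M : ℝ} (hM : ‖G‖ ≤ M) (hM' : ‖G'‖ ≤ M) (v : E) :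
    |spatialForm G e v v - spatialForm G' e v v| ≤ 4 * M * ‖e‖ ^ 2 * ‖G - G'‖ * ‖v‖ ^ 2 := by
  have b : ∀ (A : E →L[ℝ] E →L[ℝ] ℝ) (m : ℝ), ‖A‖ ≤ m → ∀ x y, |A x y| ≤ m * ‖x‖ * ‖y‖ :=
    fun A m h x y ↦ (A.le_opNorm₂ x y).trans (by gcongr)
  have M0 : 0 ≤ M := G.opNorm_nonneg.trans hM
  have e1 : spatialForm G e v v - spatialForm G' e v v =
      -((G - G') e e * G v v) - G' e e * (G - G') v v + (G - G') v e * (G v e + G' v e) := by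
    simp only [spatialForm, FunLike.coe_sub, Pi.sub_apply]; ring
  have h1 : |(G - G') e e * G v v| ≤ (‖G - G'‖ * ‖e‖ * ‖e‖) * (M * ‖v‖ * ‖v‖) := by
    rw [abs_mul]
    exact mul_le_mul (b _ _ le_rfl _ _) (b _ _ hM _ _) (abs_nonneg _) (by positivity)
  have h2 : |G' e e * (G - G') v v| ≤ (M * ‖e‖ * ‖e‖) * (‖G - G'‖ * ‖v‖ * ‖v‖) := by
    rw [abs_mul]
    exact mul_le_mul (b _ _ hM' _ _) (b _ _ le_rfl _ _) (abs_nonneg _) (by positivity)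
  have h3 : |(G - G') v e * (G v e + G' v e)| ≤
      (‖G - G'‖ * ‖v‖ * ‖e‖) * (M * ‖v‖ * ‖e‖ + M * ‖v‖ * ‖e‖) := by
    rw [abs_mul]
    exact mul_le_mul (b _ _ le_rfl _ _)
      ((abs_add_le _ _).trans (add_le_add (b _ _ hM _ _) (b _ _ hM' _ _))) (abs_nonneg _)
      (by positivity)
  rw [e1]
  rw [abs_le] at *
  constructor <;> nlinarith [h1.1, h1.2, h2.1, h2.2, h3.1, h3.2]

lemma abs_spatialForm_le {M : ℝ} (hM : ‖G‖ ≤ M) (v : E) :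
    |spatialForm G e v v| ≤ (2 * M * ‖e‖ * ‖v‖) ^ 2 := by
  have b : ∀ x y, |G x y| ≤ M * ‖x‖ * ‖y‖ :=
    fun x y ↦ (G.le_opNorm₂ x y).trans (by gcongr)
  have M0 : 0 ≤ M := G.opNorm_nonneg.trans hM
  rw [spatialForm]
  calc |-(G e e) * G v v + G v e * G v e| ≤ |-(G e e) * G v v| + |G v e * G v e| := abs_add_le _ _
    _ = |G e e| * |G v v| + |G v e| * |G v e| := by rw [abs_mul, abs_mul, abs_neg]
    _ ≤ (M * ‖e‖ * ‖e‖) * (M * ‖v‖ * ‖v‖) + (M * ‖v‖ * ‖e‖) * (M * ‖v‖ * ‖e‖) := by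
        gcongr <;> exact b _ _
    _ ≤ _ := by nlinarith [sq_nonneg (M * ‖e‖ * ‖v‖)]

/-- Strict convexity of the cone, as an inequality between numbers. -/
lemma parallelogram_bound {x y η a b s : ℝ} (ha : 0 ≤ a) (hb : 0 ≤ b)
    (hη : 0 ≤ η) (hax : a ≤ x + η) (hby : b ≤ y + η) (hsxy : x + y - η ≤ s) :
    2 * a ^ 2 + 2 * b ^ 2 - s ^ 2 ≤ (x - y) ^ 2 + 36 * η * (|x| + |y| + η) := by
  have h1 : a ^ 2 ≤ (x + η) ^ 2 := by gcongr
  have h2 : b ^ 2 ≤ (y + η) ^ 2 := by gcongr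
  have hx := le_abs_self x
  have hy := le_abs_self y
  have h0x := abs_nonneg x
  have h0y := abs_nonneg y
  rcases le_total η (x + y) with h | h
  · have h3 : (x + y - η) ^ 2 ≤ s ^ 2 := by
      have : 0 ≤ x + y - η := by linarith
      gcongr
    nlinarith [mul_le_mul_of_nonneg_left hx hη, mul_le_mul_of_nonneg_left hy hη,
      mul_nonneg hη h0x, mul_nonneg hη h0y, sq_nonneg η]
  -- Since `0 ≤ b ≤ y + η`, one has `y ≥ -η` and hence `x ≤ 2 * η`; likewise with the roles
  -- exchanged. So `a` and `b` are themselves of order `η`.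
  · have h3 : a ^ 2 ≤ (3 * η) ^ 2 := by
      have : a ≤ 3 * η := by linarith
      gcongr
    have h4 : b ^ 2 ≤ (3 * η) ^ 2 := by
      have : b ≤ 3 * η := by linarith
      gcongr
    nlinarith [sq_nonneg s, sq_nonneg (x - y), mul_nonneg hη h0x, mul_nonneg hη h0y]

end LorentzForm

end Spacetime

/-! ### The causal cones of a metric on a small ball form a cone field -/

namespace Spacetime

open Filter Metric

section

variable {E : Type*} [NormedAddCommGroup E] [NormedSpace ℝ E]

/-- A symmetric bilinear form that is positive on a subspace of finite dimension is bounded from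
below there. -/
lemma exists_lower_bound [FiniteDimensional ℝ E] (G : E →L[ℝ] E →L[ℝ] ℝ) (l : E →L[ℝ] ℝ)
    (h : ∀ u, l u = 0 → u ≠ 0 → 0 < G u u) :
    ∃ c : ℝ, 0 < c ∧ ∀ u, l u = 0 → c * ‖u‖ ^ 2 ≤ G u u := by
  have : ProperSpace E := FiniteDimensional.proper_real E
  set K : Set E := sphere 0 1 ∩ {u | l u = 0} with hK
  have hKc : IsCompact K := (isCompact_sphere 0 1).inter_right
    (isClosed_eq l.continuous continuous_const)
  have hcont : Continuous fun u ↦ G u u := by fun_prop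
  have main : ∃ c : ℝ, 0 < c ∧ ∀ u ∈ K, c ≤ G u u := by
    rcases K.eq_empty_or_nonempty with hE | hne
    · exact ⟨1, one_pos, by simp [hE]⟩
    · obtain ⟨x, hx, hmin⟩ := hKc.exists_isMinOn hne hcont.continuousOn
      refine ⟨G x x, h x hx.2 ?_, fun u hu ↦ hmin hu⟩
      rintro rfl
      simpa using hx.1
  obtain ⟨c, hc, H⟩ := main
  refine ⟨c, hc, fun u hu ↦ ?_⟩
  rcases eq_or_ne u 0 with rfl | hu0
  · simp
  · have hn := norm_pos_iff.2 hu0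
    have h1 := H (‖u‖⁻¹ • u) ⟨by simp [norm_smul, hn.ne'], by simp [hu]⟩
    simp only [map_smul, FunLike.coe_smul, Pi.smul_apply, smul_eq_mul] at h1
    have : G u u = ‖u‖ ^ 2 * (‖u‖⁻¹ * (‖u‖⁻¹ * G u u)) := by field_simp
    rw [this, mul_comm]
    gcongr

variable {G : E → E →L[ℝ] E →L[ℝ] ℝ} {p e : E}

/-- The numerical bounds that make the causal cones of `G` on a ball into a `ConeField`. -/
structure ConeBounds (G : E → E →L[ℝ] E →L[ℝ] ℝ) (p e : E) (R K M c : ℝ) : Prop where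
  R_pos : 0 < R
  R_le : R ≤ 1 / 2
  c_pos : 0 < c
  K_nonneg : 0 ≤ K
  symm : ∀ y ∈ ball p R, ∀ v w, G y v w = G y w v
  lip : ∀ y ∈ ball p R, ∀ y' ∈ ball p R, ‖G y - G y'‖ ≤ K * ‖y - y'‖
  norm_le : ∀ y ∈ ball p R, ‖G y‖ ≤ M
  timelike : ∀ y ∈ ball p R, c ≤ -(G y e e)
  spatial : ∀ y ∈ ball p R, ∀ u, G p u e = 0 → c ^ 2 * ‖u‖ ^ 2 ≤ spatialForm (G y) e u u
  small : K * R * ‖e‖ ≤ c / 4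
  small' : K * R * ‖e‖ * ‖e‖ ≤ c / 4

/-- At `p` the estimates hold with room to spare: `m` for `e` and `m * c₀` for the spatial form.
Lipschitz dependence on the point keeps half of each on a small ball. -/
lemma exists_coneBounds [FiniteDimensional ℝ E] {R₀ K : ℝ} (hR₀ : 0 < R₀)
    (symm : ∀ y ∈ ball p R₀, ∀ v w, G y v w = G y w v)
    (lip : ∀ y ∈ ball p R₀, ∀ y' ∈ ball p R₀, ‖G y - G y'‖ ≤ K * ‖y - y'‖)
    (he : G p e e < 0) (hpos : ∀ u, G p u e = 0 → u ≠ 0 → 0 < G p u u) :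
    ∃ R M c, R ≤ R₀ ∧ ConeBounds G p e R |K| M c := by
  obtain ⟨c₀, hc₀, hcG⟩ := exists_lower_bound (G p) ((G p).flip e) (by simpa using hpos)
  set m := -(G p e e) with hm
  have hm0 : 0 < m := by linarith
  set M := ‖G p‖ + |K| with hM
  have hM0 : 0 ≤ M := add_nonneg (G p).opNorm_nonneg (abs_nonneg _)
  obtain ⟨c, hc, hcm, hcc⟩ : ∃ c : ℝ, 0 < c ∧ c ≤ m / 2 ∧ c ^ 2 ≤ m * c₀ / 2 := by
    refine ⟨min (m / 2) √(m * c₀ / 2), by positivity, min_le_left _ _, ?_⟩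
    have h1 : 0 ≤ min (m / 2) √(m * c₀ / 2) := by positivity
    have h2 := pow_le_pow_left₀ h1 (min_le_right _ _) 2
    rwa [Real.sq_sqrt (show 0 ≤ m * c₀ / 2 by positivity)] at h2
  obtain ⟨R, hR, h1, h2, h3, h4, h5⟩ : ∃ R : ℝ, 0 < R ∧ R ≤ min R₀ (1 / 2) ∧
      |K| * R * ‖e‖ ≤ c / 4 ∧ |K| * R * ‖e‖ * ‖e‖ ≤ c / 4 ∧ |K| * R * ‖e‖ * ‖e‖ ≤ m / 2 ∧
      4 * M * ‖e‖ ^ 2 * (|K| * R) ≤ m * c₀ / 2 := by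
    have lim : ∀ (φ : ℝ → ℝ) (b : ℝ), Continuous φ → φ 0 = 0 → 0 < b →
        ∀ᶠ R in 𝓝[>] (0 : ℝ), φ R ≤ b := by
      intro φ b hφ h0 hb
      have := (hφ.tendsto 0).mono_left (nhdsWithin_le_nhds (s := Ioi (0 : ℝ)))
      rw [h0] at this
      exact this.eventually (ge_mem_nhds hb)
    have hev : ∀ᶠ R in 𝓝[>] (0 : ℝ), 0 < R := self_mem_nhdsWithin
    have := (((hev.and
      (lim (fun R ↦ R) (min R₀ (1 / 2)) continuous_id rfl (by positivity))).and
      (lim (fun R ↦ |K| * R * ‖e‖) (c / 4) (by fun_prop) (by simp) (by positivity))).and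
      (lim (fun R ↦ |K| * R * ‖e‖ * ‖e‖) (c / 4) (by fun_prop) (by simp) (by positivity))).and
      ((lim (fun R ↦ |K| * R * ‖e‖ * ‖e‖) (m / 2) (by fun_prop) (by simp) (by positivity)).and
      (lim (fun R ↦ 4 * M * ‖e‖ ^ 2 * (|K| * R)) (m * c₀ / 2) (by fun_prop) (by simp)
        (by positivity)))
    obtain ⟨R, ⟨⟨⟨h0, h1⟩, h2⟩, h3⟩, h4, h5⟩ := this.exists
    exact ⟨R, h0, h1, h2, h3, h4, h5⟩
  have hR₀' : R ≤ R₀ := h1.trans (min_le_left _ _)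
  have hRh : R ≤ 1 / 2 := h1.trans (min_le_right _ _)
  have hsub := ball_subset_ball (x := p) hR₀'
  have lip' : ∀ y ∈ ball p R, ∀ y' ∈ ball p R, ‖G y - G y'‖ ≤ |K| * ‖y - y'‖ :=
    fun y hy y' hy' ↦ (lip y (hsub hy) y' (hsub hy')).trans
      (mul_le_mul_of_nonneg_right (le_abs_self K) (norm_nonneg _))
  have hp : p ∈ ball p R := mem_ball_self hR
  have diff : ∀ y ∈ ball p R, ‖G y - G p‖ ≤ |K| * R := fun y hy ↦
    (lip' y hy p hp).trans (mul_le_mul_of_nonneg_left (mem_ball_iff_norm.1 hy).le (abs_nonneg _))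
  have nle : ∀ y ∈ ball p R, ‖G y‖ ≤ M := by
    intro y hy
    have h1 : ‖G y‖ ≤ ‖G p‖ + ‖G y - G p‖ := by
      calc ‖G y‖ = ‖G p + (G y - G p)‖ := by congr 1; abel
        _ ≤ _ := ContinuousLinearMap.opNorm_add_le _ _
    have h2 : |K| * R ≤ |K| := mul_le_of_le_one_right (abs_nonneg _) (by linarith)
    linarith [diff y hy]
  refine ⟨R, M, c, hR₀', hR, hRh, hc, abs_nonneg _, fun y hy ↦ symm y (hsub hy), lip', nle,
    fun y hy ↦ ?_, fun y hy u hu ↦ ?_, h2, h3⟩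
  · have h6 := (G y - G p).le_opNorm₂ e e
    have h7 : ‖G y - G p‖ * ‖e‖ * ‖e‖ ≤ |K| * R * ‖e‖ * ‖e‖ := by gcongr; exact diff y hy
    have h8 := (abs_le.1 (h6.trans h7)).2
    simp only [FunLike.coe_sub, Pi.sub_apply] at h8
    linarith
  · have h6 := (abs_le.1 (norm_spatialForm_sub_le (e := e) (nle y hy) (nle p hp) u)).1
    have h7 : 4 * M * ‖e‖ ^ 2 * ‖G y - G p‖ * ‖u‖ ^ 2 ≤ m * c₀ / 2 * ‖u‖ ^ 2 := by
      refine mul_le_mul_of_nonneg_right (le_trans ?_ h5) (by positivity)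
      gcongr
      exact diff y hy
    have h8 : spatialForm (G p) e u u = m * G p u u := by simp [spatialForm, hu, hm]
    have h9 := mul_le_mul_of_nonneg_left (hcG u (by simpa using hu)) hm0.le
    have h10 : c ^ 2 * ‖u‖ ^ 2 ≤ m * c₀ / 2 * ‖u‖ ^ 2 := by gcongr
    linarith

lemma coneFun_smul (y : E) {t : ℝ} (ht : 0 ≤ t) (v : E) :
    coneFun (G y) e (t • v) = t * coneFun (G y) e v := by
  have : spatialForm (G y) e (t • v) (t • v) = t ^ 2 * spatialForm (G y) e v v := by
    simp only [spatialForm, map_smul, FunLike.coe_smul, Pi.smul_apply, smul_eq_mul]; ring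
  rw [coneFun, coneFun, this, Real.sqrt_mul (by positivity), Real.sqrt_sq ht]
  simp only [map_smul, FunLike.coe_smul, Pi.smul_apply, smul_eq_mul]
  ring

namespace ConeBounds

variable {R K M c : ℝ}

lemma mem_self (H : ConeBounds G p e R K M c) : p ∈ ball p R := mem_ball_self H.R_pos

lemma spatialForm_nonneg (H : ConeBounds G p e R K M c) {y : E} (hy : y ∈ ball p R) (v : E) : 0 ≤ spatialForm (G y) e v v := by
  have hm : 0 < -(G p e e) := H.c_pos.trans_le (H.timelike p H.mem_self)
  have hne : G p e e ≠ 0 := by linarith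
  rw [← spatialForm_sub_smul (H.symm y hy) v (G p v e / G p e e)]
  refine le_trans (by positivity) (H.spatial y hy _ ?_)
  simp [hne]

lemma sub_form_le (H : ConeBounds G p e R K M c) {y : E} (hy : y ∈ ball p R) (v : E) :
    |G y v e - G p v e| ≤ K * R * ‖e‖ * ‖v‖ := by
  have h1 := (G y - G p).le_opNorm₂ v e
  have h2 : ‖G y - G p‖ ≤ K * R := (H.lip y hy p H.mem_self).trans
    (mul_le_mul_of_nonneg_left (mem_ball_iff_norm.1 hy).le H.K_nonneg)
  calc |G y v e - G p v e| ≤ ‖G y - G p‖ * ‖v‖ * ‖e‖ := h1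
    _ ≤ K * R * ‖v‖ * ‖e‖ := by gcongr
    _ = K * R * ‖e‖ * ‖v‖ := by ring

lemma M_nonneg (H : ConeBounds G p e R K M c) : 0 ≤ M := (G p).opNorm_nonneg.trans (H.norm_le p H.mem_self)

lemma add_le (H : ConeBounds G p e R K M c) {y : E} (hy : y ∈ ball p R) (v w : E) :
    coneFun (G y) e v + coneFun (G y) e w ≤ coneFun (G y) e (v + w) := by
  have := sqrt_spatialForm_add_le (H.symm y hy) (H.spatialForm_nonneg hy) v w
  simp only [coneFun, map_add, FunLike.coe_add, Pi.add_apply]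
  linarith

lemma bound (H : ConeBounds G p e R K M c) {y : E} (hy : y ∈ ball p R) (v : E) :
    |coneFun (G y) e v| ≤ 3 * M * ‖e‖ * ‖v‖ := by
  have hM := H.M_nonneg
  have h1 : |G y v e| ≤ M * ‖v‖ * ‖e‖ := ((G y).le_opNorm₂ v e).trans (by
    gcongr; exact H.norm_le y hy)
  have h2 : √(spatialForm (G y) e v v) ≤ 2 * M * ‖e‖ * ‖v‖ := by
    rw [Real.sqrt_le_left (by positivity)]
    exact (le_abs_self _).trans (abs_spatialForm_le (H.norm_le y hy) v)
  have h3 := Real.sqrt_nonneg (spatialForm (G y) e v v)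
  have h4 := abs_le.1 h1
  rw [coneFun, abs_le]
  constructor <;> linarith

/-- The spatial form is Lipschitz in the point but degenerate along `e`, so its square root is
controlled through `√a - √b ≤ √|a - b|`, with exponent 1/2. The linear term has the better exponent
1, which `R ≤ 1 / 2` allows to be weakened. -/
lemma holder (H : ConeBounds G p e R K M c) {y y' : E} (hy : y ∈ ball p R) (hy' : y' ∈ ball p R) (v : E) :
    |coneFun (G y) e v - coneFun (G y') e v| ≤
      (K * ‖e‖ + √(4 * M * ‖e‖ ^ 2 * K)) * √‖y - y'‖ * ‖v‖ := by
  have hM := H.M_nonneg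
  have hK := H.K_nonneg
  have hyy : ‖y - y'‖ ≤ 1 := by
    have h1 := mem_ball_iff_norm.1 hy
    have h2 := mem_ball_iff_norm'.1 hy'
    have := H.R_le
    calc ‖y - y'‖ = ‖(y - p) + (p - y')‖ := by congr 1; abel
      _ ≤ ‖y - p‖ + ‖p - y'‖ := norm_add_le _ _
      _ ≤ 1 := by linarith
  have hsq : ‖y - y'‖ ≤ √‖y - y'‖ := Real.le_sqrt_of_sq_le (by
    rw [sq]; exact mul_le_of_le_one_left (norm_nonneg _) hyy)
  have h1 : |G y v e - G y' v e| ≤ K * ‖e‖ * √‖y - y'‖ * ‖v‖ := by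
    calc |G y v e - G y' v e| ≤ ‖G y - G y'‖ * ‖v‖ * ‖e‖ := (G y - G y').le_opNorm₂ v e
      _ ≤ (K * √‖y - y'‖) * ‖v‖ * ‖e‖ := by
        gcongr; exact (H.lip y hy y' hy').trans (by gcongr)
      _ = _ := by ring
  have h2 : |√(spatialForm (G y) e v v) - √(spatialForm (G y') e v v)| ≤
      √(4 * M * ‖e‖ ^ 2 * K) * √‖y - y'‖ * ‖v‖ := by
    have key : |spatialForm (G y) e v v - spatialForm (G y') e v v| ≤
        4 * M * ‖e‖ ^ 2 * K * ‖y - y'‖ * ‖v‖ ^ 2 := by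
      refine (norm_spatialForm_sub_le (H.norm_le y hy) (H.norm_le y' hy') v).trans ?_
      calc _ ≤ 4 * M * ‖e‖ ^ 2 * (K * ‖y - y'‖) * ‖v‖ ^ 2 := by gcongr; exact H.lip y hy y' hy'
        _ = _ := by ring
    have e1 : √(4 * M * ‖e‖ ^ 2 * K) * √‖y - y'‖ * ‖v‖ =
        √(4 * M * ‖e‖ ^ 2 * K * ‖y - y'‖ * ‖v‖ ^ 2) := by
      rw [Real.sqrt_mul (show 0 ≤ 4 * M * ‖e‖ ^ 2 * K * ‖y - y'‖ by positivity) (‖v‖ ^ 2),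
        Real.sqrt_mul (show 0 ≤ 4 * M * ‖e‖ ^ 2 * K by positivity) ‖y - y'‖,
        Real.sqrt_sq (norm_nonneg _)]
    rw [e1]
    have sub : ∀ a b : ℝ, 0 ≤ b → √a - √b ≤ √|a - b| := by
      intro a b hb
      rw [sub_le_iff_le_add', Real.sqrt_le_left (by positivity), add_sq, Real.sq_sqrt hb,
        Real.sq_sqrt (abs_nonneg _)]
      have := le_abs_self (a - b)
      have : 0 ≤ 2 * √b * √|a - b| := by positivity
      linarith
    have h3 := sub (spatialForm (G y) e v v) _ (H.spatialForm_nonneg hy' v)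
    have h4 := sub (spatialForm (G y') e v v) _ (H.spatialForm_nonneg hy v)
    rw [abs_sub_comm] at h4
    have h5 := Real.sqrt_le_sqrt key
    rw [abs_le]; constructor <;> linarith
  have h3 := abs_le.1 h1
  have h4 := abs_le.1 h2
  rw [coneFun, coneFun, abs_le]
  constructor <;> nlinarith [h3.1, h3.2, h4.1, h4.2]

/-- Split `v = u + (x / m) • e` with `u` orthogonal to `e` at `p`. The spatial form controls `u` by
`x` plus a small multiple of `‖v‖`, which `small` and `small'` allow to be absorbed; this also
forces `x ≥ 0`. -/
lemma narrow (H : ConeBounds G p e R K M c) {y : E} (hy : y ∈ ball p R) {v : E}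
    (hv : -(c / (4 * (1 + ‖e‖)) * ‖v‖) ≤ coneFun (G y) e v) :
    ‖v‖ ≤ (3 / c + ‖e‖ / c) * -(G p v e) := by
  have hc := H.c_pos
  have hm : c ≤ -(G p e e) := H.timelike p H.mem_self
  have hK := H.K_nonneg
  have hR := H.R_pos
  set m := -(G p e e) with hmdef
  have hm0 : 0 < m := hc.trans_le hm
  set x := -(G p v e) with hx
  set u := v - (x / m) • e with hu
  have hlu : G p u e = 0 := by
    simp only [hu, map_sub, map_smul, FunLike.coe_sub, FunLike.coe_smul, Pi.sub_apply,
      Pi.smul_apply, smul_eq_mul]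
    rw [show G p v e = -x by rw [hx]; ring, show G p e e = -m by rw [hmdef]; ring]
    field_simp; ring
  have hN := H.spatial y hy u hlu
  rw [hu, spatialForm_sub_smul (H.symm y hy), ← hu] at hN
  have h1 : c * ‖u‖ ≤ √(spatialForm (G y) e v v) := Real.le_sqrt_of_sq_le (by rwa [mul_pow])
  have h2 := abs_le.1 (H.sub_form_le hy v)
  set s := K * R * ‖e‖ with hs
  have hs0 : 0 ≤ s := by positivity
  set κ := c / (4 * (1 + ‖e‖)) with hκ
  have hκ0 : 0 ≤ κ := by positivity
  have hκ1 : κ * (1 + ‖e‖) = c / 4 := by rw [hκ]; field_simp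
  have hκe : 0 ≤ κ * ‖e‖ := by positivity
  have h3 : c * ‖u‖ ≤ x + (s + κ) * ‖v‖ := by
    rw [coneFun] at hv
    linarith [h2.1]
  have h4 : ‖v‖ ≤ ‖u‖ + |x| / m * ‖e‖ := by
    calc ‖v‖ = ‖u + (x / m) • e‖ := by rw [hu]; congr 1; abel
      _ ≤ ‖u‖ + ‖(x / m) • e‖ := norm_add_le _ _
      _ = _ := by rw [norm_smul, Real.norm_eq_abs, abs_div, abs_of_pos hm0]
  have h5 : (s + κ) * ‖e‖ ≤ m / 2 := by nlinarith [H.small']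
  have h6 : s + κ ≤ c / 2 := by nlinarith [H.small]
  have h7 : (s + κ) * ‖v‖ ≤ c / 2 * ‖u‖ + |x| / 2 := by
    calc (s + κ) * ‖v‖ ≤ (s + κ) * (‖u‖ + |x| / m * ‖e‖) := by gcongr
      _ = (s + κ) * ‖u‖ + (s + κ) * ‖e‖ * (|x| / m) := by ring
      _ ≤ c / 2 * ‖u‖ + m / 2 * (|x| / m) := by gcongr
      _ = _ := by field_simp
  have h8 : c / 2 * ‖u‖ ≤ x + |x| / 2 := by linarith
  have hx0 : 0 ≤ x := by
    by_contra! h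
    rw [abs_of_neg h] at h8
    have : 0 ≤ c / 2 * ‖u‖ := by positivity
    linarith
  rw [abs_of_nonneg hx0] at h8 h4
  have h9 : ‖u‖ ≤ 3 / c * x := by
    rw [div_mul_eq_mul_div, le_div_iff₀ hc]; linarith
  have h10 : x / m * ‖e‖ ≤ ‖e‖ / c * x := by
    calc x / m * ‖e‖ ≤ x / c * ‖e‖ := by gcongr
      _ = _ := by ring
  linarith

/-- Equality of the clock values puts `v - w` in the subspace where the spatial form is positive
definite. Its size there is given by the parallelogram identity, and `parallelogram_bound` estimates
the result; the remaining square is absorbed because `G y · e` is small on this subspace. -/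
lemma strict (H : ConeBounds G p e R K M c) {y : E} (hy : y ∈ ball p R) {v w : E} {η : ℝ} (hη : 0 ≤ η)
    (hvw : -(G p v e) = -(G p w e)) (hv : -η ≤ coneFun (G y) e v) (hw : -η ≤ coneFun (G y) e w)
    (hs : coneFun (G y) e (v + w) ≤ η) :
    ‖v - w‖ ^ 2 ≤ 72 / c ^ 2 * (M * ‖e‖ + 1) * η * (‖v‖ + ‖w‖ + η) := by
  have hc := H.c_pos
  have hM := H.M_nonneg
  have hu0 : G p (v - w) e = 0 := by
    simp only [map_sub, FunLike.coe_sub, Pi.sub_apply]; linarith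
  have h1 := H.spatial y hy _ hu0
  have h2 := H.sub_form_le hy (v - w)
  rw [hu0, sub_zero] at h2
  have h2' : |G y (v - w) e| ≤ c / 4 * ‖v - w‖ := h2.trans (by gcongr; exact H.small)
  have h3 := parallelogram_bound (x := -(G y v e)) (y := -(G y w e)) (η := η)
    (s := √(spatialForm (G y) e (v + w) (v + w)))
    (Real.sqrt_nonneg (spatialForm (G y) e v v)) (Real.sqrt_nonneg (spatialForm (G y) e w w)) hη
    (by rw [coneFun] at hv; linarith) (by rw [coneFun] at hw; linarith)
    (by
      simp only [coneFun, map_add, FunLike.coe_add, Pi.add_apply] at hs ⊢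
      linarith)
  rw [Real.sq_sqrt (H.spatialForm_nonneg hy _), Real.sq_sqrt (H.spatialForm_nonneg hy _),
    Real.sq_sqrt (H.spatialForm_nonneg hy _), abs_neg, abs_neg] at h3
  have hpar : 2 * spatialForm (G y) e v v + 2 * spatialForm (G y) e w w -
      spatialForm (G y) e (v + w) (v + w) = spatialForm (G y) e (v - w) (v - w) := by
    simp only [spatialForm, map_add, map_sub, FunLike.coe_add, FunLike.coe_sub, Pi.add_apply,
      Pi.sub_apply]
    ring
  have hsq : (-(G y v e) - -(G y w e)) ^ 2 ≤ (c / 4 * ‖v - w‖) ^ 2 := by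
    rw [← sq_abs]
    refine pow_le_pow_left₀ (abs_nonneg _) (le_trans (le_of_eq ?_) h2') 2
    rw [← abs_neg]
    simp only [map_sub, FunLike.coe_sub, Pi.sub_apply]
    congr 1; ring
  have b : ∀ v, |G y v e| ≤ M * ‖e‖ * ‖v‖ := fun v ↦ by
    calc |G y v e| ≤ ‖G y‖ * ‖v‖ * ‖e‖ := (G y).le_opNorm₂ v e
      _ ≤ M * ‖v‖ * ‖e‖ := by gcongr; exact H.norm_le y hy
      _ = _ := by ring
  have h4 : |G y v e| + |G y w e| + η ≤ (M * ‖e‖ + 1) * (‖v‖ + ‖w‖ + η) := by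
    have := b v
    have := b w
    have : 0 ≤ M * ‖e‖ * η := by positivity
    nlinarith [norm_nonneg v, norm_nonneg w]
  have h5 : 36 * η * (|G y v e| + |G y w e| + η) ≤
      36 * η * ((M * ‖e‖ + 1) * (‖v‖ + ‖w‖ + η)) := by gcongr
  have h6 : c ^ 2 / 2 * ‖v - w‖ ^ 2 ≤ 36 * η * ((M * ‖e‖ + 1) * (‖v‖ + ‖w‖ + η)) := by
    have : 0 ≤ c ^ 2 * ‖v - w‖ ^ 2 := by positivity
    rw [mul_pow] at hsq
    linarith
  calc ‖v - w‖ ^ 2 = 2 / c ^ 2 * (c ^ 2 / 2 * ‖v - w‖ ^ 2) := by field_simp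
    _ ≤ 2 / c ^ 2 * (36 * η * ((M * ‖e‖ + 1) * (‖v‖ + ‖w‖ + η))) := by gcongr
    _ = _ := by ring

lemma coneFun_self (H : ConeBounds G p e R K M c) {y : E} (hy : y ∈ ball p R) : c ≤ coneFun (G y) e e := by
  have : spatialForm (G y) e e e = 0 := by simp [spatialForm]
  rw [coneFun, this, Real.sqrt_zero, sub_zero]
  exact H.timelike y hy

/-- Squaring `√(spatialForm) ≤ -(G v e)` leaves `G v v ≤ 0`. If `G v e = 0`, the spatial form of `v`
vanishes, so `v` is a multiple of the timelike `e` and hence zero. -/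
lemma coneFun_nonneg_iff (H : ConeBounds G p e R K M c) {y : E} (hy : y ∈ ball p R) {v : E} (hv : v ≠ 0) :
    0 ≤ coneFun (G y) e v ↔ G y v v ≤ 0 ∧ G y v e < 0 := by
  have hc := H.c_pos
  have hm := hc.trans_le (H.timelike y hy)
  have hN := H.spatialForm_nonneg hy v
  rw [coneFun, sub_nonneg]
  constructor
  · intro h
    have h0 : 0 ≤ -(G y v e) := (Real.sqrt_nonneg _).trans h
    have h1 : spatialForm (G y) e v v ≤ (-(G y v e)) ^ 2 := (Real.sqrt_le_left h0).1 h
    refine ⟨?_, ?_⟩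
    · rw [spatialForm] at h1
      by_contra! h2
      nlinarith [mul_pos hm h2]
    · refine lt_of_le_of_ne (by linarith) fun h2 ↦ ?_
      rw [h2, neg_zero, zero_pow two_ne_zero] at h1
      have hmp : 0 < -(G p e e) := hc.trans_le (H.timelike p H.mem_self)
      have hne : G p e e ≠ 0 := by linarith
      have h3 := H.spatial y hy (v - (G p v e / G p e e) • e) (by simp [hne])
      rw [spatialForm_sub_smul (H.symm y hy)] at h3
      have h4 : ‖v - (G p v e / G p e e) • e‖ = 0 := by
        have : c ^ 2 * ‖v - (G p v e / G p e e) • e‖ ^ 2 ≤ 0 := h3.trans h1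
        by_contra h5
        have : 0 < c ^ 2 * ‖v - (G p v e / G p e e) • e‖ ^ 2 := by positivity
        linarith
      rw [norm_eq_zero, sub_eq_zero] at h4
      rw [h4] at h2 hv
      simp only [map_smul, FunLike.coe_smul, Pi.smul_apply, smul_eq_mul, mul_eq_zero] at h2
      rcases h2 with h2 | h2
      · exact hv (by rw [h2, zero_smul])
      · linarith
  · rintro ⟨h1, h2⟩
    rw [Real.sqrt_le_left (by linarith), spatialForm]
    nlinarith [mul_nonneg hm.le (neg_nonneg.2 h1)]

/-- The causal cones of `G`, as a `ConeField`. -/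
noncomputable def coneField (H : ConeBounds G p e R K M c) : ConeField E p R where
  f y v := coneFun (G y) e v
  l := -((G p).flip e)
  e := e
  -- A sum of nonnegative constants, one for each of the required estimates, so it dominates each of
  -- them.
  C := 1 + 3 * M * ‖e‖ + (K * ‖e‖ + √(4 * M * ‖e‖ ^ 2 * K)) + (3 / c + ‖e‖ / c) +
    72 / c ^ 2 * (M * ‖e‖ + 1)
  κ := c / (4 * (1 + ‖e‖))
  one_le_C := by
    have := H.c_pos; have := H.M_nonneg; have := H.K_nonneg
    have : 0 ≤ 3 * M * ‖e‖ + (K * ‖e‖ + √(4 * M * ‖e‖ ^ 2 * K)) + (3 / c + ‖e‖ / c) +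
      72 / c ^ 2 * (M * ‖e‖ + 1) := by positivity
    linarith
  κ_pos := by have := H.c_pos; positivity
  add_le y hy v w := H.add_le hy v w
  smul y _ t v ht := coneFun_smul y ht v
  holder y hy y' hy' v := by
    refine (H.holder hy hy' v).trans ?_
    have := H.c_pos; have := H.M_nonneg; have := H.K_nonneg
    have : 0 ≤ 1 + 3 * M * ‖e‖ + (3 / c + ‖e‖ / c) + 72 / c ^ 2 * (M * ‖e‖ + 1) := by positivity
    refine mul_le_mul_of_nonneg_right (mul_le_mul_of_nonneg_right ?_ (Real.sqrt_nonneg _))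
      (norm_nonneg _)
    linarith
  bound y hy v := by
    refine (H.bound hy v).trans ?_
    have := H.c_pos; have := H.M_nonneg; have := H.K_nonneg
    have : 0 ≤ 1 + (K * ‖e‖ + √(4 * M * ‖e‖ ^ 2 * K)) + (3 / c + ‖e‖ / c) +
      72 / c ^ 2 * (M * ‖e‖ + 1) := by positivity
    gcongr
    linarith
  narrow y hy v hv := by
    have h1 := H.narrow hy hv
    have := H.c_pos; have := H.M_nonneg; have := H.K_nonneg
    have hpos : 0 < 3 / c + ‖e‖ / c := by positivity
    have hx : 0 ≤ -(G p v e) := nonneg_of_mul_nonneg_right ((norm_nonneg _).trans h1) hpos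
    have : 0 ≤ 1 + 3 * M * ‖e‖ + (K * ‖e‖ + √(4 * M * ‖e‖ ^ 2 * K)) +
      72 / c ^ 2 * (M * ‖e‖ + 1) := by positivity
    refine h1.trans (mul_le_mul_of_nonneg_right ?_ hx)
    linarith
  interior y hy := by
    refine le_trans ?_ (H.coneFun_self hy)
    have := H.c_pos
    exact div_le_self this.le (by linarith [norm_nonneg e])
  strict y hy v w η hη hvw hv hw hs := by
    refine (H.strict hy hη hvw hv hw hs).trans ?_
    have := H.c_pos; have := H.M_nonneg; have := H.K_nonneg
    have : 0 ≤ 1 + 3 * M * ‖e‖ + (K * ‖e‖ + √(4 * M * ‖e‖ ^ 2 * K)) + (3 / c + ‖e‖ / c) := by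
      positivity
    gcongr
    linarith

end ConeBounds

end

end Spacetime

/-! ### The metric and causal vectors in a chart -/

namespace Spacetime

open Filter Metric

variable {d : ℕ} {M : Type*} [TopologicalSpace M] [ChartedSpace (EuclideanSpace ℝ (Fin d)) M]
  [IsManifold (𝓡 d) ∞ M] {g : LorentzianMetric d M}

namespace LorentzianMetric

/-- The signature condition speaks of one timelike `v`. If `g(w, w) ≤ 0`, then `g` is negative
semidefinite on the span of `e` and `w`; this plane contains a nonzero vector `u` orthogonal to `v`,
where `g` must be positive. -/
lemma pos_of_orthogonal (g : LorentzianMetric d M) {x : M} {e w : TangentSpace (𝓡 d) x}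
    (he : g.form x e e < 0) (hw : g.form x e w = 0) (hw0 : w ≠ 0) : 0 < g.form x w w := by
  by_contra! h
  obtain ⟨v, hv, hpos⟩ := g.signature x
  set u := (g.form x v w) • e - (g.form x v e) • w with hu
  have h1 : g.form x v u = 0 := by simp [hu]; ring
  have hwe : g.form x w e = 0 := by rw [g.symm, hw]
  have h2 : g.form x u u = (g.form x v w) ^ 2 * g.form x e e +
      (g.form x v e) ^ 2 * g.form x w w := by
    simp [hu, hw, hwe]; ring
  have h3 : u ≠ 0 := by
    intro h3
    have h4 : g.form x e u = g.form x v w * g.form x e e := by simp [hu, hw]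
    rw [h3, map_zero] at h4
    have h5 : g.form x v w = 0 := (mul_eq_zero.1 h4.symm).resolve_right he.ne
    rw [hu, h5, zero_smul, zero_sub, neg_eq_zero, smul_eq_zero] at h3
    have h6 := h3.resolve_right hw0
    have h7 := hpos e h6 (by rintro rfl; simp at he)
    linarith
  have h4 := hpos u h1 h3
  have h5 : (g.form x v w) ^ 2 * g.form x e e ≤ 0 :=
    mul_nonpos_of_nonneg_of_nonpos (sq_nonneg _) he.le
  have h6 : (g.form x v e) ^ 2 * g.form x w w ≤ 0 :=
    mul_nonpos_of_nonneg_of_nonpos (sq_nonneg _) h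
  linarith

/-- Timelike vectors in a common cone select the same causal vectors. Otherwise a combination `v + t
• e` with `t ≥ 0` is orthogonal to the timelike `e'`, though it is timelike and hence cannot be
spacelike or zero. -/
lemma neg_of_neg (g : LorentzianMetric d M) {x : M} {e e' v : TangentSpace (𝓡 d) x}
    (he : g.form x e e < 0) (he' : g.form x e' e' < 0) (hee : g.form x e e' < 0)
    (hv : g.form x v v ≤ 0) (hve : g.form x v e < 0) : g.form x v e' < 0 := by
  by_contra! h
  set t := g.form x v e' / -(g.form x e e') with ht
  have ht0 : 0 ≤ t := div_nonneg h (by linarith)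
  set w := v + t • e with hw
  have h1 : g.form x e' w = 0 := by
    rw [g.symm, hw]
    have : g.form x v e' = t * -(g.form x e e') := by rw [ht, div_mul_cancel₀]; linarith
    simp [this]
  have h2 : g.form x w w = g.form x v v + 2 * t * g.form x v e + t ^ 2 * g.form x e e := by
    simp [hw, g.symm x e v]; ring
  rcases eq_or_ne w 0 with h3 | h3
  · have h4 : g.form x w e = g.form x v e + t * g.form x e e := by simp [hw]
    rw [h3] at h4
    simp only [map_zero, FunLike.coe_zero, Pi.zero_apply] at h4
    nlinarith
  · have h4 := g.pos_of_orthogonal he' h1 h3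
    nlinarith [mul_nonneg ht0 (neg_nonneg.2 hve.le), mul_nonneg (sq_nonneg t) (neg_nonneg.2 he.le)]

end LorentzianMetric

/-- The coordinate frame of the chart at `p`, as a linear map to the tangent space at `x`. -/
noncomputable def chartFrame (d : ℕ) {M : Type*} [TopologicalSpace M]
    [ChartedSpace (EuclideanSpace ℝ (Fin d)) M] [IsManifold (𝓡 d) ∞ M] (p x : M) :
    EuclideanSpace ℝ (Fin d) →L[ℝ] TangentSpace (𝓡 d) x :=
  (trivializationAt (EuclideanSpace ℝ (Fin d)) (TangentSpace (𝓡 d)) p).symmL ℝ x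

/-- The metric in the coordinates of the chart at `p`. -/
noncomputable def chartMetric (g : LorentzianMetric d M) (p : M) (y : EuclideanSpace ℝ (Fin d)) :
    EuclideanSpace ℝ (Fin d) →L[ℝ] EuclideanSpace ℝ (Fin d) →L[ℝ] ℝ :=
  LinearMap.toContinuousLinearMap (LinearMap.toContinuousLinearMap.toLinearMap ∘ₗ
    (LinearMap.mk₂ ℝ (fun v w ↦ g.form ((extChartAt (𝓡 d) p).symm y)
      (chartFrame d p ((extChartAt (𝓡 d) p).symm y) v)
      (chartFrame d p ((extChartAt (𝓡 d) p).symm y) w))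
      (fun _ _ _ ↦ by rw [map_add, map_add]; rfl) (fun _ _ _ ↦ by rw [map_smul, map_smul]; rfl)
      (fun _ _ _ ↦ by rw [map_add, map_add]) (fun _ _ _ ↦ by rw [map_smul, map_smul])))

lemma chartMetric_apply (p : M) (y v w : EuclideanSpace ℝ (Fin d)) :
    chartMetric g p y v w = g.form ((extChartAt (𝓡 d) p).symm y)
      (chartFrame d p ((extChartAt (𝓡 d) p).symm y) v)
      (chartFrame d p ((extChartAt (𝓡 d) p).symm y) w) := rfl

lemma contMDiffOn_chartFrame (p : M) (v : EuclideanSpace ℝ (Fin d)) :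
    ContMDiffOn (𝓡 d) ((𝓡 d).prod 𝓘(ℝ, EuclideanSpace ℝ (Fin d))) ∞
      (fun x : M ↦ (⟨x, chartFrame d p x v⟩ : TangentBundle (𝓡 d) M))
      (chartAt (EuclideanSpace ℝ (Fin d)) p).source := by
  set e := trivializationAt (EuclideanSpace ℝ (Fin d)) (TangentSpace (𝓡 d)) p with he
  have h : ContMDiffOn ((𝓡 d).prod 𝓘(ℝ, EuclideanSpace ℝ (Fin d)))
      ((𝓡 d).prod 𝓘(ℝ, EuclideanSpace ℝ (Fin d))) ∞
      e.toOpenPartialHomeomorph.symm e.target := e.contMDiffOn_symm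
  have h2 : ContMDiffOn (𝓡 d) ((𝓡 d).prod 𝓘(ℝ, EuclideanSpace ℝ (Fin d))) ∞
      (fun x : M ↦ (x, v)) e.baseSet := contMDiffOn_id.prodMk contMDiffOn_const
  refine (h.comp h2 fun x hx ↦ by simpa [e.mem_target] using hx).congr fun x hx ↦ ?_
  rw [Function.comp_apply, ← e.mk_symm hx v, chartFrame, e.symmL_apply hx]

/-- In finite dimension it suffices to test the form on fixed vectors, whose frame fields are smooth
sections of the tangent bundle. -/
lemma contDiffOn_chartMetric (p : M) :
    ContDiffOn ℝ ∞ (chartMetric g p) (extChartAt (𝓡 d) p).target := by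
  rw [contDiffOn_clm_apply]
  intro v
  rw [contDiffOn_clm_apply]
  intro w
  rw [← contMDiffOn_iff_contDiffOn]
  have h : ContMDiffOn (𝓡 d) ((𝓡 d).prod 𝓘(ℝ, ℝ)) ∞ (fun x : M ↦
      Bundle.TotalSpace.mk' ℝ (E := Bundle.Trivial M ℝ) x
        (g.form x (chartFrame d p x v) (chartFrame d p x w)))
      (chartAt (EuclideanSpace ℝ (Fin d)) p).source := by
    apply ContMDiffOn.clm_bundle_apply₂ (F₁ := EuclideanSpace ℝ (Fin d))
      (F₂ := EuclideanSpace ℝ (Fin d))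
    · exact g.contMDiff.contMDiffOn
    · exact contMDiffOn_chartFrame p v
    · exact contMDiffOn_chartFrame p w
  have h2 : ContMDiffOn (𝓡 d) 𝓘(ℝ, ℝ) ∞
      (fun x : M ↦ g.form x (chartFrame d p x v) (chartFrame d p x w))
      (chartAt (EuclideanSpace ℝ (Fin d)) p).source := by
    intro x hx
    have := h x hx
    simp only [Bundle.contMDiffWithinAt_totalSpace] at this
    exact this.2
  refine h2.comp (contMDiffOn_extChartAt_symm p) fun y hy ↦ ?_
  simpa using (extChartAt (𝓡 d) p).map_target hy

lemma continuousOn_form_chartFrame (τ : TimeOrientation g) (p : M)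
    (v : EuclideanSpace ℝ (Fin d)) :
    ContinuousOn (fun x ↦ g.form x (chartFrame d p x v) (τ.field x))
      (chartAt (EuclideanSpace ℝ (Fin d)) p).source := by
  have h : ContinuousOn (fun x : M ↦
      Bundle.TotalSpace.mk' ℝ (E := Bundle.Trivial M ℝ) x
        (g.form x (chartFrame d p x v) (τ.field x)))
      (chartAt (EuclideanSpace ℝ (Fin d)) p).source := by
    apply ContinuousOn.clm_bundle_apply₂ (F₁ := EuclideanSpace ℝ (Fin d))
      (F₂ := EuclideanSpace ℝ (Fin d))
    · exact g.contMDiff.continuous.continuousOn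
    · exact (contMDiffOn_chartFrame p v).continuousOn
    · exact τ.continuous.continuousOn
  exact (Bundle.Trivial.homeomorphProd M ℝ).continuous.snd.comp_continuousOn h

lemma mfderiv_chartFrame {p x : M} (hx : x ∈ (chartAt (EuclideanSpace ℝ (Fin d)) p).source)
    (v : EuclideanSpace ℝ (Fin d)) :
    (mfderiv (𝓡 d) 𝓘(ℝ, EuclideanSpace ℝ (Fin d)) (extChartAt (𝓡 d) p) x)
      (chartFrame d p x v) = v := by
  rw [← TangentBundle.continuousLinearMapAt_trivializationAt hx]
  exact Bundle.Trivialization.continuousLinearMapAt_symmL _ hx v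

lemma chartFrame_mfderiv {p x : M} (hx : x ∈ (chartAt (EuclideanSpace ℝ (Fin d)) p).source)
    (w : TangentSpace (𝓡 d) x) :
    chartFrame d p x ((mfderiv (𝓡 d) 𝓘(ℝ, EuclideanSpace ℝ (Fin d)) (extChartAt (𝓡 d) p) x) w)
      = w := by
  rw [← TangentBundle.continuousLinearMapAt_trivializationAt hx]
  exact Bundle.Trivialization.symmL_continuousLinearMapAt _ hx w

lemma chartFrame_eq_zero {p x : M} (hx : x ∈ (chartAt (EuclideanSpace ℝ (Fin d)) p).source)
    {v : EuclideanSpace ℝ (Fin d)} : chartFrame d p x v = 0 ↔ v = 0 := by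
  constructor
  · intro h
    have := mfderiv_chartFrame hx v
    rw [h, map_zero] at this
    exact this.symm
  · rintro rfl; exact map_zero _

/-- A curve in a chart domain, in coordinates. -/
lemma hasDerivWithinAt_chart {p : M} {γ : ℝ → M} {J : Set ℝ} {s : ℝ}
    (hγ : MDifferentiableWithinAt 𝓘(ℝ, ℝ) (𝓡 d) γ J s)
    (hs : γ s ∈ (chartAt (EuclideanSpace ℝ (Fin d)) p).source) :
    HasDerivWithinAt (extChartAt (𝓡 d) p ∘ γ)
      ((mfderiv (𝓡 d) 𝓘(ℝ, EuclideanSpace ℝ (Fin d)) (extChartAt (𝓡 d) p) (γ s))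
        (mfderivWithin 𝓘(ℝ, ℝ) (𝓡 d) γ J s (1 : ℝ))) J s := by
  have h1 := (mdifferentiableAt_extChartAt (I := 𝓡 d) hs).hasMFDerivAt
  have h2 := h1.comp_hasMFDerivWithinAt s hγ.hasMFDerivWithinAt
  have h3 : ∀ L : ℝ →L[ℝ] EuclideanSpace ℝ (Fin d),
      HasFDerivWithinAt (extChartAt (𝓡 d) p ∘ γ) L J s →
      HasDerivWithinAt (extChartAt (𝓡 d) p ∘ γ) (L 1) J s := fun L h ↦ h.hasDerivWithinAt
  exact h3 _ h2.hasFDerivWithinAt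

/-- The velocity of a curve given in coordinates. -/
lemma mfderivWithin_chart_symm {p : M} {y : ℝ → EuclideanSpace ℝ (Fin d)}
    {v : EuclideanSpace ℝ (Fin d)} {J : Set ℝ} {s : ℝ} (hJ : UniqueDiffWithinAt ℝ J s)
    (hy : HasDerivWithinAt y v J s) (hs : y s ∈ (extChartAt (𝓡 d) p).target) :
    mfderivWithin 𝓘(ℝ, ℝ) (𝓡 d) ((extChartAt (𝓡 d) p).symm ∘ y) J s (1 : ℝ) =
      chartFrame d p ((extChartAt (𝓡 d) p).symm (y s)) v := by
  have hx : (extChartAt (𝓡 d) p).symm (y s) ∈ (chartAt (EuclideanSpace ℝ (Fin d)) p).source := by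
    simpa using (extChartAt (𝓡 d) p).map_target hs
  have h1 := (mdifferentiableWithinAt_extChartAt_symm (I := 𝓡 d) hs).hasMFDerivWithinAt
  have h2 : HasMFDerivWithinAt 𝓘(ℝ, ℝ) 𝓘(ℝ, EuclideanSpace ℝ (Fin d)) y J s _ :=
    hy.hasFDerivWithinAt.hasMFDerivWithinAt
  have h3 := h1.comp s h2 (fun _ _ ↦ by simp)
  have h4 := h3.mfderivWithin hJ.uniqueMDiffWithinAt
  rw [h4]
  have h5 := TangentBundle.symmL_trivializationAt (I := 𝓡 d) (𝕜 := ℝ) hx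
  rw [chartFrame, h5, (extChartAt (𝓡 d) p).right_inv hs]
  exact congrArg (mfderivWithin 𝓘(ℝ, EuclideanSpace ℝ (Fin d)) (𝓡 d) (extChartAt (𝓡 d) p).symm
    (range (𝓡 d)) (y s)) (ContinuousLinearMap.toSpanSingleton_apply_one ℝ v)

end Spacetime

/-! ### Causal curves: restriction, translation, concatenation -/

namespace Spacetime

open Filter Metric

variable {d : ℕ} {M : Type*} [TopologicalSpace M] [ChartedSpace (EuclideanSpace ℝ (Fin d)) M]
  [IsManifold (𝓡 d) ∞ M] {g : LorentzianMetric d M} {τ : TimeOrientation g}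

section curves

variable {γ γ₁ γ₂ : ℝ → M} {a b c : ℝ}

lemma uniqueMDiffWithinAt_Icc (hab : a < b) {s : ℝ} (hs : s ∈ Icc a b) :
    UniqueMDiffWithinAt 𝓘(ℝ, ℝ) (Icc a b) s :=
  (uniqueDiffOn_Icc hab s hs).uniqueMDiffWithinAt

lemma IsC1CausalOn.mdifferentiableWithinAt (h : IsC1CausalOn τ γ a b) {s : ℝ}
    (hs : s ∈ Icc a b) : MDifferentiableWithinAt 𝓘(ℝ, ℝ) (𝓡 d) γ (Icc a b) s :=
  (h.1 s hs).mdifferentiableWithinAt one_ne_zero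

lemma IsC1CausalOn.mono (h : IsC1CausalOn τ γ a b) {a' b' : ℝ} (ha : a ≤ a') (hab : a' < b')
    (hb : b' ≤ b) : IsC1CausalOn τ γ a' b' := by
  have hsub : Icc a' b' ⊆ Icc a b := Icc_subset_Icc ha hb
  refine ⟨h.1.mono hsub, fun s hs ↦ ?_⟩
  rw [mfderivWithin_subset hsub (uniqueMDiffWithinAt_Icc hab hs)
    (h.mdifferentiableWithinAt (hsub hs))]
  exact h.2 s (hsub hs)

lemma IsC1CausalOn.isCausalCurveOn (h : IsC1CausalOn τ γ a b) :
    IsCausalCurveOn τ γ (Icc a b) where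
  ordConnected := ordConnected_Icc
  right _ ht u hu htu := ⟨u, ⟨htu, le_rfl⟩, h.mono ht.1 htu hu.2⟩
  left _ ht u hu hut := ⟨u, ⟨le_rfl, hut⟩, h.mono hu.1 hut ht.2⟩

/-- All tangent spaces are the same model space by definition, so a coordinate vector can be moved
along an equality of base points. -/
lemma isFutureCausal_congr {x y : M} (h : x = y) {v : EuclideanSpace ℝ (Fin d)}
    (hv : IsFutureCausal τ (x := x) v) : IsFutureCausal τ (x := y) v := by
  subst h; exact hv

lemma IsC1CausalOn.congr (h : IsC1CausalOn τ γ₁ a b) (he : EqOn γ₂ γ₁ (Icc a b)) :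
    IsC1CausalOn τ γ₂ a b := by
  refine ⟨h.1.congr he, fun s hs ↦ ?_⟩
  have h1 := h.2 s hs
  have h2 : mfderivWithin 𝓘(ℝ, ℝ) (𝓡 d) γ₂ (Icc a b) s =
    mfderivWithin 𝓘(ℝ, ℝ) (𝓡 d) γ₁ (Icc a b) s := mfderivWithin_congr he (he hs)
  rw [h2]
  exact isFutureCausal_congr (he hs).symm h1

lemma IsC1CausalOn.comp_add_const (h : IsC1CausalOn τ γ a b) (hab : a < b) (c : ℝ) :
    IsC1CausalOn τ (fun t ↦ γ (t + c)) (a - c) (b - c) := by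
  have hm : MapsTo (fun t : ℝ ↦ t + c) (Icc (a - c) (b - c)) (Icc a b) :=
    fun t ht ↦ ⟨by linarith [ht.1], by linarith [ht.2]⟩
  have hd : ∀ s, HasMFDerivWithinAt 𝓘(ℝ, ℝ) 𝓘(ℝ, ℝ) (fun t : ℝ ↦ t + c) (Icc (a - c) (b - c)) s
      (ContinuousLinearMap.id ℝ ℝ) := fun s ↦
    ((hasFDerivAt_id s).add_const c).hasFDerivWithinAt.hasMFDerivWithinAt
  refine ⟨h.1.comp (contMDiff_iff_contDiff.2 (by fun_prop)).contMDiffOn hm, fun s hs ↦ ?_⟩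
  have h1 := ((h.mdifferentiableWithinAt (hm hs)).hasMFDerivWithinAt.comp s (hd s)
    hm.subset_preimage)
  have h2 := h1.mfderivWithin (uniqueMDiffWithinAt_Icc (by linarith) hs)
  have h3 : mfderivWithin 𝓘(ℝ, ℝ) (𝓡 d) (fun t ↦ γ (t + c)) (Icc (a - c) (b - c)) s =
    mfderivWithin 𝓘(ℝ, ℝ) (𝓡 d) γ (Icc a b) (s + c) := h2
  rw [h3]
  exact h.2 _ (hm hs)

lemma IsCausalCurveOn.comp_add_const (h : IsCausalCurveOn τ γ (Icc a b)) (c : ℝ) :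
    IsCausalCurveOn τ (fun t ↦ γ (t + c)) (Icc (a - c) (b - c)) where
  ordConnected := ordConnected_Icc
  right t ht u hu htu := by
    obtain ⟨b', hb', h'⟩ := h.right (t + c) ⟨by linarith [ht.1], by linarith [ht.2]⟩ (u + c)
      ⟨by linarith [hu.1], by linarith [hu.2]⟩ (by linarith)
    have := h'.comp_add_const hb'.1 c
    rw [add_sub_cancel_right] at this
    exact ⟨b' - c, ⟨by linarith [hb'.1], by linarith [hb'.2]⟩, this⟩
  left t ht u hu htu := by
    obtain ⟨b', hb', h'⟩ := h.left (t + c) ⟨by linarith [ht.1], by linarith [ht.2]⟩ (u + c)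
      ⟨by linarith [hu.1], by linarith [hu.2]⟩ (by linarith)
    have := h'.comp_add_const hb'.2 c
    rw [add_sub_cancel_right] at this
    exact ⟨b' - c, ⟨by linarith [hb'.1], by linarith [hb'.2]⟩, this⟩

lemma IsCausalCurveOn.congr {I : Set ℝ} (h : IsCausalCurveOn τ γ₁ I) (he : EqOn γ₂ γ₁ I) :
    IsCausalCurveOn τ γ₂ I where
  ordConnected := h.ordConnected
  right t ht u hu htu := by
    obtain ⟨b, hb, h'⟩ := h.right t ht u hu htu
    exact ⟨b, hb, h'.congr (he.mono ((Icc_subset_Icc_right hb.2).trans (h.ordConnected.out ht hu)))⟩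
  left t ht u hu htu := by
    obtain ⟨b, hb, h'⟩ := h.left t ht u hu htu
    exact ⟨b, hb, h'.congr (he.mono ((Icc_subset_Icc_left hb.1).trans (h.ordConnected.out hu ht)))⟩

lemma IsCausalCurveOn.union (h₁ : IsCausalCurveOn τ γ (Icc a b))
    (h₂ : IsCausalCurveOn τ γ (Icc b c)) : IsCausalCurveOn τ γ (Icc a c) where
  ordConnected := ordConnected_Icc
  right t ht u hu htu := by
    rcases lt_or_ge t b with h | h
    · obtain ⟨b', hb', h'⟩ := h₁.right t ⟨ht.1, h.le⟩ (min u b)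
        ⟨ht.1.trans (le_min htu.le h.le), min_le_right _ _⟩ (lt_min htu h)
      exact ⟨b', ⟨hb'.1, hb'.2.trans (min_le_left _ _)⟩, h'⟩
    · exact h₂.right t ⟨h, ht.2⟩ u ⟨h.trans htu.le, hu.2⟩ htu
  left t ht u hu htu := by
    rcases lt_or_ge b t with h | h
    · obtain ⟨b', hb', h'⟩ := h₂.left t ⟨h.le, ht.2⟩ (max u b)
        ⟨le_max_right _ _, (max_le htu.le h.le).trans ht.2⟩ (max_lt htu h)
      exact ⟨b', ⟨(le_max_left _ _).trans hb'.1, hb'.2⟩, h'⟩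
    · exact h₁.left t ⟨ht.1, h⟩ u ⟨hu.1, htu.le.trans h⟩ htu

/-- Concatenation of causal curves. -/
lemma exists_concat {a' b' : ℝ} (hab : a < b) (hab' : a' < b')
    (h₁ : IsCausalCurveOn τ γ₁ (Icc a b))
    (h₂ : IsCausalCurveOn τ γ₂ (Icc a' b')) (h : γ₁ b = γ₂ a') :
    ∃ (γ : ℝ → M) (c : ℝ), a < c ∧ IsCausalCurveOn τ γ (Icc a c) ∧ γ a = γ₁ a ∧
      γ c = γ₂ b' := by
  classical
  set γ : ℝ → M := fun t ↦ if t ≤ b then γ₁ t else γ₂ (t + (a' - b)) with hγ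
  have e1 : EqOn γ γ₁ (Icc a b) := fun t ht ↦ if_pos ht.2
  have e2 : EqOn γ (fun t ↦ γ₂ (t + (a' - b))) (Icc b (b' - (a' - b))) := by
    intro t ht
    rcases ht.1.eq_or_lt with rfl | h'
    · simp only [hγ, le_refl, if_true, h]; congr 1; ring
    · exact if_neg (not_le.2 h')
  have h₃ := h₂.comp_add_const (a' - b)
  rw [show a' - (a' - b) = b by ring] at h₃
  have h4 : b ≤ b' - (a' - b) := by linarith
  refine ⟨γ, b' - (a' - b), by linarith, (h₁.congr e1).union (h₃.congr e2),
    e1 ⟨le_rfl, hab.le⟩, ?_⟩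
  rw [e2 ⟨h4, le_rfl⟩]
  simp

lemma causalFuture_subset_of_subset {S S' : Set M} (h : S' ⊆ causalFuture τ S) :
    causalFuture τ S' ⊆ causalFuture τ S := by
  rintro q ⟨p, hp, hpq⟩
  obtain ⟨r, hr, hrp⟩ := h hp
  refine ⟨r, hr, ?_⟩
  rcases hpq with rfl | ⟨γ₂, a', b', hab', h₂, rfl, rfl⟩
  · exact hrp
  · rcases hrp with rfl | ⟨γ₁, a, b, hab, h₁, rfl, h₃⟩
    · exact Or.inr ⟨γ₂, a', b', hab', h₂, rfl, rfl⟩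
    · obtain ⟨γ, c, hc, h4, h5, h6⟩ := exists_concat hab hab' h₁ h₂ h₃
      exact Or.inr ⟨γ, a, c, hc, h4, h5, h6⟩

lemma causalPast_subset_of_subset {S S' : Set M} (h : S' ⊆ causalPast τ S) :
    causalPast τ S' ⊆ causalPast τ S := by
  rintro q ⟨p, hp, hpq⟩
  obtain ⟨r, hr, hrp⟩ := h hp
  refine ⟨r, hr, ?_⟩
  rcases hpq with rfl | ⟨γ₁, a, b, hab, h₁, rfl, h₃⟩
  · exact hrp
  · rcases hrp with rfl | ⟨γ₂, a', b', hab', h₂, rfl, rfl⟩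
    · exact Or.inr ⟨γ₁, a, b, hab, h₁, rfl, h₃⟩
    · obtain ⟨γ, c, hc, h4, h5, h6⟩ := exists_concat hab hab' h₁ h₂ h₃
      exact Or.inr ⟨γ, a, c, hc, h4, h5, h6⟩

lemma IsCausalCurveOn.continuousOn {I : Set ℝ} (h : IsCausalCurveOn τ γ I) :
    ContinuousOn γ I := by
  intro t ht
  have hl : ContinuousWithinAt γ (I ∩ Iic t) t := by
    by_cases hu : ∃ u ∈ I, u < t
    · obtain ⟨u, hu, hut⟩ := hu
      obtain ⟨a, ha, h'⟩ := h.left t ht u hu hut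
      have h1 : ContinuousWithinAt γ (Icc a t) t := h'.1.continuousOn t ⟨ha.2.le, le_rfl⟩
      refine h1.mono_of_mem_nhdsWithin ?_
      filter_upwards [self_mem_nhdsWithin, mem_nhdsWithin_of_mem_nhds (Ioi_mem_nhds ha.2)]
        with x hx hx'
      exact ⟨le_of_lt hx', hx.2⟩
    · push Not at hu
      have hsub : I ∩ Iic t ⊆ {t} := fun x hx ↦ le_antisymm hx.2 (hu x hx.1)
      exact (continuousWithinAt_singleton (f := γ) (x := t)).mono hsub
  have hr : ContinuousWithinAt γ (I ∩ Ici t) t := by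
    by_cases hu : ∃ u ∈ I, t < u
    · obtain ⟨u, hu, hut⟩ := hu
      obtain ⟨a, ha, h'⟩ := h.right t ht u hu hut
      have h1 : ContinuousWithinAt γ (Icc t a) t := h'.1.continuousOn t ⟨le_rfl, ha.1.le⟩
      refine h1.mono_of_mem_nhdsWithin ?_
      filter_upwards [self_mem_nhdsWithin, mem_nhdsWithin_of_mem_nhds (Iio_mem_nhds ha.1)]
        with x hx hx'
      exact ⟨hx.2, le_of_lt hx'⟩
    · push Not at hu
      have hsub : I ∩ Ici t ⊆ {t} := fun x hx ↦ le_antisymm (hu x hx.1) hx.2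
      exact (continuousWithinAt_singleton (f := γ) (x := t)).mono hsub
  have := hl.union hr
  rwa [← inter_union_distrib_left, Iic_union_Ici, inter_univ] at this

end curves

/-- A function on an interval that is increasing from and to each point is strictly increasing. -/
lemma strictMonoOn_of_local {φ : ℝ → ℝ} {I : Set ℝ} (hI : I.OrdConnected)
    (hr : ∀ t ∈ I, ∀ u ∈ I, t < u → ∃ b ∈ Ioc t u, ∀ s ∈ Ioc t b, φ t < φ s)
    (hl : ∀ t ∈ I, ∀ u ∈ I, u < t → ∃ a ∈ Ico u t, ∀ s ∈ Ico a t, φ s < φ t) :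
    StrictMonoOn φ I := by
  intro x hx y hy hxy
  -- `hl` puts the supremum of `A` into `A`, and `hr` moves it further to the right unless it equals
  -- `y`.
  set A : Set ℝ := {t | t ∈ Icc x y ∧ ∀ s ∈ Ioc x t, φ x < φ s} with hA
  have hxA : x ∈ A := ⟨⟨le_rfl, hxy.le⟩, fun s hs ↦ absurd hs.1 (not_lt.2 hs.2)⟩
  have hbdd : BddAbove A := ⟨y, fun t ht ↦ ht.1.2⟩
  set c := sSup A with hc
  have hxc : x ≤ c := le_csSup hbdd hxA
  have hcy : c ≤ y := csSup_le ⟨x, hxA⟩ fun t ht ↦ ht.1.2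
  have hcI : c ∈ I := hI.out hx hy ⟨hxc, hcy⟩
  have below : ∀ s, x < s → s < c → φ x < φ s := by
    intro s hs hsc
    obtain ⟨t, ht, hst⟩ := exists_lt_of_lt_csSup ⟨x, hxA⟩ hsc
    exact ht.2 s ⟨hs, hst.le⟩
  have hcA : c ∈ A := by
    refine ⟨⟨hxc, hcy⟩, fun s hs ↦ ?_⟩
    rcases hs.2.lt_or_eq with h | rfl
    · exact below s hs.1 h
    · obtain ⟨a, ha, h⟩ := hl c hcI x hx hs.1
      have h1 : φ ((a + c) / 2) < φ c := h _ ⟨by linarith [ha.2], by linarith [ha.2]⟩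
      have h2 : φ x < φ ((a + c) / 2) :=
        below _ (by linarith [ha.1, ha.2]) (by linarith [ha.2])
      exact h2.trans h1
  rcases hcy.lt_or_eq with h | h
  · obtain ⟨b, hb, h'⟩ := hr c hcI y hy h
    have hbA : b ∈ A := by
      refine ⟨⟨hxc.trans hb.1.le, hb.2⟩, fun s hs ↦ ?_⟩
      rcases le_or_gt s c with hsc | hsc
      · exact hcA.2 s ⟨hs.1, hsc⟩
      · have h1 := h' s ⟨hsc, hs.2⟩
        rcases hxc.eq_or_lt with h2 | h2
        · rwa [← h2] at h1
        · exact (hcA.2 c ⟨h2, le_rfl⟩).trans h1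
    exact absurd (le_csSup hbdd hbA) (not_le.2 hb.1)
  · rw [h] at hcA
    exact hcA.2 y ⟨hxy, le_rfl⟩

end Spacetime

/-! ### Charts with cone fields -/

namespace Spacetime

open Filter Metric

variable {d : ℕ} {M : Type*} [TopologicalSpace M] [ChartedSpace (EuclideanSpace ℝ (Fin d)) M]
  [IsManifold (𝓡 d) ∞ M] {g : LorentzianMetric d M}

/-- A coordinate ball around `p`, inside `U`, on which the future causal cones are given by a
`ConeField`. -/
structure ConeChart (τ : TimeOrientation g) (p : M) (U : Set M) where
  /-- the radius -/
  R : ℝ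
  /-- the cones in coordinates -/
  F : ConeField (EuclideanSpace ℝ (Fin d)) (extChartAt (𝓡 d) p p) R
  R_pos : 0 < R
  target : ball (extChartAt (𝓡 d) p p) R ⊆ (extChartAt (𝓡 d) p).target
  sub : ∀ y ∈ ball (extChartAt (𝓡 d) p p) R, (extChartAt (𝓡 d) p).symm y ∈ U
  causal_iff : ∀ y ∈ ball (extChartAt (𝓡 d) p p) R, ∀ v,
    IsFutureCausal τ (chartFrame d p ((extChartAt (𝓡 d) p).symm y) v) ↔ v ≠ 0 ∧ 0 ≤ F.f y v

/-- Take for `e` the coordinates of the time orientation at `p`, as a constant vector. By continuity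
it remains timelike and on the future side nearby, so `neg_of_neg` identifies the cone selected by
`e` with the one selected by `τ`. Continuity suffices for `τ`; the Lipschitz bounds come from the
smooth metric. -/
theorem exists_coneChart (τ : TimeOrientation g) (p : M) {U : Set M} (hU : U ∈ 𝓝 p) :
    Nonempty (ConeChart τ p U) := by
  set φ := extChartAt (𝓡 d) p with hφ
  have hp : p ∈ (chartAt (EuclideanSpace ℝ (Fin d)) p).source :=
    mem_chart_source (EuclideanSpace ℝ (Fin d)) p
  have hφp : φ.symm (φ p) = p := extChartAt_to_inv p
  have htarget : φ.target ∈ 𝓝 (φ p) := extChartAt_target_mem_nhds p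
  have hsymm : Tendsto φ.symm (𝓝 (φ p)) (𝓝 p) := by
    have := continuousAt_extChartAt_symm (I := 𝓡 d) p
    rwa [ContinuousAt, extChartAt_to_inv] at this
  have hsrc : ∀ y ∈ φ.target, φ.symm y ∈ (chartAt (EuclideanSpace ℝ (Fin d)) p).source :=
    fun y hy ↦ by
      have := φ.map_target hy
      rwa [hφ, extChartAt_source] at this
  set e : EuclideanSpace ℝ (Fin d) :=
    (mfderiv (𝓡 d) 𝓘(ℝ, EuclideanSpace ℝ (Fin d)) φ p) (τ.field p) with he
  have hAe : chartFrame d p p e = τ.field p := chartFrame_mfderiv hp _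
  set G := chartMetric g p with hG
  have Gp : ∀ v w, G (φ p) v w = g.form p (chartFrame d p p v) (chartFrame d p p w) := by
    intro v w
    rw [hG, chartMetric_apply, ← hφ, hφp]
  have hee : G (φ p) e e < 0 := by rw [Gp, hAe]; exact τ.timelike p
  have hpos : ∀ u, G (φ p) u e = 0 → u ≠ 0 → 0 < G (φ p) u u := by
    intro u hu hu0
    rw [Gp] at hu ⊢
    rw [hAe, g.symm] at hu
    exact g.pos_of_orthogonal (τ.timelike p) hu (by rwa [ne_eq, chartFrame_eq_zero hp])
  have hGs : ContDiffAt ℝ 1 G (φ p) :=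
    ((contDiffOn_chartMetric p).contDiffAt htarget).of_le (by simp)
  obtain ⟨K, t, ht, hK⟩ := hGs.exists_lipschitzOnWith
  have hor : ∀ᶠ y in 𝓝 (φ p), g.form (φ.symm y) (chartFrame d p (φ.symm y) e)
      (τ.field (φ.symm y)) < 0 := by
    have h1 : ContinuousAt (fun x ↦ g.form x (chartFrame d p x e) (τ.field x)) p :=
      (continuousOn_form_chartFrame τ p e).continuousAt
        ((chartAt (EuclideanSpace ℝ (Fin d)) p).open_source.mem_nhds hp)
    have h2 : g.form p (chartFrame d p p e) (τ.field p) < 0 := by rw [hAe]; exact τ.timelike p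
    exact (h1.tendsto.comp hsymm).eventually (gt_mem_nhds h2)
  obtain ⟨R₀, hR₀, hball⟩ := Metric.mem_nhds_iff.1
    (inter_mem (inter_mem htarget ht) (inter_mem (hsymm hU) hor))
  obtain ⟨R, m, c, hRR, H⟩ := exists_coneBounds (G := G) (p := φ p) (e := e) (K := K) hR₀
    (fun y _ v w ↦ by rw [hG, chartMetric_apply, chartMetric_apply, g.symm])
    (fun y hy y' hy' ↦ by
      have := hK.dist_le_mul y (hball hy).1.2 y' (hball hy').1.2
      rwa [dist_eq_norm, dist_eq_norm] at this) hee hpos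
  have hsub := (ball_subset_ball (x := φ p) hRR).trans hball
  refine ⟨⟨R, H.coneField, H.R_pos, fun y hy ↦ (hsub hy).1.1, fun y hy ↦ (hsub hy).2.1,
    fun y hy v ↦ ?_⟩⟩
  have hx := hsrc y (hsub hy).1.1
  have hor' : g.form (φ.symm y) (chartFrame d p (φ.symm y) e) (τ.field (φ.symm y)) < 0 :=
    (hsub hy).2.2
  have hτ := τ.timelike (φ.symm y)
  have hey : g.form (φ.symm y) (chartFrame d p (φ.symm y) e) (chartFrame d p (φ.symm y) e) < 0 := by
    have := H.c_pos.trans_le (H.timelike y hy)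
    rw [hG, chartMetric_apply] at this
    exact neg_pos.1 this
  have key : ∀ v, v ≠ 0 → (0 ≤ H.coneField.f y v ↔ G y v v ≤ 0 ∧ G y v e < 0) :=
    fun v hv ↦ H.coneFun_nonneg_iff hy hv
  rw [IsFutureCausal, ne_eq, chartFrame_eq_zero hx]
  constructor
  · rintro ⟨hv0, hv, hvτ⟩
    exact ⟨hv0, (key v hv0).2 ⟨hv, g.neg_of_neg hτ hey (by rwa [g.symm]) hv hvτ⟩⟩
  · rintro ⟨hv0, h⟩
    obtain ⟨hv, hve⟩ := (key v hv0).1 h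
    exact ⟨hv0, hv, g.neg_of_neg hey hτ hor' hv hve⟩

namespace ConeChart

variable {τ : TimeOrientation g} {p : M} {U : Set M} (κ : ConeChart τ p U)

/-- The coordinate ball of radius `ρ`. -/
def nhd (_ : ConeChart τ p U) (ρ : ℝ) : Set M :=
  (extChartAt (𝓡 d) p).source ∩ extChartAt (𝓡 d) p ⁻¹' ball (extChartAt (𝓡 d) p p) ρ

lemma isOpen_nhd (ρ : ℝ) : IsOpen (κ.nhd ρ) := isOpen_extChartAt_preimage' p isOpen_ball

lemma nhd_sub {ρ : ℝ} (hρ : ρ ≤ κ.R) : κ.nhd ρ ⊆ U := fun x hx ↦ by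
  have := κ.sub _ (ball_subset_ball hρ hx.2)
  rwa [(extChartAt (𝓡 d) p).left_inv hx.1] at this

lemma symm_mem_nhd {ρ : ℝ} (hρ : ρ ≤ κ.R) {y : EuclideanSpace ℝ (Fin d)}
    (hy : y ∈ ball (extChartAt (𝓡 d) p p) ρ) : (extChartAt (𝓡 d) p).symm y ∈ κ.nhd ρ := by
  have ht := κ.target (ball_subset_ball hρ hy)
  exact ⟨(extChartAt (𝓡 d) p).map_target ht, by
    rw [mem_preimage, (extChartAt (𝓡 d) p).right_inv ht]; exact hy⟩

lemma right_inv {y : EuclideanSpace ℝ (Fin d)} (hy : y ∈ ball (extChartAt (𝓡 d) p p) κ.R) :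
    extChartAt (𝓡 d) p ((extChartAt (𝓡 d) p).symm y) = y :=
  (extChartAt (𝓡 d) p).right_inv (κ.target hy)

/-- A `C¹` causal curve in coordinates. -/
lemma exists_hasDerivWithinAt {γ : ℝ → M} {a b : ℝ} (hγ : IsC1CausalOn τ γ a b) {s : ℝ}
    (hs : s ∈ Icc a b) (hm : γ s ∈ κ.nhd κ.R) :
    ∃ v, HasDerivWithinAt (extChartAt (𝓡 d) p ∘ γ) v (Icc a b) s ∧ v ≠ 0 ∧
      0 ≤ κ.F.f (extChartAt (𝓡 d) p (γ s)) v := by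
  have hx : γ s ∈ (chartAt (EuclideanSpace ℝ (Fin d)) p).source := by simpa using hm.1
  refine ⟨_, hasDerivWithinAt_chart (hγ.mdifferentiableWithinAt hs) hx,
    (κ.causal_iff _ hm.2 _).1 ?_⟩
  suffices H : ∀ x, x = γ s → IsFutureCausal τ (chartFrame d p x
      ((mfderiv (𝓡 d) 𝓘(ℝ, EuclideanSpace ℝ (Fin d)) (extChartAt (𝓡 d) p) (γ s))
        (mfderivWithin 𝓘(ℝ, ℝ) (𝓡 d) γ (Icc a b) s (1 : ℝ)))) from
    H _ ((extChartAt (𝓡 d) p).left_inv hm.1)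
  rintro _ rfl
  rw [chartFrame_mfderiv hx]
  exact hγ.2 s hs

/-- Curves with causal velocity in coordinates are causal. -/
lemma isC1CausalOn_symm {y y' : ℝ → EuclideanSpace ℝ (Fin d)} {a b : ℝ} (hab : a < b)
    (hd : ∀ s ∈ Icc a b, HasDerivWithinAt y (y' s) (Icc a b) s) (hc : ContinuousOn y' (Icc a b))
    (hy : ∀ s ∈ Icc a b, y s ∈ ball (extChartAt (𝓡 d) p p) κ.R ∧ y' s ≠ 0 ∧
      0 ≤ κ.F.f (y s) (y' s)) :
    IsC1CausalOn τ ((extChartAt (𝓡 d) p).symm ∘ y) a b := by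
  have hu := uniqueDiffOn_Icc hab
  refine ⟨?_, fun s hs ↦ ?_⟩
  · have h1 : ContDiffOn ℝ 1 y (Icc a b) := by
      rw [show (1 : WithTop ℕ∞) = 0 + 1 from (zero_add _).symm, contDiffOn_succ_iff_derivWithin hu]
      refine ⟨fun s hs ↦ (hd s hs).differentiableWithinAt, by simp, ?_⟩
      rw [contDiffOn_zero]
      exact hc.congr fun s hs ↦ (hd s hs).derivWithin (hu s hs)
    exact ((contMDiffOn_extChartAt_symm (n := ∞) p).of_le (by simp)).comp
      (contMDiffOn_iff_contDiffOn.2 h1) fun s hs ↦ κ.target (hy s hs).1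
  · rw [mfderivWithin_chart_symm (hu s hs) (hd s hs) (κ.target (hy s hs).1)]
    exact (κ.causal_iff _ (hy s hs).1 _).2 (hy s hs).2

lemma increasing {T : M → ℝ} (hT : IsTimeFunction τ T) :
    κ.F.Increasing (T ∘ (extChartAt (𝓡 d) p).symm) := by
  intro y y' a b hab hd hc hy
  exact hT.strictMonoOn _ _ (κ.isC1CausalOn_symm hab hd hc hy).isCausalCurveOn
    ⟨le_rfl, hab.le⟩ ⟨hab.le, le_rfl⟩ hab

/-- Functions of the coordinates that increase along the cones increase along causal curves. -/
lemma strictMonoOn_of_fderiv_pos {ρ : ℝ} (hρ : ρ ≤ κ.R) {h : EuclideanSpace ℝ (Fin d) → ℝ}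
    (hd : Differentiable ℝ h) (hpos : ∀ q ∈ ball (extChartAt (𝓡 d) p p) ρ, ∀ v, v ≠ 0 →
      0 ≤ κ.F.f q v → 0 < fderiv ℝ h q v) {γ : ℝ → M} {I : Set ℝ} (hγ : IsCausalCurveOn τ γ I)
    (hm : ∀ t ∈ I, γ t ∈ κ.nhd ρ) : StrictMonoOn (h ∘ extChartAt (𝓡 d) p ∘ γ) I := by
  have C1 : ∀ a b, IsC1CausalOn τ γ a b → (∀ t ∈ Icc a b, γ t ∈ κ.nhd ρ) →
      StrictMonoOn (h ∘ extChartAt (𝓡 d) p ∘ γ) (Icc a b) := by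
    intro a b hab hm
    have hder : ∀ s ∈ Icc a b, ∃ x, 0 < x ∧
        HasDerivWithinAt (h ∘ extChartAt (𝓡 d) p ∘ γ) x (Icc a b) s := by
      intro s hs
      obtain ⟨v, hv, hv0, hvf⟩ := κ.exists_hasDerivWithinAt hab hs
        ⟨(hm s hs).1, ball_subset_ball hρ (hm s hs).2⟩
      exact ⟨_, hpos _ (hm s hs).2 v hv0 hvf,
        (hd _).hasFDerivAt.comp_hasDerivWithinAt s hv⟩
    choose! x hx hx' using hder
    refine strictMonoOn_of_deriv_pos (convex_Icc a b)
      (fun s hs ↦ (hx' s hs).continuousWithinAt) fun s hs ↦ ?_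
    rw [interior_Icc] at hs
    rw [((hx' s (Ioo_subset_Icc_self hs)).hasDerivAt (Icc_mem_nhds hs.1 hs.2)).deriv]
    exact hx s (Ioo_subset_Icc_self hs)
  refine strictMonoOn_of_local hγ.ordConnected (fun t ht u hu htu ↦ ?_) fun t ht u hu htu ↦ ?_
  · obtain ⟨b, hb, h'⟩ := hγ.right t ht u hu htu
    refine ⟨b, hb, fun s hs ↦ C1 t b h' (fun x hx ↦ hm x ?_) ⟨le_rfl, hb.1.le⟩
      ⟨hs.1.le, hs.2⟩ hs.1⟩
    exact hγ.ordConnected.out ht hu ⟨hx.1, hx.2.trans hb.2⟩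
  · obtain ⟨b, hb, h'⟩ := hγ.left t ht u hu htu
    refine ⟨b, hb, fun s hs ↦ C1 b t h' (fun x hx ↦ hm x ?_) ⟨hs.1, hs.2.le⟩
      ⟨hb.2.le, le_rfl⟩ hs.2⟩
    exact hγ.ordConnected.out hu ht ⟨hb.1.trans hx.1, hx.2⟩

end ConeChart

end Spacetime

/-! ### The cutoff, and the escape of causal curves from coordinate balls -/

namespace Spacetime

open Filter Metric

/-- A smooth step divided by a number exceeding the bound of its derivative has slope at most 1. The
two monotonicities together make `T - θ (T - h)` increase when `T` and `h` do. -/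
lemma exists_cutoff {δ : ℝ} :
    ∃ θ : ℝ → ℝ, ContDiff ℝ ∞ θ ∧ (∀ x ≤ -δ, θ x = 0) ∧ (∀ x, -δ < x → 0 < θ x) ∧
      Monotone θ ∧ Monotone fun x ↦ x - θ x := by
  have hs : ContDiff ℝ ∞ Real.smoothTransition := Real.smoothTransition.contDiff
  have hd : Continuous (deriv Real.smoothTransition) := hs.continuous_deriv (by simp)
  obtain ⟨C, hC⟩ := (isCompact_Icc (a := (0 : ℝ)) (b := 1)).exists_bound_of_continuousOn
    hd.continuousOn
  have hC0 : 0 ≤ C := (norm_nonneg _).trans (hC 0 ⟨le_rfl, zero_le_one⟩)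
  have bound : ∀ x, deriv Real.smoothTransition x ≤ C := by
    intro x
    rcases lt_or_ge x 0 with h | h
    · have : Real.smoothTransition =ᶠ[𝓝 x] fun _ ↦ 0 := by
        filter_upwards [Iio_mem_nhds h] with y hy
        exact Real.smoothTransition.zero_of_nonpos (le_of_lt hy)
      rw [this.deriv_eq, deriv_const]; exact hC0
    rcases lt_or_ge 1 x with h1 | h1
    · have : Real.smoothTransition =ᶠ[𝓝 x] fun _ ↦ 1 := by
        filter_upwards [Ioi_mem_nhds h1] with y hy
        exact Real.smoothTransition.one_of_one_le (le_of_lt hy)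
      rw [this.deriv_eq, deriv_const]; exact hC0
    · exact (le_abs_self _).trans (hC x ⟨h, h1⟩)
  set c := (C + 1)⁻¹ with hc
  have hc0 : 0 < c := by positivity
  have hθ : ContDiff ℝ ∞ fun x ↦ c * Real.smoothTransition (x + δ) :=
    contDiff_const.mul (hs.comp (contDiff_id.add contDiff_const))
  refine ⟨fun x ↦ c * Real.smoothTransition (x + δ), hθ, fun x hx ↦ ?_, fun x hx ↦ ?_, ?_, ?_⟩
  · beta_reduce
    rw [Real.smoothTransition.zero_of_nonpos (by linarith), mul_zero]
  · exact mul_pos hc0 (Real.smoothTransition.pos_of_pos (by linarith))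
  · exact fun x y hxy ↦ mul_le_mul_of_nonneg_left
      (Real.smoothTransition.monotone (by linarith)) hc0.le
  · have hd' : ∀ x, HasDerivAt (fun x ↦ x - c * Real.smoothTransition (x + δ))
        (1 - c * deriv Real.smoothTransition (x + δ)) x := fun x ↦
      (hasDerivAt_id x).sub ((((hs.differentiable (by simp)) (x + δ)).hasDerivAt.comp_add_const
        x δ).const_mul c)
    refine monotone_of_deriv_nonneg (fun x ↦ (hd' x).differentiableAt) fun x ↦ ?_
    rw [(hd' x).deriv, sub_nonneg]
    calc c * deriv Real.smoothTransition (x + δ) ≤ c * (C + 1) := by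
          gcongr; linarith [bound (x + δ)]
      _ = 1 := inv_mul_cancel₀ (by positivity)

/-- A curve in a compact set whose variation is controlled by a bounded monotone function has a
limit. -/
lemma exists_limit_of_norm_sub_le {E : Type*} [NormedAddCommGroup E] {K : Set E}
    (hK : IsCompact K) {y : ℝ → E} {m : ℝ → ℝ} {J : Set ℝ} (hJ : J.Nonempty)
    (hy : ∀ t ∈ J, y t ∈ K) (hm : BddAbove (m '' J))
    (h : ∀ t ∈ J, ∀ t' ∈ J, t ≤ t' → ‖y t' - y t‖ ≤ m t' - m t) :
    ∃ z ∈ K, ∀ V ∈ 𝓝 z, ∃ t₁ ∈ J, ∀ t ∈ J, t₁ ≤ t → y t ∈ V := by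
  set σ := sSup (m '' J) with hσ
  have hex : ∀ n : ℕ, ∃ t ∈ J, σ - 1 / (n + 1 : ℝ) < m t := by
    intro n
    have hn : σ - 1 / (n + 1 : ℝ) < σ := sub_lt_self _ (by positivity)
    obtain ⟨_, ⟨t, ht, rfl⟩, h'⟩ := exists_lt_of_lt_csSup (hJ.image m) hn
    exact ⟨t, ht, h'⟩
  choose t ht hmt using hex
  obtain ⟨z, hz, ψ, hψ, hlim⟩ := hK.tendsto_subseq fun n ↦ hy (t n) (ht n)
  refine ⟨z, hz, fun V hV ↦ ?_⟩
  obtain ⟨ε, hε, hV⟩ := Metric.mem_nhds_iff.1 hV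
  have h1 : ∀ᶠ n in atTop, y (t (ψ n)) ∈ ball z (ε / 2) :=
    hlim.eventually (ball_mem_nhds z (half_pos hε))
  have h2 : ∀ᶠ n : ℕ in atTop, (1 : ℝ) / (ψ n + 1 : ℝ) < ε / 2 :=
    (tendsto_one_div_add_atTop_nhds_zero_nat.comp hψ.tendsto_atTop).eventually
      (gt_mem_nhds (half_pos hε))
  obtain ⟨n, hn1, hn2⟩ := (h1.and h2).exists
  refine ⟨t (ψ n), ht _, fun s hs hts ↦ hV ?_⟩
  have h3 := h _ (ht (ψ n)) s hs hts
  have h4 : m s ≤ σ := le_csSup hm (mem_image_of_mem m hs)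
  have h5 := hmt (ψ n)
  rw [mem_ball_iff_norm] at hn1 ⊢
  calc ‖y s - z‖ = ‖(y s - y (t (ψ n))) + (y (t (ψ n)) - z)‖ := by congr 1; abel
    _ ≤ ‖y s - y (t (ψ n))‖ + ‖y (t (ψ n)) - z‖ := norm_add_le _ _
    _ < ε := by linarith

variable {d : ℕ} {M : Type*} [TopologicalSpace M] [ChartedSpace (EuclideanSpace ℝ (Fin d)) M]
  [IsManifold (𝓡 d) ∞ M] {g : LorentzianMetric d M} {τ : TimeOrientation g}

lemma IsCausalCurveOn.mono {γ : ℝ → M} {I J : Set ℝ} (h : IsCausalCurveOn τ γ I)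
    (hJ : J.OrdConnected) (hJI : J ⊆ I) : IsCausalCurveOn τ γ J where
  ordConnected := hJ
  right t ht u hu htu := h.right t (hJI ht) u (hJI hu) htu
  left t ht u hu htu := h.left t (hJI ht) u (hJI hu) htu

namespace ConeChart

variable {p : M} {U : Set M} (κ : ConeChart τ p U)

/-- Let `ξ` be a functional of norm at most 1 attaining the norm of the chord. On the cones `(C + 1)
* l - ξ` is positive, so it increases along the curve; the extra 1 makes this strict. -/
lemma norm_coord_sub_le {γ : ℝ → M} {I : Set ℝ} (hγ : IsCausalCurveOn τ γ I)
    (hm : ∀ t ∈ I, γ t ∈ κ.nhd κ.R) {t t' : ℝ} (ht : t ∈ I) (ht' : t' ∈ I) (h : t ≤ t') :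
    ‖extChartAt (𝓡 d) p (γ t') - extChartAt (𝓡 d) p (γ t)‖ ≤
      (κ.F.C + 1) * κ.F.l (extChartAt (𝓡 d) p (γ t')) -
        (κ.F.C + 1) * κ.F.l (extChartAt (𝓡 d) p (γ t)) := by
  obtain ⟨ξ, hξ, hξw⟩ := exists_dual_vector'' ℝ
    (extChartAt (𝓡 d) p (γ t') - extChartAt (𝓡 d) p (γ t))
  have hmono := κ.strictMonoOn_of_fderiv_pos le_rfl (h := ⇑((κ.F.C + 1) • κ.F.l - ξ))
    (ContinuousLinearMap.differentiable _) (fun q hq v hv0 hv ↦ ?_) hγ hm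
  · have h1 := hmono.monotoneOn ht ht' h
    simp only [Function.comp_apply, FunLike.coe_sub, FunLike.coe_smul, Pi.sub_apply,
      Pi.smul_apply, smul_eq_mul] at h1
    rw [map_sub] at hξw
    simp only [RCLike.ofReal_real_eq_id, id_eq] at hξw
    linarith
  · rw [ContinuousLinearMap.fderiv]
    simp only [FunLike.coe_sub, FunLike.coe_smul, Pi.sub_apply, Pi.smul_apply, smul_eq_mul]
    have h1 := κ.F.norm_le hq hv
    have h2 : ξ v ≤ 1 * ‖v‖ := (le_abs_self _).trans (ξ.le_of_opNorm_le hξ v)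
    have h3 : 0 < κ.F.l v := pos_of_mul_pos_right ((norm_pos_iff.2 hv0).trans_le h1) κ.F.C_pos.le
    linarith

/-- The compact coordinate ball of radius `ρ`. -/
def cball (_ : ConeChart τ p U) (ρ : ℝ) : Set M :=
  (extChartAt (𝓡 d) p).symm '' closedBall (extChartAt (𝓡 d) p p) ρ

variable {κ} {ρ : ℝ}

lemma mem_cball_iff {ρ' : ℝ} (hρ : ρ < ρ') (hρ' : ρ' ≤ κ.R) {x : M} :
    x ∈ κ.cball ρ ↔ x ∈ κ.nhd ρ' ∧ ‖extChartAt (𝓡 d) p x - extChartAt (𝓡 d) p p‖ ≤ ρ := by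
  constructor
  · rintro ⟨y, hy, rfl⟩
    have hy' := closedBall_subset_ball hρ hy
    refine ⟨κ.symm_mem_nhd hρ' hy', ?_⟩
    rw [κ.right_inv (ball_subset_ball hρ' hy')]
    exact mem_closedBall_iff_norm.1 hy
  · rintro ⟨hx, hn⟩
    exact ⟨_, mem_closedBall_iff_norm.2 hn, (extChartAt (𝓡 d) p).left_inv hx.1⟩

lemma isCompact_cball (hρ : ρ < κ.R) : IsCompact (κ.cball ρ) :=
  (isCompact_closedBall _ _).image_of_continuousOn
    ((continuousOn_extChartAt_symm p).mono ((closedBall_subset_ball hρ).trans κ.target))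

/-- In a compact ball the clock is bounded, and it controls the variation of the curve, which would
therefore converge to a future end point. -/
lemma not_forall_ge_mem_cball (hρ : ρ < κ.R) {γ : ℝ → M} {I : Set ℝ}
    (hγ : IsInextendibleCausalCurve τ γ I) {t₀ : ℝ} (ht₀ : t₀ ∈ I) :
    ∃ t ∈ I, t₀ ≤ t ∧ γ t ∉ κ.cball ρ := by
  by_contra! H
  have hJ : IsCausalCurveOn τ γ (I ∩ Ici t₀) :=
    hγ.1.mono (hγ.1.ordConnected.inter ordConnected_Ici) inter_subset_left
  have hm : ∀ t ∈ I ∩ Ici t₀, γ t ∈ κ.nhd κ.R := fun t ht ↦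
    ((mem_cball_iff hρ le_rfl).1 (H t ht.1 ht.2)).1
  have hy : ∀ t ∈ I ∩ Ici t₀, extChartAt (𝓡 d) p (γ t) ∈
      closedBall (extChartAt (𝓡 d) p p) ρ := fun t ht ↦
    mem_closedBall_iff_norm.2 ((mem_cball_iff hρ le_rfl).1 (H t ht.1 ht.2)).2
  have hK := isCompact_closedBall (extChartAt (𝓡 d) p p) ρ
  have hbdd : BddAbove ((fun t ↦ (κ.F.C + 1) * κ.F.l (extChartAt (𝓡 d) p (γ t))) ''
      (I ∩ Ici t₀)) := by
    have h1 : Continuous fun y ↦ (κ.F.C + 1) * κ.F.l y := by fun_prop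
    refine (hK.bddAbove_image h1.continuousOn).mono ?_
    rintro _ ⟨t, ht, rfl⟩
    exact ⟨_, hy t ht, rfl⟩
  obtain ⟨z, hz, hlim⟩ := exists_limit_of_norm_sub_le hK (J := I ∩ Ici t₀)
    (y := fun t ↦ extChartAt (𝓡 d) p (γ t)) ⟨t₀, ht₀, self_mem_Ici⟩ hy hbdd
    fun t ht t' ht' h ↦ κ.norm_coord_sub_le hJ hm ht ht' h
  have hzt := κ.target (closedBall_subset_ball hρ hz)
  refine (hγ.2 ((extChartAt (𝓡 d) p).symm z)).1 fun V hV ↦ ?_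
  obtain ⟨t₁, ht₁, h⟩ := hlim _ ((continuousAt_extChartAt_symm'' hzt).preimage_mem_nhds hV)
  refine ⟨t₁, ht₁.1, fun t ht htt ↦ ?_⟩
  have hmem : t ∈ I ∩ Ici t₀ := ⟨ht, le_trans ht₁.2 htt⟩
  have := h t hmem htt
  rwa [mem_preimage, (extChartAt (𝓡 d) p).left_inv (hm t hmem).1] at this

lemma not_forall_le_mem_cball (hρ : ρ < κ.R) {γ : ℝ → M} {I : Set ℝ}
    (hγ : IsInextendibleCausalCurve τ γ I) {t₀ : ℝ} (ht₀ : t₀ ∈ I) :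
    ∃ t ∈ I, t ≤ t₀ ∧ γ t ∉ κ.cball ρ := by
  by_contra! H
  have hJ : IsCausalCurveOn τ γ (I ∩ Iic t₀) :=
    hγ.1.mono (hγ.1.ordConnected.inter ordConnected_Iic) inter_subset_left
  have hm : ∀ t ∈ I ∩ Iic t₀, γ t ∈ κ.nhd κ.R := fun t ht ↦
    ((mem_cball_iff hρ le_rfl).1 (H t ht.1 ht.2)).1
  have hy : ∀ t ∈ I ∩ Iic t₀, extChartAt (𝓡 d) p (γ t) ∈
      closedBall (extChartAt (𝓡 d) p p) ρ := fun t ht ↦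
    mem_closedBall_iff_norm.2 ((mem_cball_iff hρ le_rfl).1 (H t ht.1 ht.2)).2
  have hK := isCompact_closedBall (extChartAt (𝓡 d) p p) ρ
  have hbdd : BddAbove ((fun t ↦ -((κ.F.C + 1) * κ.F.l (extChartAt (𝓡 d) p (γ (-t))))) ''
      {t | -t ∈ I ∩ Iic t₀}) := by
    have h1 : Continuous fun y ↦ -((κ.F.C + 1) * κ.F.l y) := by fun_prop
    refine (hK.bddAbove_image h1.continuousOn).mono ?_
    rintro _ ⟨t, ht, rfl⟩
    exact ⟨_, hy (-t) ht, rfl⟩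
  obtain ⟨z, hz, hlim⟩ := exists_limit_of_norm_sub_le hK (J := {t | -t ∈ I ∩ Iic t₀})
    (y := fun t ↦ extChartAt (𝓡 d) p (γ (-t)))
    ⟨-t₀, by simpa using ht₀⟩ (fun t ht ↦ hy (-t) ht) hbdd
    fun t ht t' ht' h ↦ by
      have := κ.norm_coord_sub_le hJ hm ht' ht (neg_le_neg h)
      rw [norm_sub_rev]
      linarith
  have hzt := κ.target (closedBall_subset_ball hρ hz)
  refine (hγ.2 ((extChartAt (𝓡 d) p).symm z)).2 fun V hV ↦ ?_
  obtain ⟨t₁, ht₁, h⟩ := hlim _ ((continuousAt_extChartAt_symm'' hzt).preimage_mem_nhds hV)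
  refine ⟨-t₁, ht₁.1, fun t ht htt ↦ ?_⟩
  have hmem : t ∈ I ∩ Iic t₀ := ⟨ht, le_trans htt ht₁.2⟩
  have := h (-t) (by simpa using hmem) (by linarith)
  rwa [mem_preimage, neg_neg, (extChartAt (𝓡 d) p).left_inv (hm t hmem).1] at this

/-- The vertical curve through a point of a compact coordinate ball leaves that ball to the future
and to the past. -/
lemma exists_vertical {ρ' : ℝ} (hρ0 : 0 ≤ ρ) (hρ : ρ < ρ') (hρ' : ρ' < κ.R) {q : M}
    (hq : q ∈ κ.cball ρ) :
    ∃ (γ : ℝ → M) (a b : ℝ), a < 0 ∧ 0 < b ∧ IsC1CausalOn τ γ a b ∧ γ 0 = q ∧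
      γ a ∉ κ.cball ρ ∧ γ b ∉ κ.cball ρ := by
  obtain ⟨y, hy, rfl⟩ := hq
  rw [mem_closedBall_iff_norm] at hy
  set o := extChartAt (𝓡 d) p p with ho
  have heR : ∀ z ∈ ball o κ.R, 0 < κ.F.f z κ.F.e := fun z hz ↦
    κ.F.κ_pos.trans_le (κ.F.interior z hz)
  have he0 : κ.F.e ≠ 0 := by
    intro h
    have h1 := heR o (mem_ball_self κ.R_pos)
    rw [h, κ.F.zero (mem_ball_self κ.R_pos)] at h1
    exact lt_irrefl _ h1
  have exit : ∀ v : EuclideanSpace ℝ (Fin d), v ≠ 0 →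
      ∃ s : ℝ, 0 < s ∧ ‖y + s • v - o‖ = ρ' := by
    intro v hv
    have hn := norm_pos_iff.2 hv
    have hc : Continuous fun s : ℝ ↦ ‖y + s • v - o‖ := by fun_prop
    -- From a point within `ρ` of the centre, a displacement of length `ρ + ρ'` ends at distance at
    -- least `ρ'`.
    have hS : 0 ≤ (ρ + ρ') / ‖v‖ := div_nonneg (by linarith) hn.le
    have h1 : ρ' ≤ ‖y + ((ρ + ρ') / ‖v‖) • v - o‖ := by
      have h2 : ‖((ρ + ρ') / ‖v‖) • v‖ = ρ + ρ' := by
        rw [norm_smul, Real.norm_of_nonneg hS, div_mul_cancel₀ _ hn.ne']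
      have h3 := norm_sub_le (y + ((ρ + ρ') / ‖v‖) • v - o) (y - o)
      rw [show y + ((ρ + ρ') / ‖v‖) • v - o - (y - o) = ((ρ + ρ') / ‖v‖) • v by abel, h2] at h3
      linarith
    obtain ⟨s, hs, hs'⟩ := intermediate_value_Icc hS hc.continuousOn
      (show ρ' ∈ Icc _ _ from ⟨by simpa using hy.trans hρ.le, h1⟩)
    refine ⟨s, lt_of_le_of_ne hs.1 fun h ↦ ?_, hs'⟩
    rw [← h] at hs'
    simp only [zero_smul, add_zero] at hs'
    linarith
  obtain ⟨b, hb, hb'⟩ := exit κ.F.e he0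
  obtain ⟨a, ha, ha'⟩ := exit (-κ.F.e) (neg_ne_zero.2 he0)
  have ha' : ‖y + (-a) • κ.F.e - o‖ = ρ' := by rwa [neg_smul, ← smul_neg]
  have hin : ∀ s ∈ Icc (-a) b, y + s • κ.F.e ∈ ball o κ.R := by
    intro s hs
    refine closedBall_subset_ball hρ' ?_
    have hconv : Convex ℝ ((fun s : ℝ ↦ y + s • κ.F.e) ⁻¹' closedBall o ρ') :=
      (convex_closedBall o ρ').affine_preimage
        (AffineMap.const ℝ ℝ y + (LinearMap.toSpanSingleton ℝ _ κ.F.e).toAffineMap)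
    exact hconv.ordConnected.out (mem_closedBall_iff_norm.2 ha'.le)
      (mem_closedBall_iff_norm.2 hb'.le) hs
  have hout : ∀ s ∈ Icc (-a) b, ‖y + s • κ.F.e - o‖ = ρ' →
      (extChartAt (𝓡 d) p).symm (y + s • κ.F.e) ∉ κ.cball ρ := by
    intro s hs h h'
    have h1 := ((mem_cball_iff (hρ.trans hρ') le_rfl).1 h').2
    rw [κ.right_inv (hin s hs), h] at h1
    linarith
  refine ⟨(extChartAt (𝓡 d) p).symm ∘ fun s ↦ y + s • κ.F.e, -a, b, neg_lt_zero.2 ha, hb,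
    κ.isC1CausalOn_symm (y' := fun _ ↦ κ.F.e) (by linarith) (fun s _ ↦ by
      simpa using (((hasDerivAt_id s).smul_const κ.F.e).const_add y).hasDerivWithinAt)
      continuousOn_const fun s hs ↦ ⟨hin s hs, he0, (heR _ (hin s hs)).le⟩, by simp,
    hout _ ⟨le_rfl, by linarith⟩ ha', hout _ ⟨by linarith, le_rfl⟩ hb'⟩

end ConeChart

end Spacetime

/-! ### Local deformation of a time function -/

namespace Spacetime

open Filter Metric

variable {d : ℕ} {M : Type*} [TopologicalSpace M] [ChartedSpace (EuclideanSpace ℝ (Fin d)) M]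
  [IsManifold (𝓡 d) ∞ M] {g : LorentzianMetric d M} {τ : TimeOrientation g}

/-- A function `h` on a coordinate ball that increases along the cones, is negative at the centre
and is greater than `T₀` in a spherical layer, together with a cutoff function `θ`. -/
structure LocalTime (τ : TimeOrientation g) (T₀ : M → ℝ) (p : M) (U : Set M)
    extends ConeChart τ p U where
  /-- the function, in coordinates -/
  h : EuclideanSpace ℝ (Fin d) → ℝ
  /-- the least excess of `h` over `T₀` in the layer -/
  δ : ℝ
  /-- the inner radius of the layer -/
  ρ : ℝ
  /-- the outer radius of the layer -/
  ρ' : ℝ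
  /-- the cutoff function -/
  θ : ℝ → ℝ
  δ_pos : 0 < δ
  ρ_nonneg : 0 ≤ ρ
  ρ_lt : ρ < ρ'
  ρ'_lt : ρ' < R
  contDiff_h : ContDiff ℝ ∞ h
  h_neg : h (extChartAt (𝓡 d) p p) < 0
  fderiv_h_pos : ∀ q ∈ ball (extChartAt (𝓡 d) p p) ρ', ∀ v, v ≠ 0 → 0 ≤ F.f q v →
    0 < fderiv ℝ h q v
  add_le_h : ∀ q ∈ ball (extChartAt (𝓡 d) p p) ρ', ρ ≤ ‖q - extChartAt (𝓡 d) p p‖ →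
    T₀ ((extChartAt (𝓡 d) p).symm q) + δ ≤ h q
  contDiff_θ : ContDiff ℝ ∞ θ
  θ_zero : ∀ x ≤ -δ, θ x = 0
  θ_pos : ∀ x, -δ < x → 0 < θ x
  θ_mono : Monotone θ
  sub_θ_mono : Monotone fun x ↦ x - θ x

/-- A `C¹` function is Lipschitz near `p`; this is the only regularity of `T₀` that the construction
of `h` uses. The layer radii are those of `exists_local_time` with `r = R / 2`. -/
theorem exists_localTime {T₀ : M → ℝ} (hT : IsTimeFunction τ T₀) {p : M} (hp : T₀ p = 0)
    {U : Set M} (hU : U ∈ 𝓝 p) : Nonempty (LocalTime τ T₀ p U) := by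
  set φ := extChartAt (𝓡 d) p with hφ
  have hs : ContDiffAt ℝ 1 (T₀ ∘ φ.symm) (φ p) := by
    rw [← contMDiffAt_iff_contDiffAt]
    have h1 : ContMDiffAt 𝓘(ℝ, EuclideanSpace ℝ (Fin d)) (𝓡 d) 1 φ.symm (φ p) :=
      ((contMDiffOn_extChartAt_symm (n := ∞) p).of_le (by simp)).contMDiffAt
        (extChartAt_target_mem_nhds p)
    exact hT.contMDiff.contMDiffAt.comp _ h1
  obtain ⟨L, t, ht, hL⟩ := hs.exists_lipschitzOnWith
  have hU' : U ∩ (φ.source ∩ φ ⁻¹' t) ∈ 𝓝 p :=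
    inter_mem hU (inter_mem (extChartAt_source_mem_nhds p)
      ((continuousAt_extChartAt p).preimage_mem_nhds ht))
  obtain ⟨κ⟩ := exists_coneChart τ p hU'
  have hL' : ∀ x ∈ ball (φ p) κ.R, ∀ y ∈ ball (φ p) κ.R,
      |(T₀ ∘ φ.symm) x - (T₀ ∘ φ.symm) y| ≤ L * ‖x - y‖ := by
    have hsub : ∀ x ∈ ball (φ p) κ.R, x ∈ t := fun x hx ↦ by
      have := (κ.sub x hx).2.2
      rwa [mem_preimage, κ.right_inv hx] at this
    intro x hx y hy
    have := hL.dist_le_mul x (hsub x hx) y (hsub y hy)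
    rwa [dist_eq_norm, dist_eq_norm, Real.norm_eq_abs] at this
  have hR := κ.R_pos
  obtain ⟨h, δ, hδ, hh, hneg, hpos, hle⟩ := ConeField.exists_local_time (r := κ.R / 2)
    (by linarith) (by linarith) (κ.increasing hT) hL' (by simp [hp])
  obtain ⟨θ, h1, h2, h3, h4, h5⟩ := exists_cutoff (δ := δ)
  exact ⟨{ R := κ.R, F := κ.F, R_pos := κ.R_pos, target := κ.target,
           sub := fun y hy ↦ (κ.sub y hy).1, causal_iff := κ.causal_iff, h := h, δ := δ,
           ρ := 5 * (κ.R / 2) / 8, ρ' := 7 * (κ.R / 2) / 8, θ := θ, δ_pos := hδ,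
           ρ_nonneg := by linarith, ρ_lt := by linarith, ρ'_lt := by linarith,
           contDiff_h := hh, h_neg := hneg, fderiv_h_pos := hpos, add_le_h := hle,
           contDiff_θ := h1, θ_zero := h2, θ_pos := h3, θ_mono := h4, sub_θ_mono := h5 }⟩

namespace LocalTime

variable {T₀ T : M → ℝ} {p : M} {U : Set M} (B : LocalTime τ T₀ p U)

/-- The coordinate ball on which a time function is deformed. -/
def dom : Set M := B.nhd B.ρ'

/-- The compact set outside which a time function is unchanged. -/
def core : Set M := B.cball B.ρ

/-- The deformation of a time function by a local time. -/
noncomputable def deform (T : M → ℝ) (x : M) : ℝ :=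
  open Classical in
  if x ∈ B.dom then T x - B.θ (T x - B.h (extChartAt (𝓡 d) p x)) else T x

lemma isOpen_dom : IsOpen B.dom := B.isOpen_nhd _

lemma core_sub_dom : B.core ⊆ B.dom := fun _ hx ↦
  ((ConeChart.mem_cball_iff B.ρ_lt B.ρ'_lt.le).1 hx).1

lemma core_sub : B.core ⊆ U := B.core_sub_dom.trans (B.nhd_sub B.ρ'_lt.le)

lemma ρ_lt_R : B.ρ < B.R := B.ρ_lt.trans B.ρ'_lt

lemma isClosed_core [T2Space M] : IsClosed B.core :=
  (ConeChart.isCompact_cball B.ρ_lt_R).isClosed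

lemma θ_nonneg (x : ℝ) : 0 ≤ B.θ x := by
  rcases le_or_gt x (-B.δ) with h | h
  · rw [B.θ_zero x h]
  · exact (B.θ_pos x h).le

lemma deform_of_mem {x : M} (hx : x ∈ B.dom) :
    B.deform T x = T x - B.θ (T x - B.h (extChartAt (𝓡 d) p x)) := if_pos hx

lemma deform_le (x : M) : B.deform T x ≤ T x := by
  by_cases hx : x ∈ B.dom
  · rw [B.deform_of_mem hx]; linarith [B.θ_nonneg (T x - B.h (extChartAt (𝓡 d) p x))]
  · exact (if_neg hx).le

/-- In the layer `T - h ≤ T₀ - h ≤ -δ`, where `θ` vanishes. The layer belongs to `T₀`, so `T ≤ T₀`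
is what lets the same `h` deform an already deformed function. -/
lemma deform_of_notMem_core (hT : ∀ x, T x ≤ T₀ x) {x : M} (hx : x ∉ B.core) :
    B.deform T x = T x := by
  by_cases hx' : x ∈ B.dom
  · rw [B.deform_of_mem hx', B.θ_zero, sub_zero]
    have h1 : ¬ ‖extChartAt (𝓡 d) p x - extChartAt (𝓡 d) p p‖ ≤ B.ρ := fun h ↦
      hx ((ConeChart.mem_cball_iff B.ρ_lt B.ρ'_lt.le).2 ⟨hx', h⟩)
    have h2 := B.add_le_h _ hx'.2 (not_le.1 h1).le
    rw [(extChartAt (𝓡 d) p).left_inv hx'.1] at h2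
    linarith [hT x]
  · exact if_neg hx'

lemma deform_eqOn (hT : ∀ x, T x ≤ T₀ x) : EqOn (B.deform T) T B.coreᶜ :=
  fun _ hx ↦ B.deform_of_notMem_core hT hx

lemma contMDiff_deform [T2Space M] (hT : ∀ x, T x ≤ T₀ x) {k : ℕ∞}
    (hk : ContMDiff (𝓡 d) 𝓘(ℝ, ℝ) k T) : ContMDiff (𝓡 d) 𝓘(ℝ, ℝ) k (B.deform T) := by
  intro x
  by_cases hx : x ∈ B.core
  · have hx' := B.core_sub_dom hx
    have h1 : ContMDiffAt (𝓡 d) 𝓘(ℝ, EuclideanSpace ℝ (Fin d)) k (extChartAt (𝓡 d) p) x :=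
      (contMDiffAt_extChartAt' (n := ∞) (by simpa using hx'.1)).of_le (by exact_mod_cast le_top)
    have h2 : ContMDiffAt (𝓡 d) 𝓘(ℝ, ℝ) k (fun x ↦ B.h (extChartAt (𝓡 d) p x)) x :=
      ((B.contDiff_h.of_le (by exact_mod_cast le_top)).contMDiff.contMDiffAt).comp x h1
    have h3 : ContMDiffAt (𝓡 d) 𝓘(ℝ, ℝ) k
        (fun x ↦ T x - B.θ (T x - B.h (extChartAt (𝓡 d) p x))) x :=
      (hk x).sub (((B.contDiff_θ.of_le (by exact_mod_cast le_top)).contMDiff.contMDiffAt).comp x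
        ((hk x).sub h2))
    refine h3.congr_of_eventuallyEq ?_
    filter_upwards [B.isOpen_dom.mem_nhds hx'] with z hz
    exact B.deform_of_mem hz
  · refine (hk x).congr_of_eventuallyEq ?_
    filter_upwards [B.isClosed_core.isOpen_compl.mem_nhds hx] with z hz
    exact B.deform_eqOn hT hz

/-- If `T - h` does not increase, neither does `θ`, while `T` grows. Otherwise write the deformation
as `h` plus the nondecreasing `x - θ x` at `x = T - h`. -/
lemma deform_lt {x y : M} (hx : x ∈ B.dom) (hy : y ∈ B.dom) (hT : T x < T y)
    (hh : B.h (extChartAt (𝓡 d) p x) < B.h (extChartAt (𝓡 d) p y)) :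
    B.deform T x < B.deform T y := by
  rw [B.deform_of_mem hx, B.deform_of_mem hy]
  rcases le_total (T y - B.h (extChartAt (𝓡 d) p y)) (T x - B.h (extChartAt (𝓡 d) p x)) with h | h
  · linarith [B.θ_mono h]
  · have := B.sub_θ_mono h
    simp only at this
    linarith

/-- Strict increase is local along a curve. Every point has a neighbourhood inside `dom`, where
`deform_lt` applies, or off the closed `core`, where nothing changes. -/
lemma isTimeFunction_deform [T2Space M] (hT : ∀ x, T x ≤ T₀ x) (hτ : IsTimeFunction τ T) :
    IsTimeFunction τ (B.deform T) where
  contMDiff := B.contMDiff_deform hT hτ.contMDiff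
  strictMonoOn γ I hγ := by
    have inDom : ∀ J, IsCausalCurveOn τ γ J → MapsTo γ J B.dom →
        StrictMonoOn (B.deform T ∘ γ) J := fun J hJ hm x hx y hy hxy ↦
      B.deform_lt (hm hx) (hm hy) (hτ.strictMonoOn γ J hJ hx hy hxy)
        (B.strictMonoOn_of_fderiv_pos B.ρ'_lt.le (B.contDiff_h.differentiable (by simp))
          B.fderiv_h_pos hJ hm hx hy hxy)
    have outCore : ∀ J, IsCausalCurveOn τ γ J → MapsTo γ J B.coreᶜ →
        StrictMonoOn (B.deform T ∘ γ) J := fun J hJ hm x hx y hy hxy ↦ by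
      rw [Function.comp_apply, Function.comp_apply, B.deform_eqOn hT (hm hx),
        B.deform_eqOn hT (hm hy)]
      exact hτ.strictMonoOn γ J hJ hx hy hxy
    have local' : ∀ t, ∃ V, IsOpen V ∧ γ t ∈ V ∧ ∀ J, IsCausalCurveOn τ γ J → MapsTo γ J V →
        StrictMonoOn (B.deform T ∘ γ) J := by
      intro t
      by_cases h : γ t ∈ B.core
      · exact ⟨B.dom, B.isOpen_dom, B.core_sub_dom h, inDom⟩
      · exact ⟨B.coreᶜ, B.isClosed_core.isOpen_compl, h, outCore⟩
    have nbhd : ∀ t ∈ I, ∃ ε > 0, StrictMonoOn (B.deform T ∘ γ) (I ∩ Ioo (t - ε) (t + ε)) := by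
      intro t ht
      obtain ⟨V, hV, htV, H⟩ := local' t
      obtain ⟨ε, hε, hb⟩ := Metric.mem_nhdsWithin_iff.1
        ((hγ.continuousOn t ht).preimage_mem_nhdsWithin (hV.mem_nhds htV))
      refine ⟨ε, hε, H _ (hγ.mono (hγ.ordConnected.inter ordConnected_Ioo) inter_subset_left) ?_⟩
      intro s hs
      rw [Real.ball_eq_Ioo] at hb
      exact hb ⟨hs.2, hs.1⟩
    refine strictMonoOn_of_local hγ.ordConnected (fun t ht u hu htu ↦ ?_) fun t ht u hu htu ↦ ?_
    · obtain ⟨ε, hε, H⟩ := nbhd t ht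
      refine ⟨min u (t + ε / 2), ⟨lt_min htu (by linarith), min_le_left _ _⟩, fun s hs ↦
        H ⟨ht, by linarith, by linarith⟩ ⟨?_, ?_, ?_⟩ hs.1⟩
      · exact hγ.ordConnected.out ht hu ⟨hs.1.le, hs.2.trans (min_le_left _ _)⟩
      · linarith [hs.1]
      · linarith [hs.2.trans (min_le_right _ _)]
    · obtain ⟨ε, hε, H⟩ := nbhd t ht
      refine ⟨max u (t - ε / 2), ⟨le_max_left _ _, max_lt htu (by linarith)⟩, fun s hs ↦
        H ⟨?_, ?_, ?_⟩ ⟨ht, by linarith, by linarith⟩ hs.2⟩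
      · exact hγ.ordConnected.out hu ht ⟨(le_max_left _ _).trans hs.1, hs.2.le⟩
      · linarith [(le_max_right _ _).trans hs.1]
      · linarith [hs.2]

/-- The open set on which the deformation makes negative a time function that is at most zero. -/
def negSet : Set M := {x ∈ B.dom | B.h (extChartAt (𝓡 d) p x) < 0}

lemma negSet_mem_nhds : B.negSet ∈ 𝓝 p := by
  have h1 : ContinuousAt (fun x ↦ B.h (extChartAt (𝓡 d) p x)) p :=
    B.contDiff_h.continuous.continuousAt.comp (continuousAt_extChartAt p)
  have h2 : B.dom ∈ 𝓝 p := B.isOpen_dom.mem_nhds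
    ⟨mem_extChartAt_source p, mem_ball_self (B.ρ_nonneg.trans_lt B.ρ_lt)⟩
  filter_upwards [h2, h1.eventually (gt_mem_nhds B.h_neg)] with x hx hh
  exact ⟨hx, hh⟩

lemma deform_neg {x : M} (hx : x ∈ B.negSet) (hT : T x ≤ 0) : B.deform T x < 0 := by
  rw [B.deform_of_mem hx.1]
  rcases hT.lt_or_eq with h | h
  · linarith [B.θ_nonneg (T x - B.h (extChartAt (𝓡 d) p x))]
  · rw [h]
    linarith [B.θ_pos (0 - B.h (extChartAt (𝓡 d) p x)) (by linarith [B.δ_pos, hx.2])]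

lemma deform_ne {x : M} (hT : ∀ x, T x ≤ T₀ x) (h : B.deform T x ≠ T x) : x ∈ B.core := by
  by_contra hx
  exact h (B.deform_of_notMem_core hT hx)

/-- At a new point `q` of the level set, `T q > 0`. The vertical curve backwards from `q` leaves the
core; there `T` equals its deformation, which is negative since it increases along the curve. So `T`
has a zero in between. -/
lemma level_subset_causalFuture [T2Space M] (hT : ∀ x, T x ≤ T₀ x) (hτ : IsTimeFunction τ T) :
    B.deform T ⁻¹' {0} ⊆ causalFuture τ (T ⁻¹' {0}) := by
  intro q (hq : B.deform T q = 0)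
  have h0 := B.deform_le (T := T) q
  rw [hq] at h0
  rcases h0.eq_or_lt with h | h
  · exact ⟨q, h.symm, Or.inl rfl⟩
  obtain ⟨γ, a, b, ha, hb, hγ, rfl, hga, -⟩ := ConeChart.exists_vertical B.ρ_nonneg B.ρ_lt B.ρ'_lt
    (B.deform_ne hT (by rw [hq]; exact h.ne))
  have hγ0 := hγ.mono le_rfl ha hb.le
  have h1 := (B.isTimeFunction_deform hT hτ).strictMonoOn _ _ hγ0.isCausalCurveOn
    ⟨le_rfl, ha.le⟩ ⟨ha.le, le_rfl⟩ ha
  simp only [Function.comp_apply] at h1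
  rw [hq, B.deform_of_notMem_core hT hga] at h1
  obtain ⟨t, ht, htT⟩ := intermediate_value_Icc ha.le
    (hτ.contMDiff.continuous.comp_continuousOn hγ0.1.continuousOn)
    (show (0 : ℝ) ∈ Icc _ _ from ⟨h1.le, h.le⟩)
  have ht0 : t < 0 := lt_of_le_of_ne ht.2 fun h' ↦ by
    rw [h'] at htT; exact h.ne htT.symm
  exact ⟨γ t, htT, Or.inr ⟨γ, t, 0, ht0, (hγ0.mono ht.1 ht0 le_rfl).isCausalCurveOn, rfl, rfl⟩⟩

lemma level_subset_causalPast [T2Space M] (hT : ∀ x, T x ≤ T₀ x) (hτ : IsTimeFunction τ T) :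
    T ⁻¹' {0} ⊆ causalPast τ (B.deform T ⁻¹' {0}) := by
  intro q (hq : T q = 0)
  have h0 := B.deform_le (T := T) q
  rw [hq] at h0
  rcases h0.eq_or_lt with h | h
  · exact ⟨q, h, Or.inl rfl⟩
  obtain ⟨γ, a, b, ha, hb, hγ, rfl, -, hgb⟩ := ConeChart.exists_vertical B.ρ_nonneg B.ρ_lt B.ρ'_lt
    (B.deform_ne hT (by rw [hq]; exact h.ne))
  have hγ0 := hγ.mono ha.le hb le_rfl
  have h1 := hτ.strictMonoOn _ _ hγ0.isCausalCurveOn ⟨le_rfl, hb.le⟩ ⟨hb.le, le_rfl⟩ hb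
  simp only [Function.comp_apply] at h1
  rw [hq, ← B.deform_of_notMem_core hT hgb] at h1
  obtain ⟨t, ht, htT⟩ := intermediate_value_Icc hb.le
    ((B.isTimeFunction_deform hT hτ).contMDiff.continuous.comp_continuousOn hγ0.1.continuousOn)
    (show (0 : ℝ) ∈ Icc _ _ from ⟨h.le, h1.le⟩)
  have ht0 : 0 < t := lt_of_le_of_ne ht.1 fun h' ↦ by
    rw [← h'] at htT; exact h.ne htT
  exact ⟨γ t, htT, Or.inr ⟨γ, 0, t, ht0, (hγ0.mono le_rfl ht0 ht.2).isCausalCurveOn, rfl, rfl⟩⟩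

/-- Suppose the curve meets only the new slice. Before the meeting point the deformation is at most
0, while `T` is nonnegative there and has no zero, so it stays positive. The two functions then
differ at all earlier points, which confines the past of the curve to the compact core. The converse
confines the future in the same way. -/
lemma meets_iff [T2Space M] (hT : ∀ x, T x ≤ T₀ x) (hτ : IsTimeFunction τ T) {γ : ℝ → M}
    {I : Set ℝ} (hγ : IsInextendibleCausalCurve τ γ I) :
    (γ '' I ∩ B.deform T ⁻¹' {0}).Nonempty ↔ (γ '' I ∩ T ⁻¹' {0}).Nonempty := by
  have hd := B.isTimeFunction_deform hT hτ
  have hcT : ContinuousOn (T ∘ γ) I := hτ.contMDiff.continuous.comp_continuousOn hγ.1.continuousOn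
  have hcd : ContinuousOn (B.deform T ∘ γ) I :=
    hd.contMDiff.continuous.comp_continuousOn hγ.1.continuousOn
  constructor
  · rintro ⟨_, ⟨t₀, ht₀, rfl⟩, (h0 : B.deform T (γ t₀) = 0)⟩
    by_contra hne
    have hne' : ∀ t ∈ I, T (γ t) ≠ 0 := fun t ht h ↦ hne ⟨γ t, ⟨t, ht, rfl⟩, h⟩
    obtain ⟨t, ht, htt, hmem⟩ := ConeChart.not_forall_le_mem_cball B.ρ_lt_R hγ ht₀
    refine hmem (B.deform_ne hT (ne_of_lt ?_))
    have h1 : B.deform T (γ t) ≤ 0 := by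
      rw [← h0]; exact (hd.strictMonoOn γ I hγ.1).monotoneOn ht ht₀ htt
    refine h1.trans_lt ?_
    by_contra! h2
    have h3 : 0 ≤ T (γ t₀) := by rw [← h0]; exact B.deform_le _
    obtain ⟨s, hs, hs0⟩ := intermediate_value_Icc htt
      (hcT.mono (hγ.1.ordConnected.out ht ht₀)) (show (0 : ℝ) ∈ Icc _ _ from ⟨h2, h3⟩)
    exact hne' s (hγ.1.ordConnected.out ht ht₀ hs) hs0
  · rintro ⟨_, ⟨t₀, ht₀, rfl⟩, (h0 : T (γ t₀) = 0)⟩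
    by_contra hne
    have hne' : ∀ t ∈ I, B.deform T (γ t) ≠ 0 := fun t ht h ↦ hne ⟨γ t, ⟨t, ht, rfl⟩, h⟩
    obtain ⟨t, ht, htt, hmem⟩ := ConeChart.not_forall_ge_mem_cball B.ρ_lt_R hγ ht₀
    refine hmem (B.deform_ne hT (ne_of_lt ?_))
    have h1 : 0 ≤ T (γ t) := by
      rw [← h0]; exact (hτ.strictMonoOn γ I hγ.1).monotoneOn ht₀ ht htt
    refine lt_of_lt_of_le ?_ h1
    by_contra! h2
    have h3 : B.deform T (γ t₀) ≤ 0 := by rw [← h0]; exact B.deform_le _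
    obtain ⟨s, hs, hs0⟩ := intermediate_value_Icc htt
      (hcd.mono (hγ.1.ordConnected.out ht₀ ht)) (show (0 : ℝ) ∈ Icc _ _ from ⟨h3, h2⟩)
    exact hne' s (hγ.1.ordConnected.out ht₀ ht hs) hs0

lemma domainOfDependence_level [T2Space M] (hT : ∀ x, T x ≤ T₀ x) (hτ : IsTimeFunction τ T) :
    domainOfDependence τ (B.deform T ⁻¹' {0}) = domainOfDependence τ (T ⁻¹' {0}) := by
  ext x
  exact forall_congr' fun γ ↦ forall_congr' fun I ↦ forall_congr' fun hγ ↦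
    forall_congr' fun _ ↦ B.meets_iff hT hτ hγ

end LocalTime

/-- A time function whose zero set passes strictly to the future of finitely many pieces of the
zero set of `T₀`. -/
lemma exists_deformation [T2Space M] {T₀ : M → ℝ} (hT₀ : IsTimeFunction τ T₀) {k : ℕ∞}
    (hk : ContMDiff (𝓡 d) 𝓘(ℝ, ℝ) k T₀) {U : Set M} {ι : Type*} {c : ι → M}
    (B : ∀ i, LocalTime τ T₀ (c i) U) (s : Finset ι) :
    ∃ T : M → ℝ, IsTimeFunction τ T ∧ ContMDiff (𝓡 d) 𝓘(ℝ, ℝ) k T ∧ (∀ x, T x ≤ T₀ x) ∧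
      (∀ x, T x ≠ T₀ x → x ∈ U) ∧
      domainOfDependence τ (T ⁻¹' {0}) = domainOfDependence τ (T₀ ⁻¹' {0}) ∧
      T ⁻¹' {0} ⊆ causalFuture τ (T₀ ⁻¹' {0}) ∧ T₀ ⁻¹' {0} ⊆ causalPast τ (T ⁻¹' {0}) ∧
      ∀ i ∈ s, ∀ x ∈ (B i).negSet, T₀ x ≤ 0 → T x < 0 := by
  classical
  induction s using Finset.induction_on with
  | empty =>
    exact ⟨T₀, hT₀, hk, fun _ ↦ le_rfl, fun x h ↦ (h rfl).elim, rfl,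
      fun q hq ↦ ⟨q, hq, Or.inl rfl⟩, fun q hq ↦ ⟨q, hq, Or.inl rfl⟩, by simp⟩
  | insert i s _ ih =>
    obtain ⟨T, hτ, hTk, hT, hU, hdom, hfut, hpast, hneg⟩ := ih
    refine ⟨(B i).deform T, (B i).isTimeFunction_deform hT hτ, (B i).contMDiff_deform hT hTk,
      fun x ↦ ((B i).deform_le x).trans (hT x), fun x hx ↦ ?_,
      ((B i).domainOfDependence_level hT hτ).trans hdom,
      ((B i).level_subset_causalFuture hT hτ).trans (causalFuture_subset_of_subset hfut),
      hpast.trans (causalPast_subset_of_subset ((B i).level_subset_causalPast hT hτ)),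
      fun j hj x hx hx0 ↦ ?_⟩
    · by_cases h : (B i).deform T x = T x
      · exact hU x (h ▸ hx)
      · exact (B i).core_sub ((B i).deform_ne hT h)
    · rcases Finset.mem_insert.1 hj with rfl | hj
      · exact (B j).deform_neg hx ((hT x).trans hx0)
      · exact ((B i).deform_le x).trans_lt (hneg j hj x hx hx0)

end Spacetime

/-! ### Level sets and causal order; the theorem -/

namespace Spacetime

section

variable {d : ℕ} {M : Type*} [TopologicalSpace M] [ChartedSpace (EuclideanSpace ℝ (Fin d)) M]
  [IsManifold (𝓡 d) ∞ M] {g : LorentzianMetric d M} {τ : TimeOrientation g}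

lemma IsTimeFunction.sub_const {T : M → ℝ} (hT : IsTimeFunction τ T) (c : ℝ) :
    IsTimeFunction τ (fun x ↦ T x - c) where
  contMDiff := hT.contMDiff.sub contMDiff_const
  strictMonoOn γ I hγ _ hx _ hy hxy := sub_lt_sub_right (hT.strictMonoOn γ I hγ hx hy hxy) c

lemma IsTimeFunction.le_of_mem_causalFuture {T : M → ℝ} (hT : IsTimeFunction τ T) {c : ℝ} {q : M}
    (hq : q ∈ causalFuture τ (T ⁻¹' {c})) : c ≤ T q := by
  obtain ⟨p, hp : T p = c, rfl | ⟨γ, a, b, hab, hγ, rfl, rfl⟩⟩ := hq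
  · exact hp.ge
  · rw [← hp]
    exact (hT.strictMonoOn γ _ hγ ⟨le_rfl, hab.le⟩ ⟨hab.le, le_rfl⟩ hab).le

lemma IsTimeFunction.le_of_mem_causalPast {T : M → ℝ} (hT : IsTimeFunction τ T) {c : ℝ} {q : M}
    (hq : q ∈ causalPast τ (T ⁻¹' {c})) : T q ≤ c := by
  obtain ⟨p, hp : T p = c, rfl | ⟨γ, a, b, hab, hγ, rfl, rfl⟩⟩ := hq
  · exact hp.le
  · rw [← hp]
    exact (hT.strictMonoOn γ _ hγ ⟨le_rfl, hab.le⟩ ⟨hab.le, le_rfl⟩ hab).le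

end

end Spacetime

theorem mainTheorem2 {d : ℕ} {M : Type*} [TopologicalSpace M]
    [ChartedSpace (EuclideanSpace ℝ (Fin d)) M] [IsManifold (𝓡 d) ∞ M]
    [T2Space M] [SecondCountableTopology M]
    (g : Spacetime.LorentzianMetric d M) (τ : Spacetime.TimeOrientation g)
    (k : ℕ∞) (hk : 1 ≤ k) (S : Set M) (hS : Spacetime.IsTimeslice τ k S)
    (X : Set M) (hXS : X ⊆ S) (hX : IsCompact X) (U : Set M) (hU : IsOpen U) (hXU : X ⊆ U) :
    ∃ S' : Set M, Spacetime.IsTimeslice τ k S' ∧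
      Spacetime.IsForwardCauchyEvolution τ U S S' ∧ S' ∩ S ∩ X = ∅ := by
  obtain ⟨T, c, hT, hTk, hST⟩ := hS
  set T₀ : M → ℝ := fun x ↦ T x - c with hT₀
  have hT₀τ : Spacetime.IsTimeFunction τ T₀ := hT.sub_const c
  have hS₀ : S = T₀ ⁻¹' {0} := by
    rw [hST]; ext x; simp [hT₀, sub_eq_zero]
  subst hS₀
  let B : ∀ p : X, Spacetime.LocalTime τ T₀ p U := fun p ↦
    (Spacetime.exists_localTime hT₀τ (hXS p.2) (hU.mem_nhds (hXU p.2))).some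
  obtain ⟨s, hs⟩ := hX.elim_nhds_subcover' (fun p hp ↦ (B ⟨p, hp⟩).negSet)
    fun p hp ↦ (B ⟨p, hp⟩).negSet_mem_nhds
  obtain ⟨T', hT'τ, hT'k, -, hT'U, hdom, hfut, hpast, hneg⟩ :=
    Spacetime.exists_deformation hT₀τ (hTk.sub contMDiff_const) B s
  refine ⟨T' ⁻¹' {0}, ⟨T', 0, hT'τ, hT'k, rfl⟩, ⟨hdom, hfut, hpast, fun x hx ↦ hT'U x fun h ↦ ?_,
    fun x hx ↦ hT'U x fun h ↦ ?_⟩, ?_⟩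
  · rcases hx with ⟨h1, h2⟩ | ⟨h1, h2⟩
    · exact h2 (h.trans h1)
    · exact h2 (h.symm.trans h1)
  -- Between the slices `T₀ ≥ 0` and `T' ≤ 0`. Where the two functions agree both vanish, so the
  -- point is on the original slice; elsewhere it lies in `U`.
  · refine hx.2 (le_antisymm ?_ (hT₀τ.le_of_mem_causalFuture hx.1.1))
    rw [← h]
    exact hT'τ.le_of_mem_causalPast hx.1.2
  -- A point of `X` has `T₀ = 0` and lies in one of the selected sets `negSet`, so `T'` is negative
  -- there.
  · refine eq_empty_of_forall_notMem fun x hx ↦ ?_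
    obtain ⟨i, hi, hxi⟩ := mem_iUnion₂.1 (hs hx.2)
    exact (hneg i hi x hxi (le_of_eq hx.1.2)).ne hx.1.1
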